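/- Let $(M^3,g)$ be a smooth $3$-dimensional Riemannian manifold of constant sectional curvature $c\in\mathbb{R}$ (a space form; completeness is not needed), let $(N^2,h)$ be a smooth $2$-dimensional Riemannian manifold, and let $\pi:(M^3,g)\to(N^2,h)$ be a Riemannian submersion, i.e. a smooth map whose differential is surjective at every point and preserves the length of vectors orthogonal to its kernel. Then $\pi$ is biharmonic if and only if it is harmonic. Here, for a smooth map $\varphi:(M,g)\to(N,h)$, $\tau(\varphi)=\operatorname{Trace}_g\nabla d\varphi$ is the tension field; $\varphi$ is harmonic if $\tau(\varphi)\equiv 0$, and biharmonic if it is a critical point of the bienergy $$E^2(\varphi,\Omega)=\frac12\int_\Omega|\tau(\varphi)|^2\,dv_g$$ for every compact subset $\Omega\subset M$, i.e. $\frac{d}{dt}\big|_{t=0}E^2(\varphi_t,\Omega)=0$ for every smooth variation $(\varphi_t)_{t\in\mathbb{R}}$ of $\varphi=\varphi_0$ with $\varphi_t=\varphi$ outside $\Omega$ for all $t$. -/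

import Mathlib

open Bundle MeasureTheory
open scoped Manifold ContDiff

noncomputable section

namespace RiemGeom

/-- The `i`-th partial derivative of a function on `ℝᵐ`. -/
def pderiv {m : ℕ} (i : Fin m) (f : EuclideanSpace ℝ (Fin m) → ℝ)
    (u : EuclideanSpace ℝ (Fin m)) : ℝ :=
  fderiv ℝ f u (EuclideanSpace.single i 1)

/-! ### Local Riemannian geometry in the preferred charts

Below, `u` ranges over the target of the chart around `x₀`, an open subset of `ℝᵐ`. -/

section Metric

variable {m : ℕ} {M : Type*} [TopologicalSpace M] [ChartedSpace (EuclideanSpace ℝ (Fin m)) M]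
  [IsManifold (𝓡 m) ∞ M]

/-- The coordinate vector `∂ᵢ` at the point `x` for the chart around `x₀`
(meaningful for `x` in the domain of that chart). -/
def coordVec (x₀ x : M) (i : Fin m) : TangentSpace (𝓡 m) x :=
  (trivializationAt (EuclideanSpace ℝ (Fin m)) (TangentSpace (𝓡 m)) x₀).symmL ℝ x
    (EuclideanSpace.single i 1 : EuclideanSpace ℝ (Fin m))

variable [RiemannianBundle (fun x : M ↦ TangentSpace (𝓡 m) x)]

/-- The matrix `g i j = ⟨∂ᵢ, ∂ⱼ⟩` of the metric in the chart around `x₀`. -/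
def metricMatrix (x₀ : M) (u : EuclideanSpace ℝ (Fin m)) : Matrix (Fin m) (Fin m) ℝ :=
  Matrix.of fun i j ↦
    inner ℝ (coordVec x₀ ((extChartAt (𝓡 m) x₀).symm u) i)
      (coordVec x₀ ((extChartAt (𝓡 m) x₀).symm u) j)

/-- The Christoffel symbols `Γᵏᵢⱼ` of the Levi-Civita connection: `∇_{∂ᵢ} ∂ⱼ = ∑ₖ Γᵏᵢⱼ ∂ₖ`. -/
def christoffel (x₀ : M) (k i j : Fin m) (u : EuclideanSpace ℝ (Fin m)) : ℝ :=
  (1 / 2) * ∑ l, (metricMatrix x₀ u)⁻¹ k l *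
    (pderiv i (fun w ↦ metricMatrix x₀ w j l) u + pderiv j (fun w ↦ metricMatrix x₀ w i l) u
      - pderiv l (fun w ↦ metricMatrix x₀ w i j) u)

/-- The components of `R(X,Y)Z = [∇_X, ∇_Y]Z - ∇_{[X,Y]}Z`:
`R(∂ᵢ, ∂ⱼ)∂ₖ = ∑ₗ (curvatureCoeff x₀ l i j k) ∂ₗ`. -/
def curvatureCoeff (x₀ : M) (l i j k : Fin m) (u : EuclideanSpace ℝ (Fin m)) : ℝ :=
  pderiv i (christoffel x₀ l j k) u - pderiv j (christoffel x₀ l i k) u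
    + ∑ p, (christoffel x₀ l i p u * christoffel x₀ p j k u
      - christoffel x₀ l j p u * christoffel x₀ p i k u)

/-- `⟨X, Y⟩` for `X = ∑ aⁱ ∂ᵢ` and `Y = ∑ bʲ ∂ⱼ`. -/
def metricForm (x₀ : M) (u : EuclideanSpace ℝ (Fin m)) (a b : Fin m → ℝ) : ℝ :=
  ∑ i, ∑ j, metricMatrix x₀ u i j * a i * b j

/-- The coordinates of `R(X, Y)Z` for `X = ∑ aⁱ ∂ᵢ`, `Y = ∑ bʲ ∂ⱼ`, `Z = ∑ cᵏ ∂ₖ`. -/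
def curvatureVec (x₀ : M) (u : EuclideanSpace ℝ (Fin m)) (a b c : Fin m → ℝ) : Fin m → ℝ :=
  fun l ↦ ∑ i, ∑ j, ∑ k, curvatureCoeff x₀ l i j k u * a i * b j * c k

/-- The sectional curvature `⟨R(X,Y)Y, X⟩ / (|X|²|Y|² - ⟨X,Y⟩²)` of the plane spanned by the
linearly independent vectors `X = ∑ aⁱ ∂ᵢ` and `Y = ∑ bʲ ∂ⱼ`. -/
def sectionalCurvature (x₀ : M) (u : EuclideanSpace ℝ (Fin m)) (a b : Fin m → ℝ) : ℝ :=
  metricForm x₀ u (curvatureVec x₀ u a b b) a /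
    (metricForm x₀ u a a * metricForm x₀ u b b - metricForm x₀ u a b ^ 2)

variable (m M) in
/-- All sectional curvatures of the Riemannian manifold `M` are equal to `c`. -/
def HasConstantSectionalCurvature (c : ℝ) : Prop :=
  ∀ x₀ : M, ∀ u ∈ (extChartAt (𝓡 m) x₀).target, ∀ a b : Fin m → ℝ,
    LinearIndependent ℝ ![a, b] → sectionalCurvature x₀ u a b = c

variable [MeasurableSpace M]

/-- The Riemannian volume `√(det g) du¹ ⋯ duᵐ` of the domain of the chart around `x₀`, as a measure
on `M` that gives no mass to the complement of that domain. -/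
def chartVolume (x₀ : M) : Measure M :=
  Measure.map (extChartAt (𝓡 m) x₀).symm
    ((volume.restrict (extChartAt (𝓡 m) x₀).target).withDensity
      fun u ↦ ENNReal.ofReal (√(metricMatrix x₀ u).det))

variable (m M) in
/-- The Riemannian volume measure. Any two of the measures `chartVolume x₀` agree on the
intersection of the chart domains, and countably many chart domains cover a second countable
manifold; hence their supremum is the measure that restricts to `chartVolume x₀` on the domain of
the chart around `x₀`, for every `x₀`. -/
def riemannianVolume : Measure M := ⨆ x₀ : M, chartVolume (m := m) x₀

end Metric

/-! ### Tension field, harmonic and biharmonic maps, Riemannian submersions -/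

section Maps

variable {m n : ℕ}
  {M : Type*} [TopologicalSpace M] [ChartedSpace (EuclideanSpace ℝ (Fin m)) M]
  [IsManifold (𝓡 m) ∞ M] [RiemannianBundle (fun x : M ↦ TangentSpace (𝓡 m) x)]
  {N : Type*} [TopologicalSpace N] [ChartedSpace (EuclideanSpace ℝ (Fin n)) N]
  [IsManifold (𝓡 n) ∞ N] [RiemannianBundle (fun y : N ↦ TangentSpace (𝓡 n) y)]

/-- The `γ`-th component of `φ` in the charts around `x₀` and `φ x₀`. -/
def coordMap (φ : M → N) (x₀ : M) (γ : Fin n) (u : EuclideanSpace ℝ (Fin m)) : ℝ :=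
  writtenInExtChartAt (𝓡 m) (𝓡 n) x₀ φ u γ

/-- The `γ`-th component of `(∇dφ)(∂ᵢ, ∂ⱼ)`, the second fundamental form of `φ`, at the point with
coordinates `u`, in the charts around `x₀` and `φ x₀`. -/
def secondFundamentalForm (φ : M → N) (x₀ : M) (γ : Fin n) (i j : Fin m)
    (u : EuclideanSpace ℝ (Fin m)) : ℝ :=
  pderiv i (pderiv j (coordMap φ x₀ γ)) u
    - ∑ k, christoffel x₀ k i j u * pderiv k (coordMap φ x₀ γ) u
    + ∑ α, ∑ β, christoffel (φ x₀) γ α β (writtenInExtChartAt (𝓡 m) (𝓡 n) x₀ φ u)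
        * pderiv i (coordMap φ x₀ α) u * pderiv j (coordMap φ x₀ β) u

variable (m n) in
/-- The tension field `τ(φ) = trace_g ∇dφ`, a vector field along `φ`. -/
def tensionField (φ : M → N) (x : M) : TangentSpace (𝓡 n) (φ x) :=
  ∑ γ : Fin n, (∑ i, ∑ j, (metricMatrix x (extChartAt (𝓡 m) x x))⁻¹ i j
    * secondFundamentalForm φ x γ i j (extChartAt (𝓡 m) x x)) • coordVec (φ x) (φ x) γ

variable (m n) in
/-- `φ` is harmonic if its tension field vanishes identically. -/
def IsHarmonicMap (φ : M → N) : Prop := ∀ x : M, tensionField m n φ x = 0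

variable (m n) in
/-- The bienergy `E²(φ, Ω) = ½ ∫_Ω |τ(φ)|² dv_g`. -/
def bienergy [MeasurableSpace M] (φ : M → N) (Ω : Set M) : ℝ :=
  (1 / 2) * ∫ x in Ω, ‖tensionField m n φ x‖ ^ 2 ∂(riemannianVolume m M)

variable (m n) in
/-- `φ` is biharmonic if it is a critical point of the bienergy on every compact set `Ω`, that is,
with respect to all smooth variations `Φ` of `φ` that leave `φ` fixed outside `Ω`. -/
def IsBiharmonicMap [MeasurableSpace M] (φ : M → N) : Prop :=
  ∀ Ω : Set M, IsCompact Ω → ∀ Φ : ℝ → M → N,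
    ContMDiff (𝓘(ℝ, ℝ).prod (𝓡 m)) (𝓡 n) ∞ (fun p : ℝ × M ↦ Φ p.1 p.2) →
    Φ 0 = φ → (∀ t : ℝ, ∀ x ∉ Ω, Φ t x = φ x) →
    HasDerivAt (fun t : ℝ ↦ bienergy m n (Φ t) Ω) 0 0

variable (m n) in
/-- A Riemannian submersion: a smooth submersion whose differential preserves the length of
horizontal vectors, i.e. of the vectors orthogonal to the kernel of the differential. -/
structure IsRiemannianSubmersion (φ : M → N) : Prop where
  contMDiff : ContMDiff (𝓡 m) (𝓡 n) ∞ φ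
  surjective : ∀ x : M, Function.Surjective (mfderiv (𝓡 m) (𝓡 n) φ x)
  norm_eq : ∀ (x : M) (v : TangentSpace (𝓡 m) x),
    (∀ w : TangentSpace (𝓡 m) x, mfderiv (𝓡 m) (𝓡 n) φ x w = 0 → inner ℝ v w = 0) →
    ‖mfderiv (𝓡 m) (𝓡 n) φ x v‖ = ‖v‖

end Maps

end RiemGeom

end

noncomputable section

set_option linter.unusedSectionVars false
set_option linter.unusedSimpArgs false
set_option synthInstance.maxHeartbeats 200000

/-! Harmonic implies biharmonic for every smooth map. If `τ(Φ 0) = 0`, the tension field of a smooth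
variation depends smoothly on `t` and vanishes at `t = 0`, so on a compact set `|τ(Φ t)|² ≤ C t²`
for small `t`, and the bienergy has derivative zero (`exists_norm_tensionField_sq_le`,
`IsHarmonicMap.isBiharmonicMap`).

The converse is local. Near any point of the total space there is an orthonormal frame e₁, e₂, e₃ in
which e₁, e₂ are the horizontal lifts of an orthonormal frame of the surface and e₃ is vertical
(`exists_isAdaptedFrame`). Its connection is described by five functions
(`IsAdaptedFrame.connCoeff_eq`): the connection θ₁, θ₂ of the surface, constant along the fibres,
the mean curvature κ = (κ₁, κ₂) of the fibres, and the integrability function σ of the horizontal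
planes. The tension field is -κ (`sum_sff_eq`), so the claim is κ = 0. Constant curvature c
prescribes the horizontal derivatives of κ, gives eᵢσ = 2κᵢσ, and yields O'Neill's formula K = c +
3σ² for the curvature of the surface (`structureEquations`).

The first variation of the bienergy, tested on fields supported in a chart, together with the
divergence theorem in the frame (`integral_frame_divergence`, `integral_jac_eq`) and the fundamental
lemma of the calculus of variations, says that κ is a Jacobi field
(`IsBiharmonicMap.jac_kappa_eq_zero`).

If κ were nonzero somewhere, there would be a nonempty open set on which κ has no zero and σ either
has no zero or vanishes identically. Both cases are refuted by algebra in the ring of smooth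
functions with the derivations e₁, e₂, e₃.

If σ has no zero: K is constant along the fibres, hence so is σ by O'Neill's formula, and then so is
κ. The Jacobi equation becomes 3c - 3σ² + |κ|² = 0; horizontal differentiation gives c + 2σ² = 0, a
second one gives σ²κ = 0 (`false_of_sigma_ne_zero`).

If σ = 0: the Jacobi equation is κ'' = -(3c + |κ|²)κ along the fibres. Its horizontal derivatives
are quadratic identities in κ and κ', from which first κ·κ' = 0 and then κ' = 0 follow. Now 3c +
|κ|² = 0, and the same identities give c = 0, so κ = 0 (`false_of_sigma_eq_zero`). -/

namespace RiemGeom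

/-! ### Riemannian geometry on an open subset of a vector space. -/

section LocalCalculus

variable {E F G : Type*} [NormedAddCommGroup E] [NormedSpace ℝ E]
  [NormedAddCommGroup F] [NormedSpace ℝ F] [NormedAddCommGroup G] [NormedSpace ℝ G]

/-- `g` is a smooth Riemannian metric on the open set `U` of a vector space, and `Γ` is the
Christoffel map of its Levi-Civita connection. -/
structure IsLocalMetric (U : Set E) (g : E → E →L[ℝ] E →L[ℝ] ℝ)
    (Γ : E → E →L[ℝ] E →L[ℝ] E) : Prop where
  isOpen : IsOpen U
  contDiffOn : ContDiffOn ℝ ∞ g U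
  contDiffOn_chr : ContDiffOn ℝ ∞ Γ U
  symm : ∀ u ∈ U, ∀ a b, g u a b = g u b a
  pos : ∀ u ∈ U, ∀ a, a ≠ 0 → 0 < g u a a
  koszul : ∀ u ∈ U, ∀ a b c, 2 * g u (Γ u a b) c =
    fderiv ℝ g u a b c + fderiv ℝ g u b a c - fderiv ℝ g u c a b

/-- The covariant derivative `∇_X Y` of vector fields on an open set of a vector space. -/
def cov (Γ : E → E →L[ℝ] E →L[ℝ] E) (X Y : E → E) (u : E) : E :=
  fderiv ℝ Y u (X u) + Γ u (X u) (Y u)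

/-- The curvature `R(a, b)c` of the connection with Christoffel map `Γ`. -/
def curv (Γ : E → E →L[ℝ] E →L[ℝ] E) (u a b c : E) : E :=
  fderiv ℝ Γ u a b c - fderiv ℝ Γ u b a c + Γ u a (Γ u b c) - Γ u b (Γ u a c)

/-- The second fundamental form `(∇df)(a, b)`. -/
def sff (Γ : E → E →L[ℝ] E →L[ℝ] E) (Γ' : F → F →L[ℝ] F →L[ℝ] F) (f : E → F) (u a b : E) : F :=
  fderiv ℝ (fderiv ℝ f) u a b - fderiv ℝ f u (Γ u a b)
    + Γ' (f u) (fderiv ℝ f u a) (fderiv ℝ f u b)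

theorem ContDiffOn.differentiableAt_of_isOpen {U : Set E} (hU : IsOpen U) {f : E → F}
    (hf : ContDiffOn ℝ ∞ f U) {u : E} (hu : u ∈ U) : DifferentiableAt ℝ f u :=
  (hf.contDiffAt (hU.mem_nhds hu)).differentiableAt (by simp)

theorem contDiffOn_fderiv {U : Set E} (hU : IsOpen U) {f : E → F}
    (hf : ContDiffOn ℝ ∞ f U) : ContDiffOn ℝ ∞ (fderiv ℝ f) U :=
  hf.fderiv_of_isOpen hU (by simp)

theorem fderiv_congr_of_isOpen {U : Set E} (hU : IsOpen U) {f f' : E → F}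
    (h : ∀ u ∈ U, f u = f' u) {u : E} (hu : u ∈ U) : fderiv ℝ f u = fderiv ℝ f' u :=
  Filter.EventuallyEq.fderiv_eq (Filter.eventuallyEq_of_mem (hU.mem_nhds hu) h)

theorem fderiv_fderiv_symm {U : Set E} (hU : IsOpen U) {f : E → F}
    (hf : ContDiffOn ℝ ∞ f U) {u : E} (hu : u ∈ U) (a b : E) :
    fderiv ℝ (fderiv ℝ f) u a b = fderiv ℝ (fderiv ℝ f) u b a :=
  (hf.contDiffAt (hU.mem_nhds hu)).isSymmSndFDerivAt (by simpa using WithTop.coe_le_coe.2 (le_top (a := (2 : ℕ∞)))) a b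

theorem fderiv_fderiv_const {f : E → F} {u : E} (hf : DifferentiableAt ℝ (fderiv ℝ f) u) (a b : E) :
    fderiv ℝ (fun w ↦ fderiv ℝ f w b) u a = fderiv ℝ (fderiv ℝ f) u a b := by
  have h : HasFDerivAt (fun w ↦ fderiv ℝ f w b) _ u :=
    hf.hasFDerivAt.clm_apply (hasFDerivAt_const b u)
  rw [h.fderiv]; simp

theorem fderiv_comp_apply {f : E → F} {k : F → G} {u : E} (hf : DifferentiableAt ℝ f u)
    (hk : DifferentiableAt ℝ k (f u)) (a : E) :
    fderiv ℝ (fun w ↦ k (f w)) u a = fderiv ℝ k (f u) (fderiv ℝ f u a) := by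
  rw [fderiv_fun_comp u hk hf]; rfl

theorem differentiableAt_fun_comp {f : E → F} {k : F → G} {u : E} (hf : DifferentiableAt ℝ f u)
    (hk : DifferentiableAt ℝ k (f u)) : DifferentiableAt ℝ (fun w ↦ k (f w)) u :=
  hk.comp u hf

theorem fderiv_clm_apply_const₂ {g : E → F →L[ℝ] F →L[ℝ] G} {u : E}
    (hg : DifferentiableAt ℝ g u) (a : E) (b c : F) :
    fderiv ℝ (fun w ↦ g w b c) u a = fderiv ℝ g u a b c := by
  have h : HasFDerivAt (fun w ↦ g w b c) _ u :=
    (hg.hasFDerivAt.clm_apply (hasFDerivAt_const b u)).clm_apply (hasFDerivAt_const c u)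
  rw [h.fderiv]; simp

theorem fderiv_clm_apply₂ {g : E → F →L[ℝ] F →L[ℝ] G} {Y Z : E → F} {u : E}
    (hg : DifferentiableAt ℝ g u) (hY : DifferentiableAt ℝ Y u) (hZ : DifferentiableAt ℝ Z u)
    (a : E) :
    fderiv ℝ (fun w ↦ g w (Y w) (Z w)) u a =
      fderiv ℝ g u a (Y u) (Z u) + g u (fderiv ℝ Y u a) (Z u) + g u (Y u) (fderiv ℝ Z u a) := by
  have h : HasFDerivAt (fun w ↦ g w (Y w) (Z w)) _ u :=
    (hg.hasFDerivAt.clm_apply hY.hasFDerivAt).clm_apply hZ.hasFDerivAt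
  rw [h.fderiv]; simp; abel

theorem fderiv_clm_apply₁ {A : E → F →L[ℝ] G} {Y : E → F} {u : E}
    (hA : DifferentiableAt ℝ A u) (hY : DifferentiableAt ℝ Y u) (a : E) :
    fderiv ℝ (fun w ↦ A w (Y w)) u a = fderiv ℝ A u a (Y u) + A u (fderiv ℝ Y u a) := by
  have h : HasFDerivAt (fun w ↦ A w (Y w)) _ u := hA.hasFDerivAt.clm_apply hY.hasFDerivAt
  rw [h.fderiv]; simp; abel

namespace IsLocalMetric

variable {U : Set E} {g : E → E →L[ℝ] E →L[ℝ] ℝ} {Γ : E → E →L[ℝ] E →L[ℝ] E}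
  (h : IsLocalMetric U g Γ) {u : E} (hu : u ∈ U)

include h

theorem mono {V : Set E} (hV : IsOpen V) (hVU : V ⊆ U) : IsLocalMetric V g Γ where
  isOpen := hV
  contDiffOn := h.contDiffOn.mono hVU
  contDiffOn_chr := h.contDiffOn_chr.mono hVU
  symm u hu := h.symm u (hVU hu)
  pos u hu := h.pos u (hVU hu)
  koszul u hu := h.koszul u (hVU hu)

include hu

theorem differentiableAt : DifferentiableAt ℝ g u :=
  ContDiffOn.differentiableAt_of_isOpen h.isOpen h.contDiffOn hu

theorem differentiableAt_chr : DifferentiableAt ℝ Γ u :=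
  ContDiffOn.differentiableAt_of_isOpen h.isOpen h.contDiffOn_chr hu

theorem eq_of_forall {x y : E} (hxy : ∀ c, g u x c = g u y c) : x = y := by
  by_contra hne
  have := h.pos u hu (x - y) (sub_ne_zero.2 hne)
  simp [hxy] at this

theorem fderiv_symm (a b c : E) : fderiv ℝ g u a b c = fderiv ℝ g u a c b := by
  rw [← fderiv_clm_apply_const₂ (h.differentiableAt hu),
    ← fderiv_clm_apply_const₂ (h.differentiableAt hu),
    fderiv_congr_of_isOpen h.isOpen (fun w hw ↦ h.symm w hw b c) hu]

/-- The right-hand side of the Koszul formula is symmetric in the first two arguments, and `g` is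
nondegenerate. -/
theorem chr_symm (a b : E) : Γ u a b = Γ u b a := by
  refine h.eq_of_forall hu fun c ↦ ?_
  have h1 := h.koszul u hu a b c
  have h2 := h.koszul u hu b a c
  rw [h.fderiv_symm hu c b a] at h2
  linarith

/-- Adding the Koszul formulas for `(a, b, c)` and `(a, c, b)` cancels all but one derivative of the
metric. -/
theorem compat (a b c : E) :
    fderiv ℝ g u a b c = g u (Γ u a b) c + g u b (Γ u a c) := by
  have h1 := h.koszul u hu a b c
  have h2 := h.koszul u hu a c b
  rw [h.symm u hu b, h.fderiv_symm hu b a c, h.fderiv_symm hu c a b] at *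
  rw [h.fderiv_symm hu a c b] at h2
  linarith

theorem fderiv_metric {Y Z : E → E} (hY : DifferentiableAt ℝ Y u) (hZ : DifferentiableAt ℝ Z u)
    (X : E → E) :
    fderiv ℝ (fun w ↦ g w (Y w) (Z w)) u (X u) =
      g u (cov Γ X Y u) (Z u) + g u (Y u) (cov Γ X Z u) := by
  rw [fderiv_clm_apply₂ (h.differentiableAt hu) hY hZ, h.compat hu]
  simp [cov]; abel

omit h hu in
theorem _root_.RiemGeom.curv_antisymm (a b c : E) : curv Γ u a b c = - curv Γ u b a c := by
  simp [curv]; abel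

theorem curv_bianchi (a b c : E) : curv Γ u a b c + curv Γ u b c a + curv Γ u c a b = 0 := by
  have hs : ∀ x y z : E, fderiv ℝ Γ u x y z = fderiv ℝ Γ u x z y := fun x y z ↦ by
    rw [← fderiv_clm_apply_const₂ (h.differentiableAt_chr hu),
      ← fderiv_clm_apply_const₂ (h.differentiableAt_chr hu),
      fderiv_congr_of_isOpen h.isOpen (fun w hw ↦ h.chr_symm hw y z) hu]
  simp only [curv]
  rw [hs a b c, hs b c a, hs c a b, h.chr_symm hu b c, h.chr_symm hu a c, h.chr_symm hu a b]
  abel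

/-- The second derivative of the function `g(c, d)` is computed by applying metric compatibility
twice. It is symmetric in `a, b`; the mixed terms `g(Γ(b, c), Γ(a, d)) + g(Γ(b, d), Γ(a, c))` are
symmetric too, and what remains is the claim. -/
theorem curv_skew (a b c d : E) : g u (curv Γ u a b c) d = - g u (curv Γ u a b d) c := by
  have hφ : ContDiffOn ℝ ∞ (fun w ↦ g w c d) U :=
    (h.contDiffOn.clm_apply contDiffOn_const).clm_apply contDiffOn_const
  have key : ∀ a b : E, fderiv ℝ (fderiv ℝ (fun w ↦ g w c d)) u a b =
      g u (fderiv ℝ Γ u a b c) d + g u (Γ u a (Γ u b c)) d + g u (Γ u b c) (Γ u a d)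
      + (g u (fderiv ℝ Γ u a b d) c + g u (Γ u a (Γ u b d)) c + g u (Γ u b d) (Γ u a c)) := by
    intro a b
    have hΓ := h.differentiableAt_chr hu
    have hg := h.differentiableAt hu
    have hd : ∀ x y : E, DifferentiableAt ℝ (fun w ↦ Γ w x y) u := fun x y ↦
      (hΓ.clm_apply (differentiableAt_const x)).clm_apply (differentiableAt_const y)
    have e2 : ∀ x y : E, fderiv ℝ (fun w ↦ g w (Γ w b x) y) u a =
        g u (fderiv ℝ Γ u a b x) y + g u (Γ u a (Γ u b x)) y + g u (Γ u b x) (Γ u a y) := by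
      intro x y
      rw [fderiv_clm_apply₂ hg (hd b x) (differentiableAt_const y), h.compat hu,
        fderiv_clm_apply_const₂ hΓ]
      simp; ring
    have e3 : ∀ w ∈ U, fderiv ℝ (fun w ↦ g w c d) w b =
        g w (Γ w b c) d + g w (Γ w b d) c := fun w hw ↦ by
      rw [fderiv_clm_apply_const₂ (h.differentiableAt hw), h.compat hw, h.symm w hw c]
    rw [← fderiv_fderiv_const (ContDiffOn.differentiableAt_of_isOpen h.isOpen
      (contDiffOn_fderiv h.isOpen hφ) hu), fderiv_congr_of_isOpen h.isOpen e3 hu,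
      ← e2 c d, ← e2 d c, fderiv_fun_add]
    · rfl
    · exact (hg.clm_apply (hd b c)).clm_apply (differentiableAt_const d)
    · exact (hg.clm_apply (hd b d)).clm_apply (differentiableAt_const c)
  have k1 := key a b
  have k2 := key b a
  rw [fderiv_fderiv_symm h.isOpen hφ hu a b] at k1
  rw [h.symm u hu (Γ u a c), h.symm u hu (Γ u a d)] at k2
  simp only [curv, map_add, map_sub, add_apply, sub_apply]
  linarith

/-- A metric whose sectional curvatures are all equal to `c` has the curvature tensor
`R(x, y)z = c (⟨y, z⟩ x - ⟨x, z⟩ y)`. -/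
theorem curv_of_sectional {k : ℝ}
    (hk : ∀ a b, g u (curv Γ u a b b) a = k * (g u a a * g u b b - g u a b ^ 2)) (x y z : E) :
    curv Γ u x y z = k • (g u y z • x - g u x z • y) := by
  have addl : ∀ a a' b c : E, curv Γ u (a + a') b c = curv Γ u a b c + curv Γ u a' b c := by
    intros; simp only [curv, map_add, add_apply]; abel
  have addm : ∀ a b b' c : E, curv Γ u a (b + b') c = curv Γ u a b c + curv Γ u a b' c := by
    intro a b b' c
    rw [curv_antisymm, addl, curv_antisymm a b, curv_antisymm a b']; abel
  have addr : ∀ a b c c' : E, curv Γ u a b (c + c') = curv Γ u a b c + curv Γ u a b c' := by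
    intro a b c c'
    simp only [curv, (fderiv ℝ Γ u a b).map_add, (fderiv ℝ Γ u b a).map_add, (Γ u a).map_add,
      (Γ u b).map_add]
    abel
  -- `T` is the difference between the curvature tensor and the model of constant curvature `k`. It
  -- has all the symmetries of a curvature tensor and vanishing sectional curvatures, so
  -- polarization must show that it is zero. Hiding it behind an equation keeps the linear
  -- arithmetic in terms of its values.
  obtain ⟨T, hT⟩ : ∃ T : E → E → E → E → ℝ, T = fun a b c d ↦
    g u (curv Γ u a b c) d - k * (g u b c * g u a d - g u a c * g u b d) := ⟨_, rfl⟩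
  have t1 : ∀ a b c d, T a b c d = - T b a c d := fun a b c d ↦ by
    simp only [hT]; rw [curv_antisymm]; simp; ring
  have t2 : ∀ a b c d, T a b c d = - T a b d c := fun a b c d ↦ by
    simp only [hT]; rw [h.curv_skew hu]; ring
  have t3 : ∀ a b c d, T a b c d + T b c a d + T c a b d = 0 := fun a b c d ↦ by
    have := congrArg (fun v ↦ g u v d) (h.curv_bianchi hu a b c)
    simp only [map_add, add_apply, map_zero,
      zero_apply] at this
    simp only [hT]
    rw [h.symm u hu b a, h.symm u hu c a, h.symm u hu c b]
    linear_combination this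
  have pair : ∀ a b c d, T a b c d = T c d a b := fun a b c d ↦ by
    have e1 := t1 c a b d
    have e2 := t2 b c d a
    have e3 := t2 c d b a
    have e4 := t1 d b c a
    have e5 := t2 b d c a
    have e6 := t1 d a c b
    have e7 := t2 a d c b
    have e8 := t2 a c d b
    have e9 := t1 d a b c
    have e10 := t2 a b d c
    linarith [t3 a b c d, t3 b c d a, t3 c d a b, t3 d a b c]
  have diag : ∀ a b, T a b b a = 0 := fun a b ↦ by
    simp only [hT]; rw [hk, h.symm u hu b a]; ring
  have Taddm : ∀ a b c, T a (b + c) (b + c) a = T a b b a + T a c c a + T a b c a + T a c b a := by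
    intro a b c
    simp only [hT, addm, addr, map_add, add_apply]; ring
  have Tadde : ∀ a d b c, T (a + d) b c (a + d) = T a b c a + T d b c d + T a b c d + T d b c a := by
    intro a d b c
    simp only [hT, addl, map_add, add_apply]; ring
  have q1 : ∀ a b c, T a b c a = 0 := fun a b c ↦ by
    have e := Taddm a b c
    rw [diag, diag, diag] at e
    have := pair a b c a
    have := t1 c a a b
    have := t2 a c a b
    linarith
  have q2 : ∀ a b c d, T a b c d = - T d b c a := fun a b c d ↦ by
    have e := Tadde a d b c
    rw [q1, q1, q1] at e
    linarith
  -- `T` now changes sign under the transpositions (12), (34) and (14), hence is totally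
  -- antisymmetric. The three terms of the Bianchi identity are then equal, so `3 T = 0`.
  have q3 : ∀ a b c d, T a b c d = 0 := fun a b c d ↦ by
    have e1 := q2 a b c d
    have e2 := pair d b c a
    have e3 := t1 c a d b
    have e4 := t2 a c d b
    have e5 := t1 a c b d
    have e6 := q2 c a b d
    have e7 := pair d a b c
    have e8 := t1 b c d a
    have e9 := t2 c b d a
    have e10 := t2 b c d a
    linarith [t3 a b c d]
  refine h.eq_of_forall hu fun d ↦ ?_
  have := q3 x y z d
  simp only [hT] at this
  simp only [map_smul, map_sub, smul_apply, sub_apply,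
    smul_eq_mul]
  linarith

set_option maxHeartbeats 1000000 in
/-- The curvature in terms of covariant derivatives of vector fields. -/
theorem curv_eq_cov {X Y Z : E → E} (hX : ContDiffOn ℝ ∞ X U) (hY : ContDiffOn ℝ ∞ Y U)
    (hZ : ContDiffOn ℝ ∞ Z U) :
    curv Γ u (X u) (Y u) (Z u) = cov Γ X (cov Γ Y Z) u - cov Γ Y (cov Γ X Z) u
      - cov Γ (fun w ↦ cov Γ X Y w - cov Γ Y X w) Z u := by
  have hd : ∀ {W : E → E}, ContDiffOn ℝ ∞ W U → DifferentiableAt ℝ W u := fun hW ↦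
    ContDiffOn.differentiableAt_of_isOpen h.isOpen hW hu
  have hZ' := ContDiffOn.differentiableAt_of_isOpen h.isOpen (contDiffOn_fderiv h.isOpen hZ) hu
  have hΓ := h.differentiableAt_chr hu
  -- After exchanging `X` and `Y` the second derivatives of `Z` cancel by symmetry, and the first
  -- derivatives of `X` and `Y` assemble into the bracket, which is `∇_X Y - ∇_Y X` because the
  -- connection has no torsion.
  have key : ∀ {X Y : E → E}, ContDiffOn ℝ ∞ X U → ContDiffOn ℝ ∞ Y U →
      cov Γ X (cov Γ Y Z) u = fderiv ℝ (fderiv ℝ Z) u (X u) (Y u) + fderiv ℝ Z u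
        (fderiv ℝ Y u (X u)) + fderiv ℝ Γ u (X u) (Y u) (Z u) + Γ u (fderiv ℝ Y u (X u)) (Z u)
        + Γ u (Y u) (fderiv ℝ Z u (X u)) + Γ u (X u) (fderiv ℝ Z u (Y u))
        + Γ u (X u) (Γ u (Y u) (Z u)) := by
    intro X Y hX hY
    have h1 : DifferentiableAt ℝ (fun w ↦ fderiv ℝ Z w (Y w)) u := hZ'.clm_apply (hd hY)
    have h2 : DifferentiableAt ℝ (fun w ↦ Γ w (Y w) (Z w)) u :=
      (hΓ.clm_apply (hd hY)).clm_apply (hd hZ)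
    have e : fderiv ℝ (cov Γ Y Z) u (X u) =
        fderiv ℝ (fun w ↦ fderiv ℝ Z w (Y w)) u (X u)
        + fderiv ℝ (fun w ↦ Γ w (Y w) (Z w)) u (X u) := by
      rw [← add_apply, ← fderiv_fun_add h1 h2]
      rfl
    rw [cov, e, fderiv_clm_apply₂ hΓ (hd hY) (hd hZ), fderiv_clm_apply₁ hZ' (hd hY), cov, map_add]
    abel
  rw [key hX hY, key hY hX, fderiv_fderiv_symm h.isOpen hZ hu (Y u)]
  simp only [cov, curv, map_add, map_sub, h.chr_symm hu (Y u) (X u), sub_apply, add_apply]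
  abel

end IsLocalMetric

theorem fderiv_fderiv_comp {U : Set E} (hU : IsOpen U) {V : Set F} (hV : IsOpen V)
    {f : E → F} (hf : ContDiffOn ℝ ∞ f U) (hfU : Set.MapsTo f U V)
    {k : F → G} (hk : ContDiffOn ℝ ∞ k V) {u : E} (hu : u ∈ U) (a b : E) :
    fderiv ℝ (fderiv ℝ (k ∘ f)) u a b = fderiv ℝ (fderiv ℝ k) (f u) (fderiv ℝ f u a)
      (fderiv ℝ f u b) + fderiv ℝ k (f u) (fderiv ℝ (fderiv ℝ f) u a b) := by
  have hc : ∀ w ∈ U, fderiv ℝ (k ∘ f) w b = fderiv ℝ k (f w) (fderiv ℝ f w b) := fun w hw ↦ by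
    rw [fderiv_comp w (ContDiffOn.differentiableAt_of_isOpen hV hk (hfU hw))
      (ContDiffOn.differentiableAt_of_isOpen hU hf hw)]; rfl
  have hkf := ContDiffOn.differentiableAt_of_isOpen hU
    (contDiffOn_fderiv hU (hk.comp hf hfU)) hu
  have hk' := ContDiffOn.differentiableAt_of_isOpen hV (contDiffOn_fderiv hV hk) (hfU hu)
  have hf' := ContDiffOn.differentiableAt_of_isOpen hU (contDiffOn_fderiv hU hf) hu
  have hf0 := ContDiffOn.differentiableAt_of_isOpen hU hf hu
  have e1 := fderiv_clm_apply₁ hkf (differentiableAt_const b) a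
  rw [fderiv_congr_of_isOpen hU hc hu] at e1
  have hc2 : HasFDerivAt (fun w ↦ fderiv ℝ k (f w)) ((fderiv ℝ (fderiv ℝ k) (f u)).comp
    (fderiv ℝ f u)) u := hk'.hasFDerivAt.comp u hf0.hasFDerivAt
  have e2 := fderiv_clm_apply₁ hc2.differentiableAt (hf'.clm_apply (differentiableAt_const b)) a
  rw [fderiv_clm_apply₁ hf' (differentiableAt_const b) a, hc2.fderiv] at e2
  rw [e2] at e1
  simpa using e1.symm

/-- The composition formula for second fundamental forms. -/
theorem sff_comp {U : Set E} (hU : IsOpen U) {V : Set F} (hV : IsOpen V)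
    {f : E → F} (hf : ContDiffOn ℝ ∞ f U) (hfU : Set.MapsTo f U V)
    {k : F → G} (hk : ContDiffOn ℝ ∞ k V) (Γ : E → E →L[ℝ] E →L[ℝ] E)
    (Γ' : F → F →L[ℝ] F →L[ℝ] F) (Γ'' : G → G →L[ℝ] G →L[ℝ] G) {u : E} (hu : u ∈ U) (a b : E) :
    sff Γ Γ'' (k ∘ f) u a b = fderiv ℝ k (f u) (sff Γ Γ' f u a b)
      + sff Γ' Γ'' k (f u) (fderiv ℝ f u a) (fderiv ℝ f u b) := by
  have hc : fderiv ℝ (k ∘ f) u = (fderiv ℝ k (f u)).comp (fderiv ℝ f u) :=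
    fderiv_comp u (ContDiffOn.differentiableAt_of_isOpen hV hk (hfU hu))
      (ContDiffOn.differentiableAt_of_isOpen hU hf hu)
  simp only [sff]
  rw [fderiv_fderiv_comp hU hV hf hfU hk hu, hc]
  simp
  abel

/-- The second fundamental form of a local isometry with surjective differential vanishes. -/
theorem sff_eq_zero_of_isometry {U : Set E} {g : E → E →L[ℝ] E →L[ℝ] ℝ}
    {Γ : E → E →L[ℝ] E →L[ℝ] E}
    (h : IsLocalMetric U g Γ) {V : Set F} {g' : F → F →L[ℝ] F →L[ℝ] ℝ}
    {Γ' : F → F →L[ℝ] F →L[ℝ] F} (h' : IsLocalMetric V g' Γ') {f : E → F}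
    (hf : ContDiffOn ℝ ∞ f U) (hfU : Set.MapsTo f U V)
    (hiso : ∀ u ∈ U, ∀ a b, g u a b = g' (f u) (fderiv ℝ f u a) (fderiv ℝ f u b))
    {u : E} (hu : u ∈ U) (hsurj : Function.Surjective (fderiv ℝ f u)) (a b : E) :
    sff Γ Γ' f u a b = 0 := by
  have hf' := ContDiffOn.differentiableAt_of_isOpen h.isOpen (contDiffOn_fderiv h.isOpen hf) hu
  have hf0 := ContDiffOn.differentiableAt_of_isOpen h.isOpen hf hu
  have hg' := h'.differentiableAt (hfU hu)
  have hc2 := differentiableAt_fun_comp (G := F →L[ℝ] F →L[ℝ] ℝ) hf0 hg'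
  have key : ∀ a b c : E, fderiv ℝ g u a b c =
      fderiv ℝ g' (f u) (fderiv ℝ f u a) (fderiv ℝ f u b) (fderiv ℝ f u c)
      + g' (f u) (fderiv ℝ (fderiv ℝ f) u a b) (fderiv ℝ f u c)
      + g' (f u) (fderiv ℝ (fderiv ℝ f) u a c) (fderiv ℝ f u b) := by
    intro a b c
    rw [← fderiv_clm_apply_const₂ (h.differentiableAt hu),
      fderiv_congr_of_isOpen h.isOpen (fun w hw ↦ hiso w hw b c) hu,
      fderiv_clm_apply₂ hc2 (hf'.clm_apply (differentiableAt_const b))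
        (hf'.clm_apply (differentiableAt_const c)), fderiv_comp_apply (G := F →L[ℝ] F →L[ℝ] ℝ) hf0 hg',
      fderiv_fderiv_const hf', fderiv_fderiv_const hf',
      h'.symm _ (hfU hu) (fderiv ℝ (fderiv ℝ f) u a c)]
  refine h'.eq_of_forall (hfU hu) fun d ↦ ?_
  obtain ⟨c, rfl⟩ := hsurj d
  -- The Koszul formula of the pulled-back metric is that of `g'` plus `2 g'(d²f(a, b), df c)`, the
  -- other second derivatives cancelling. Comparison leaves `g'(sff f (a, b), df c) = 0`, and
  -- surjectivity of `df` makes `df c` an arbitrary test vector.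
  have k1 := h.koszul u hu a b c
  rw [hiso u hu, key, key, key] at k1
  have k2 := h'.koszul (f u) (hfU hu) (fderiv ℝ f u a) (fderiv ℝ f u b) (fderiv ℝ f u c)
  rw [fderiv_fderiv_symm h.isOpen hf hu c a, fderiv_fderiv_symm h.isOpen hf hu c b,
    fderiv_fderiv_symm h.isOpen hf hu b a] at k1
  simp only [sff, map_add, map_sub, map_zero, add_apply,
    sub_apply, zero_apply]
  linarith

end LocalCalculus

/-! ### Linear algebra in coordinates: bilinear forms and metric traces. -/

section Coordinates

variable {m n : ℕ} {V : Type*} [NormedAddCommGroup V] [NormedSpace ℝ V]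

/-- The coordinate vectors of `ℝᵐ`. -/
abbrev stdVec (i : Fin m) : EuclideanSpace ℝ (Fin m) := EuclideanSpace.single i 1

theorem sum_smul_stdVec (a : EuclideanSpace ℝ (Fin m)) : ∑ i, a i • stdVec i = a := by
  ext j
  simp [stdVec, Pi.single_apply]

theorem apply_eq_sum {W : Type*} [AddCommGroup W] [Module ℝ W]
    (L : EuclideanSpace ℝ (Fin m) →ₗ[ℝ] W) (a : EuclideanSpace ℝ (Fin m)) :
    L a = ∑ i, a i • L (stdVec i) := by
  conv_lhs => rw [← sum_smul_stdVec a]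
  rw [map_sum]
  simp

theorem clm_apply_eq_sum (L : EuclideanSpace ℝ (Fin m) →L[ℝ] V) (a : EuclideanSpace ℝ (Fin m)) :
    L a = ∑ i, a i • L (stdVec i) := apply_eq_sum (L : EuclideanSpace ℝ (Fin m) →ₗ[ℝ] V) a

theorem fderiv_eq_sum_pderiv (f : EuclideanSpace ℝ (Fin m) → ℝ) (u a : EuclideanSpace ℝ (Fin m)) :
    fderiv ℝ f u a = ∑ i, a i * pderiv i f u := by
  rw [clm_apply_eq_sum]; rfl

/-- The bilinear form with matrix `A`. -/
def bil (A : Matrix (Fin m) (Fin m) ℝ) :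
    EuclideanSpace ℝ (Fin m) →L[ℝ] EuclideanSpace ℝ (Fin m) →L[ℝ] ℝ :=
  ∑ i, ∑ j, A i j • (EuclideanSpace.proj i : EuclideanSpace ℝ (Fin m) →L[ℝ] ℝ).smulRight
    (EuclideanSpace.proj j : EuclideanSpace ℝ (Fin m) →L[ℝ] ℝ)

theorem bil_apply (A : Matrix (Fin m) (Fin m) ℝ) (a b : EuclideanSpace ℝ (Fin m)) :
    bil A a b = ∑ i, ∑ j, A i j * a i * b j := by
  simp [bil, mul_assoc]

theorem bil_stdVec (A : Matrix (Fin m) (Fin m) ℝ) (i j : Fin m) :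
    bil A (stdVec i) (stdVec j) = A i j := by
  simp [bil_apply, stdVec]

theorem contDiffOn_smul_const {W : Type*} [NormedAddCommGroup W] [NormedSpace ℝ W] {f : V → ℝ}
    {U : Set V} (hf : ContDiffOn ℝ ∞ f U) (w : W) : ContDiffOn ℝ ∞ (fun u ↦ f u • w) U :=
  hf.smul contDiffOn_const

theorem contDiffOn_bil {A : V → Matrix (Fin m) (Fin m) ℝ} {U : Set V}
    (hA : ∀ i j, ContDiffOn ℝ ∞ (fun u ↦ A u i j) U) : ContDiffOn ℝ ∞ (fun u ↦ bil (A u)) U := by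
  unfold bil
  exact ContDiffOn.sum fun i _ ↦ ContDiffOn.sum fun j _ ↦ contDiffOn_smul_const (hA i j) _

theorem contDiffOn_det {A : V → Matrix (Fin m) (Fin m) ℝ} {U : Set V}
    (hA : ∀ i j, ContDiffOn ℝ ∞ (fun u ↦ A u i j) U) : ContDiffOn ℝ ∞ (fun u ↦ (A u).det) U := by
  simp only [Matrix.det_apply]
  exact ContDiffOn.sum fun σ _ ↦ (contDiffOn_prod fun i _ ↦ hA _ _).const_smul _

theorem contDiffOn_inv_matrix {A : V → Matrix (Fin m) (Fin m) ℝ} {U : Set V}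
    (hA : ∀ i j, ContDiffOn ℝ ∞ (fun u ↦ A u i j) U) (hdet : ∀ u ∈ U, (A u).det ≠ 0)
    (i j : Fin m) : ContDiffOn ℝ ∞ (fun u ↦ (A u)⁻¹ i j) U := by
  simp only [Matrix.inv_def, Matrix.smul_apply, Matrix.adjugate_apply, Ring.inverse_eq_inv',
    smul_eq_mul]
  refine ((contDiffOn_det hA).inv hdet).mul (contDiffOn_det fun k l ↦ ?_)
  by_cases hk : k = j
  · subst hk; simpa using contDiffOn_const
  · simpa [Matrix.updateRow_ne hk] using hA k l

/-- The trace of a bilinear map with respect to the metric with matrix `A`. -/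
def metricTrace (A : Matrix (Fin m) (Fin m) ℝ)
    (S : EuclideanSpace ℝ (Fin m) → EuclideanSpace ℝ (Fin m) → V) : V :=
  ∑ i, ∑ j, A⁻¹ i j • S (stdVec i) (stdVec j)

theorem eq_transpose_mul_mul_of_gram {A B : Matrix (Fin m) (Fin m) ℝ}
    {v : Fin m → EuclideanSpace ℝ (Fin m)} (hv : ∀ i j, bil A (v i) (v j) = B i j) :
    B = (Matrix.of fun k i ↦ v i k).transpose * A * (Matrix.of fun k i ↦ v i k) := by
  ext i j
  rw [← hv, bil_apply]
  simp only [Matrix.mul_apply, Matrix.transpose_apply, Matrix.of_apply, Finset.sum_mul]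
  rw [Finset.sum_comm]
  exact Finset.sum_congr rfl fun _ _ ↦ Finset.sum_congr rfl fun _ _ ↦ by ring

/-- With `J` the matrix whose columns are the `v i`, the Gram matrix is `B = Jᵀ A J`, hence `J B⁻¹
Jᵀ = A⁻¹`: the metric trace may be taken in any basis. This serves both for changes of charts and
for orthonormal frames. -/
theorem metricTrace_eq_of_gram {A B : Matrix (Fin m) (Fin m) ℝ}
    {v : Fin m → EuclideanSpace ℝ (Fin m)} (hv : ∀ i j, bil A (v i) (v j) = B i j)
    (hB : B.det ≠ 0) {S : EuclideanSpace ℝ (Fin m) → EuclideanSpace ℝ (Fin m) → V}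
    (hS : ∃ L : EuclideanSpace ℝ (Fin m) →ₗ[ℝ] EuclideanSpace ℝ (Fin m) →ₗ[ℝ] V,
      ∀ a b, S a b = L a b) :
    ∑ i, ∑ j, B⁻¹ i j • S (v i) (v j) = metricTrace A S := by
  obtain ⟨L, hL⟩ := hS
  set J : Matrix (Fin m) (Fin m) ℝ := Matrix.of fun k i ↦ v i k with hJ
  have hBJ : B = J.transpose * A * J := eq_transpose_mul_mul_of_gram hv
  have hdet : IsUnit J.det ∧ IsUnit A.det := by
    rw [hBJ, Matrix.det_mul, Matrix.det_mul] at hB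
    simp only [mul_ne_zero_iff] at hB
    exact ⟨isUnit_iff_ne_zero.2 hB.2, isUnit_iff_ne_zero.2 hB.1.2⟩
  have hinv : J * B⁻¹ * J.transpose = A⁻¹ := by
    rw [hBJ, Matrix.mul_inv_rev, Matrix.mul_inv_rev, Matrix.mul_nonsing_inv_cancel_left _ _ hdet.1,
      Matrix.mul_assoc, Matrix.nonsing_inv_mul _ (by rw [Matrix.det_transpose]; exact hdet.1),
      Matrix.mul_one]
  have hvv : ∀ i j, S (v i) (v j) = ∑ k, ∑ l, (J k i * J l j) • L (stdVec k) (stdVec l) := by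
    intro i j
    rw [hL, apply_eq_sum L, LinearMap.sum_apply]
    refine Finset.sum_congr rfl fun k _ ↦ ?_
    rw [LinearMap.smul_apply, apply_eq_sum (L (stdVec k)), Finset.smul_sum]
    exact Finset.sum_congr rfl fun l _ ↦ by rw [smul_smul]; rfl
  simp only [metricTrace, ← hinv, Matrix.mul_apply, Matrix.transpose_apply, hvv, hL,
    Finset.smul_sum, Finset.sum_smul, Finset.sum_mul, smul_smul]
  have : ∀ F : Fin m → Fin m → Fin m → Fin m → V,
      ∑ i, ∑ j, ∑ k, ∑ l, F i j k l = ∑ k, ∑ l, ∑ j, ∑ i, F i j k l := fun F ↦ by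
    calc ∑ i, ∑ j, ∑ k, ∑ l, F i j k l = ∑ j, ∑ i, ∑ k, ∑ l, F i j k l := Finset.sum_comm
      _ = ∑ j, ∑ k, ∑ i, ∑ l, F i j k l := Finset.sum_congr rfl fun _ _ ↦ Finset.sum_comm
      _ = ∑ k, ∑ j, ∑ i, ∑ l, F i j k l := Finset.sum_comm
      _ = ∑ k, ∑ j, ∑ l, ∑ i, F i j k l :=
        Finset.sum_congr rfl fun _ _ ↦ Finset.sum_congr rfl fun _ _ ↦ Finset.sum_comm
      _ = _ := Finset.sum_congr rfl fun _ _ ↦ Finset.sum_comm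
  rw [this]
  exact Finset.sum_congr rfl fun _ _ ↦ Finset.sum_congr rfl fun _ _ ↦
    Finset.sum_congr rfl fun _ _ ↦ Finset.sum_congr rfl fun _ _ ↦ by congr 1; ring

/-- The trace of a bilinear map in an orthonormal frame. -/
theorem metricTrace_eq_sum_of_orthonormal {A : Matrix (Fin m) (Fin m) ℝ}
    {v : Fin m → EuclideanSpace ℝ (Fin m)} (hv : ∀ i j, bil A (v i) (v j) = if i = j then 1 else 0)
    {S : EuclideanSpace ℝ (Fin m) → EuclideanSpace ℝ (Fin m) → V}
    (hS : ∃ L : EuclideanSpace ℝ (Fin m) →ₗ[ℝ] EuclideanSpace ℝ (Fin m) →ₗ[ℝ] V,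
      ∀ a b, S a b = L a b) :
    metricTrace A S = ∑ i, S (v i) (v i) := by
  rw [← metricTrace_eq_of_gram (B := 1) (by simpa [Matrix.one_apply] using hv) (by simp) hS]
  simp [Matrix.one_apply]

/-- Covers the linearly dependent pairs, on which the hypothesis about sectional curvatures says
nothing. -/
theorem curv_smul_self {E : Type*} [NormedAddCommGroup E] [NormedSpace ℝ E]
    (Γ : E → E →L[ℝ] E →L[ℝ] E) (u : E) (t : ℝ) (a w : E) : curv Γ u a (t • a) w = 0 := by
  have h1 : curv Γ u a (t • a) w = t • curv Γ u a a w := by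
    simp only [curv, (fderiv ℝ Γ u).map_smul, (fderiv ℝ Γ u a).map_smul, (Γ u).map_smul,
      (Γ u a).map_smul, smul_apply, smul_add, smul_sub]
  rw [h1]
  simp [curv]

theorem sff_isBilinear {E F : Type*} [NormedAddCommGroup E] [NormedSpace ℝ E]
    [NormedAddCommGroup F] [NormedSpace ℝ F] (Γ : E → E →L[ℝ] E →L[ℝ] E)
    (Γ' : F → F →L[ℝ] F →L[ℝ] F) (f : E → F) (u : E) :
    ∃ L : E →ₗ[ℝ] E →ₗ[ℝ] F, ∀ a b, sff Γ Γ' f u a b = L a b := by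
  refine ⟨LinearMap.mk₂ ℝ (sff Γ Γ' f u) ?_ ?_ ?_ ?_, fun a b ↦ rfl⟩
  · intro a a' b; simp only [sff, map_add, add_apply]; abel
  · intro k a b; simp only [sff, map_smul, smul_apply, smul_add, smul_sub]
  · intro a b b'; simp only [sff, map_add]; abel
  · intro k a b; simp only [sff, map_smul, smul_add, smul_sub]

end Coordinates

/-! ### The metric, Christoffel symbols and curvature of a manifold in a chart. -/

section Charts

variable {m : ℕ} {M : Type*} [TopologicalSpace M] [ChartedSpace (EuclideanSpace ℝ (Fin m)) M]
  [IsManifold (𝓡 m) ∞ M] [RiemannianBundle (fun x : M ↦ TangentSpace (𝓡 m) x)]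

/-- The metric in the chart around `x₀`, as a bilinear form. -/
def metricBil (x₀ : M) (u : EuclideanSpace ℝ (Fin m)) :
    EuclideanSpace ℝ (Fin m) →L[ℝ] EuclideanSpace ℝ (Fin m) →L[ℝ] ℝ :=
  bil (metricMatrix x₀ u)

/-- The Christoffel symbols in the chart around `x₀`, as a bilinear map. -/
def chrMap (x₀ : M) (u : EuclideanSpace ℝ (Fin m)) :
    EuclideanSpace ℝ (Fin m) →L[ℝ] EuclideanSpace ℝ (Fin m) →L[ℝ] EuclideanSpace ℝ (Fin m) :=
  ∑ k, ∑ i, ∑ j, christoffel x₀ k i j u •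
    (EuclideanSpace.proj i : EuclideanSpace ℝ (Fin m) →L[ℝ] ℝ).smulRight
      ((EuclideanSpace.proj j : EuclideanSpace ℝ (Fin m) →L[ℝ] ℝ).smulRight (stdVec k))

theorem chrMap_apply (x₀ : M) (u a b : EuclideanSpace ℝ (Fin m)) (k : Fin m) :
    chrMap x₀ u a b k = ∑ i, ∑ j, christoffel x₀ k i j u * a i * b j := by
  simp [chrMap, stdVec, Pi.single_apply, mul_assoc]

theorem chrMap_stdVec (x₀ : M) (u : EuclideanSpace ℝ (Fin m)) (i j k : Fin m) :
    chrMap x₀ u (stdVec i) (stdVec j) k = christoffel x₀ k i j u := by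
  simp [chrMap_apply, stdVec]

theorem metricForm_eq_metricBil (x₀ : M) (u a b : EuclideanSpace ℝ (Fin m)) :
    metricForm x₀ u a b = metricBil x₀ u a b := by
  simp [metricForm, metricBil, bil_apply]

/-- The vector with coordinates `a` in the chart around `x₀`. -/
abbrev tangentVec (x₀ x : M) (a : EuclideanSpace ℝ (Fin m)) : TangentSpace (𝓡 m) x :=
  (trivializationAt (EuclideanSpace ℝ (Fin m)) (TangentSpace (𝓡 m)) x₀).symmL ℝ x a

omit [RiemannianBundle (fun x : M ↦ TangentSpace (𝓡 m) x)] in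
theorem sum_smul_coordVec (x₀ x : M) (a : EuclideanSpace ℝ (Fin m)) :
    ∑ i, a i • coordVec x₀ x i = tangentVec x₀ x a := by
  conv_rhs => rw [← sum_smul_stdVec a, tangentVec, map_sum]
  simp [coordVec]

theorem metricBil_eq_inner (x₀ : M) (u a b : EuclideanSpace ℝ (Fin m)) :
    metricBil x₀ u a b = inner ℝ (tangentVec x₀ ((extChartAt (𝓡 m) x₀).symm u) a)
      (tangentVec x₀ ((extChartAt (𝓡 m) x₀).symm u) b) := by
  rw [← sum_smul_coordVec, ← sum_smul_coordVec, sum_inner, metricBil, bil_apply]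
  refine Finset.sum_congr rfl fun i _ ↦ ?_
  rw [inner_sum]
  refine Finset.sum_congr rfl fun j _ ↦ ?_
  rw [inner_smul_left, inner_smul_right]
  simp [metricMatrix]; ring

end Charts

section Charts

variable {m : ℕ} {M : Type*} [TopologicalSpace M] [ChartedSpace (EuclideanSpace ℝ (Fin m)) M]
  [IsManifold (𝓡 m) ∞ M]

theorem chart_symm_mem_source {x₀ : M} {u : EuclideanSpace ℝ (Fin m)}
    (hu : u ∈ (extChartAt (𝓡 m) x₀).target) :
    (extChartAt (𝓡 m) x₀).symm u ∈ (chartAt (EuclideanSpace ℝ (Fin m)) x₀).source := by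
  simpa using (extChartAt (𝓡 m) x₀).map_target hu

theorem tangentVec_injective {x₀ x : M}
    (hx : x ∈ (chartAt (EuclideanSpace ℝ (Fin m)) x₀).source) :
    Function.Injective (tangentVec (m := m) x₀ x) := by
  have h : x ∈ (trivializationAt (EuclideanSpace ℝ (Fin m)) (TangentSpace (𝓡 m)) x₀).baseSet := by
    simpa using hx
  intro a b hab
  have := congrArg ((trivializationAt (EuclideanSpace ℝ (Fin m))
    (TangentSpace (𝓡 m)) x₀).continuousLinearMapAt ℝ x) hab
  rwa [Trivialization.continuousLinearMapAt_symmL _ h,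
    Trivialization.continuousLinearMapAt_symmL _ h] at this

theorem tangentVec_surjective {x₀ x : M}
    (hx : x ∈ (chartAt (EuclideanSpace ℝ (Fin m)) x₀).source) :
    Function.Surjective (tangentVec (m := m) x₀ x) := by
  have h : x ∈ (trivializationAt (EuclideanSpace ℝ (Fin m)) (TangentSpace (𝓡 m)) x₀).baseSet := by
    simpa using hx
  intro v
  exact ⟨_, Trivialization.symmL_continuousLinearMapAt _ h v⟩

theorem contMDiffOn_coordVec (x₀ : M) (i : Fin m) :
    ContMDiffOn 𝓘(ℝ, EuclideanSpace ℝ (Fin m)) ((𝓡 m).prod 𝓘(ℝ, EuclideanSpace ℝ (Fin m))) ∞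
      (fun u ↦ (⟨(extChartAt (𝓡 m) x₀).symm u, coordVec x₀ ((extChartAt (𝓡 m) x₀).symm u) i⟩ :
        TotalSpace (EuclideanSpace ℝ (Fin m)) (fun x : M ↦ TangentSpace (𝓡 m) x)))
      (extChartAt (𝓡 m) x₀).target := by
  have h1 : ContMDiffOn (𝓡 m) ((𝓡 m).prod 𝓘(ℝ, EuclideanSpace ℝ (Fin m))) ∞
      (fun x ↦ (⟨x, coordVec x₀ x i⟩ :
        TotalSpace (EuclideanSpace ℝ (Fin m)) (fun x : M ↦ TangentSpace (𝓡 m) x)))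
      (trivializationAt (EuclideanSpace ℝ (Fin m)) (TangentSpace (𝓡 m)) x₀).baseSet := by
    rw [Trivialization.contMDiffOn_section_baseSet_iff
      (trivializationAt (EuclideanSpace ℝ (Fin m)) (TangentSpace (𝓡 m) (M := M)) x₀)]
    refine (contMDiffOn_const (c := stdVec i)).congr fun x hx ↦ ?_
    have := Trivialization.continuousLinearMapAt_symmL (R := ℝ) (trivializationAt
      (EuclideanSpace ℝ (Fin m)) (TangentSpace (𝓡 m) (M := M)) x₀) hx (stdVec i)
    rw [Trivialization.continuousLinearMapAt_apply, Trivialization.coe_linearMapAt_of_mem _ hx]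
      at this
    exact this
  exact h1.comp (contMDiffOn_extChartAt_symm x₀) fun u hu ↦ by
    simpa using chart_symm_mem_source hu

variable [RiemannianBundle (fun x : M ↦ TangentSpace (𝓡 m) x)]

theorem metricMatrix_symm (x₀ : M) (u : EuclideanSpace ℝ (Fin m)) (i j : Fin m) :
    metricMatrix x₀ u i j = metricMatrix x₀ u j i := by
  simp only [metricMatrix, Matrix.of_apply]
  exact real_inner_comm _ _

theorem metricBil_symm (x₀ : M) (u a b : EuclideanSpace ℝ (Fin m)) :
    metricBil x₀ u a b = metricBil x₀ u b a := by
  rw [metricBil_eq_inner, metricBil_eq_inner, real_inner_comm]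

theorem metricBil_pos {x₀ : M} {u a : EuclideanSpace ℝ (Fin m)}
    (hu : u ∈ (extChartAt (𝓡 m) x₀).target) (ha : a ≠ 0) : 0 < metricBil x₀ u a a := by
  rw [metricBil_eq_inner]
  refine real_inner_self_pos.2 fun h ↦ ha ?_
  exact tangentVec_injective (chart_symm_mem_source hu) (h.trans (map_zero _).symm)

theorem metricMatrix_posDef {x₀ : M} {u : EuclideanSpace ℝ (Fin m)}
    (hu : u ∈ (extChartAt (𝓡 m) x₀).target) : (metricMatrix x₀ u).PosDef := by
  refine Matrix.PosDef.of_dotProduct_mulVec_pos ?_ fun a ha ↦ ?_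
  · exact Matrix.IsHermitian.ext fun i j ↦ metricMatrix_symm x₀ u j i
  · have := metricBil_pos hu (a := WithLp.toLp 2 a) (by simpa using ha)
    rw [metricBil, bil_apply] at this
    refine this.trans_eq ?_
    simp only [dotProduct, Matrix.mulVec, Finset.mul_sum, star_trivial]
    exact Finset.sum_congr rfl fun i _ ↦ Finset.sum_congr rfl fun j _ ↦ by ring

theorem metricMatrix_det_pos {x₀ : M} {u : EuclideanSpace ℝ (Fin m)}
    (hu : u ∈ (extChartAt (𝓡 m) x₀).target) : 0 < (metricMatrix x₀ u).det :=
  (metricMatrix_posDef hu).det_pos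

variable [IsContMDiffRiemannianBundle (𝓡 m) ∞ (EuclideanSpace ℝ (Fin m))
  (fun x : M ↦ TangentSpace (𝓡 m) x)]

theorem contDiffOn_metricMatrix (x₀ : M) (i j : Fin m) :
    ContDiffOn ℝ ∞ (fun u ↦ metricMatrix x₀ u i j) (extChartAt (𝓡 m) x₀).target := by
  rw [← contMDiffOn_iff_contDiffOn]
  exact ContMDiffOn.inner_bundle (contMDiffOn_coordVec x₀ i) (contMDiffOn_coordVec x₀ j)

theorem contDiffOn_pderiv {U : Set (EuclideanSpace ℝ (Fin m))} (hU : IsOpen U)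
    {f : EuclideanSpace ℝ (Fin m) → ℝ} (hf : ContDiffOn ℝ ∞ f U) (i : Fin m) :
    ContDiffOn ℝ ∞ (pderiv i f) U :=
  (contDiffOn_fderiv hU hf).clm_apply contDiffOn_const

theorem contDiffOn_christoffel (x₀ : M) (k i j : Fin m) :
    ContDiffOn ℝ ∞ (christoffel x₀ k i j) (extChartAt (𝓡 m) x₀).target := by
  have hU : IsOpen (extChartAt (𝓡 m) x₀).target := isOpen_extChartAt_target x₀
  have hG := contDiffOn_metricMatrix (m := m) x₀
  refine contDiffOn_const.mul (ContDiffOn.sum fun l _ ↦ ?_)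
  exact (contDiffOn_inv_matrix hG (fun u hu ↦ (metricMatrix_det_pos hu).ne') k l).mul
    (((contDiffOn_pderiv hU (hG j l) i).add (contDiffOn_pderiv hU (hG i l) j)).sub
      (contDiffOn_pderiv hU (hG i j) l))

theorem fderiv_metricBil {x₀ : M} {u : EuclideanSpace ℝ (Fin m)}
    (hu : u ∈ (extChartAt (𝓡 m) x₀).target) (a b c : EuclideanSpace ℝ (Fin m)) :
    fderiv ℝ (metricBil x₀) u a b c =
      ∑ i, ∑ j, ∑ l, pderiv i (fun w ↦ metricMatrix x₀ w j l) u * a i * b j * c l := by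
  have hU : IsOpen (extChartAt (𝓡 m) x₀).target := isOpen_extChartAt_target x₀
  have hG := contDiffOn_metricMatrix (m := m) x₀
  have hd : ∀ j l, DifferentiableAt ℝ (fun w ↦ metricMatrix x₀ w j l) u := fun j l ↦
    ContDiffOn.differentiableAt_of_isOpen hU (hG j l) hu
  rw [← fderiv_clm_apply_const₂ (g := metricBil x₀) (ContDiffOn.differentiableAt_of_isOpen hU (contDiffOn_bil hG) hu),
    show (fun w ↦ metricBil x₀ w b c) =
      fun w ↦ ∑ j, ∑ l, metricMatrix x₀ w j l * b j * c l from funext fun w ↦ bil_apply _ _ _,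
    fderiv_eq_sum_pderiv]
  refine Finset.sum_congr rfl fun i _ ↦ ?_
  have e : pderiv i (fun w ↦ ∑ j, ∑ l, metricMatrix x₀ w j l * b j * c l) u =
      ∑ j, ∑ l, pderiv i (fun w ↦ metricMatrix x₀ w j l) u * b j * c l := by
    have : HasFDerivAt (fun w ↦ ∑ j, ∑ l, metricMatrix x₀ w j l * b j * c l)
        (∑ j, ∑ l, c l • b j • fderiv ℝ (fun w ↦ metricMatrix x₀ w j l) u) u :=
      HasFDerivAt.fun_sum fun j _ ↦ HasFDerivAt.fun_sum fun l _ ↦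
        ((hd j l).hasFDerivAt.mul_const _).mul_const _
    rw [pderiv, this.fderiv]
    simp [pderiv]
    exact Finset.sum_congr rfl fun j _ ↦ Finset.sum_congr rfl fun l _ ↦ by ring
  rw [e, Finset.mul_sum]
  refine Finset.sum_congr rfl fun j _ ↦ ?_
  rw [Finset.mul_sum]
  exact Finset.sum_congr rfl fun l _ ↦ by ring

/-- Lowering the index cancels the inverse matrix in the definition of the Christoffel symbols; this
is the Koszul formula on coordinate vectors. -/
theorem sum_metricMatrix_mul_christoffel {x₀ : M} {u : EuclideanSpace ℝ (Fin m)}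
    (hu : u ∈ (extChartAt (𝓡 m) x₀).target) (i j l : Fin m) :
    2 * ∑ k, metricMatrix x₀ u k l * christoffel x₀ k i j u =
      pderiv i (fun w ↦ metricMatrix x₀ w j l) u + pderiv j (fun w ↦ metricMatrix x₀ w i l) u
      - pderiv l (fun w ↦ metricMatrix x₀ w i j) u := by
  set K : Fin m → ℝ := fun l ↦ pderiv i (fun w ↦ metricMatrix x₀ w j l) u
    + pderiv j (fun w ↦ metricMatrix x₀ w i l) u
      - pderiv l (fun w ↦ metricMatrix x₀ w i j) u with hK
  have e : ∀ k, christoffel x₀ k i j u = (1 / 2) * ((metricMatrix x₀ u)⁻¹.mulVec K) k :=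
    fun k ↦ rfl
  have : ∑ k, metricMatrix x₀ u k l * christoffel x₀ k i j u = (1 / 2) * K l := by
    simp only [e, metricMatrix_symm x₀ u _ l]
    have h : (metricMatrix x₀ u).mulVec ((metricMatrix x₀ u)⁻¹.mulVec K) = K := by
      rw [Matrix.mulVec_mulVec, Matrix.mul_nonsing_inv _
        (isUnit_iff_ne_zero.2 (metricMatrix_det_pos hu).ne'), Matrix.one_mulVec]
    conv_rhs => rw [← h]
    rw [Matrix.mulVec, dotProduct, Finset.mul_sum]
    exact Finset.sum_congr rfl fun k _ ↦ by ring
  rw [this]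
  simp only [hK]
  ring

/-- The bridge from index notation to bilinear maps: all later geometry in a chart rests on this
structure rather than on sums over indices. -/
theorem isLocalMetric (x₀ : M) :
    IsLocalMetric (extChartAt (𝓡 m) x₀).target (metricBil x₀) (chrMap x₀) where
  isOpen := isOpen_extChartAt_target x₀
  contDiffOn := contDiffOn_bil (contDiffOn_metricMatrix x₀)
  contDiffOn_chr := ContDiffOn.sum fun k _ ↦ ContDiffOn.sum fun i _ ↦ ContDiffOn.sum fun j _ ↦
    contDiffOn_smul_const (contDiffOn_christoffel x₀ k i j) _
  symm u _ := metricBil_symm x₀ u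
  pos u hu a ha := metricBil_pos hu ha
  koszul u hu a b c := by
    have e1 : 2 * metricBil x₀ u (chrMap x₀ u a b) c = ∑ i, ∑ j, ∑ l,
        (2 * ∑ k, metricMatrix x₀ u k l * christoffel x₀ k i j u) * a i * b j * c l := by
      rw [metricBil, bil_apply]
      simp only [chrMap_apply, Finset.mul_sum, Finset.sum_mul]
      calc _ = ∑ k, ∑ i, ∑ l, ∑ j, _ := Finset.sum_congr rfl fun _ _ ↦ Finset.sum_comm
        _ = ∑ i, ∑ k, ∑ l, ∑ j, _ := Finset.sum_comm
        _ = ∑ i, ∑ k, ∑ j, ∑ l, _ := Finset.sum_congr rfl fun _ _ ↦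
          Finset.sum_congr rfl fun _ _ ↦ Finset.sum_comm
        _ = ∑ i, ∑ j, ∑ k, ∑ l, _ := Finset.sum_congr rfl fun _ _ ↦ Finset.sum_comm
        _ = ∑ i, ∑ j, ∑ l, ∑ k, _ := Finset.sum_congr rfl fun _ _ ↦
          Finset.sum_congr rfl fun _ _ ↦ Finset.sum_comm
        _ = _ := Finset.sum_congr rfl fun _ _ ↦ Finset.sum_congr rfl fun _ _ ↦
          Finset.sum_congr rfl fun _ _ ↦ Finset.sum_congr rfl fun _ _ ↦ by ring
    have e2 : fderiv ℝ (metricBil x₀) u b a c = ∑ i, ∑ j, ∑ l,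
        pderiv j (fun w ↦ metricMatrix x₀ w i l) u * a i * b j * c l := by
      rw [fderiv_metricBil hu, Finset.sum_comm]
      exact Finset.sum_congr rfl fun _ _ ↦ Finset.sum_congr rfl fun _ _ ↦
          Finset.sum_congr rfl fun _ _ ↦ by ring
    have e3 : fderiv ℝ (metricBil x₀) u c a b = ∑ i, ∑ j, ∑ l,
        pderiv l (fun w ↦ metricMatrix x₀ w i j) u * a i * b j * c l := by
      rw [fderiv_metricBil hu, Finset.sum_comm]
      refine Finset.sum_congr rfl fun _ _ ↦ ?_
      rw [Finset.sum_comm]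
      exact Finset.sum_congr rfl fun _ _ ↦ Finset.sum_congr rfl fun _ _ ↦ by ring
    rw [e1, e2, e3, fderiv_metricBil hu, ← Finset.sum_add_distrib, ← Finset.sum_sub_distrib]
    refine Finset.sum_congr rfl fun i _ ↦ ?_
    rw [← Finset.sum_add_distrib, ← Finset.sum_sub_distrib]
    refine Finset.sum_congr rfl fun j _ ↦ ?_
    rw [← Finset.sum_add_distrib, ← Finset.sum_sub_distrib]
    refine Finset.sum_congr rfl fun l _ ↦ ?_
    rw [sum_metricMatrix_mul_christoffel hu]
    ring

theorem curvatureVec_eq_curv {x₀ : M} {u : EuclideanSpace ℝ (Fin m)}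
    (hu : u ∈ (extChartAt (𝓡 m) x₀).target) (a b c : EuclideanSpace ℝ (Fin m)) :
    curvatureVec x₀ u a b c = curv (chrMap x₀) u a b c := by
  have hU : IsOpen (extChartAt (𝓡 m) x₀).target := isOpen_extChartAt_target x₀
  have hd : ∀ k i j, DifferentiableAt ℝ (christoffel x₀ k i j) u := fun k i j ↦
    ContDiffOn.differentiableAt_of_isOpen hU (contDiffOn_christoffel x₀ k i j) hu
  have hΓ := (isLocalMetric x₀).differentiableAt_chr hu
  funext l
  have d : ∀ a b : EuclideanSpace ℝ (Fin m), fderiv ℝ (chrMap x₀) u a b c l =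
      ∑ i, ∑ j, ∑ k, pderiv i (christoffel x₀ l j k) u * a i * b j * c k := by
    intro a b
    rw [← fderiv_clm_apply_const₂ hΓ]
    have e1 : fderiv ℝ (fun w ↦ chrMap x₀ w b c) u a l =
        fderiv ℝ (fun w ↦ chrMap x₀ w b c l) u a := by
      have h' : DifferentiableAt ℝ (fun w ↦ chrMap x₀ w b c) u :=
        (hΓ.clm_apply (differentiableAt_const b)).clm_apply (differentiableAt_const c)
      have := ((EuclideanSpace.proj l : EuclideanSpace ℝ (Fin m) →L[ℝ] ℝ).hasFDerivAt.comp u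
        h'.hasFDerivAt).fderiv
      exact (DFunLike.congr_fun this a).symm
    rw [e1, fderiv_eq_sum_pderiv]
    refine Finset.sum_congr rfl fun i _ ↦ ?_
    simp only [chrMap_apply]
    have : HasFDerivAt (fun w ↦ ∑ j, ∑ k, christoffel x₀ l j k w * b j * c k)
        (∑ j, ∑ k, c k • b j • fderiv ℝ (christoffel x₀ l j k) u) u :=
      HasFDerivAt.fun_sum fun j _ ↦ HasFDerivAt.fun_sum fun k _ ↦
        ((hd l j k).hasFDerivAt.mul_const _).mul_const _
    rw [pderiv, this.fderiv]
    simp only [sum_apply, smul_apply, smul_eq_mul, Finset.mul_sum]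
    exact Finset.sum_congr rfl fun j _ ↦ Finset.sum_congr rfl fun l _ ↦ by rw [pderiv]; ring
  have q : ∀ a b : EuclideanSpace ℝ (Fin m), chrMap x₀ u a (chrMap x₀ u b c) l =
      ∑ i, ∑ j, ∑ k, (∑ p, christoffel x₀ l i p u * christoffel x₀ p j k u)
        * a i * b j * c k := by
    intro a b
    simp only [chrMap_apply, Finset.mul_sum, Finset.sum_mul]
    refine Finset.sum_congr rfl fun i _ ↦ ?_
    rw [Finset.sum_comm]
    refine Finset.sum_congr rfl fun j _ ↦ ?_
    rw [Finset.sum_comm]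
    exact Finset.sum_congr rfl fun _ _ ↦ Finset.sum_congr rfl fun _ _ ↦ by ring
  have swap : ∀ F : Fin m → Fin m → Fin m → ℝ, ∑ i, ∑ j, ∑ k, F i j k * b i * a j * c k =
      ∑ i, ∑ j, ∑ k, F j i k * a i * b j * c k := by
    intro F
    rw [Finset.sum_comm]
    exact Finset.sum_congr rfl fun _ _ ↦ Finset.sum_congr rfl fun _ _ ↦
      Finset.sum_congr rfl fun _ _ ↦ by ring
  simp only [curv, PiLp.add_apply, PiLp.sub_apply, d, q, swap, curvatureVec, curvatureCoeff]
  simp only [← Finset.sum_add_distrib, ← Finset.sum_sub_distrib]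
  refine Finset.sum_congr rfl fun i _ ↦ Finset.sum_congr rfl fun j _ ↦
      Finset.sum_congr rfl fun k _ ↦ ?_
  rw [Finset.sum_sub_distrib]
  ring

/-- Polarization needs the sectional identity cleared of its denominator and for all pairs of
vectors. Independent pairs have a positive Gram determinant; for dependent pairs both sides vanish.
-/
theorem curv_of_hasConstantSectionalCurvature {c : ℝ} (hM : HasConstantSectionalCurvature m M c)
    {x₀ : M} {u : EuclideanSpace ℝ (Fin m)} (hu : u ∈ (extChartAt (𝓡 m) x₀).target)
    (x y z : EuclideanSpace ℝ (Fin m)) :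
    curv (chrMap x₀) u x y z = c • (metricBil x₀ u y z • x - metricBil x₀ u x z • y) := by
  have h := isLocalMetric (m := m) x₀
  refine h.curv_of_sectional hu (fun a b ↦ ?_) x y z
  by_cases hab : LinearIndependent ℝ ![(a : Fin m → ℝ), (b : Fin m → ℝ)]
  · have := hM x₀ u hu a b hab
    rw [sectionalCurvature, curvatureVec_eq_curv hu, metricForm_eq_metricBil,
      metricForm_eq_metricBil, metricForm_eq_metricBil, metricForm_eq_metricBil] at this
    rw [← this, div_mul_cancel₀]
    have ha : a ≠ 0 := fun h0 ↦ hab.ne_zero 0 (by simp [h0])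
    have hpa := metricBil_pos hu ha
    -- The squared length of `|a|² b - ⟨a, b⟩ a` is `|a|² (|a|² |b|² - ⟨a, b⟩²)`, so the Gram
    -- determinant is positive as soon as this vector is nonzero.
    have hw : metricBil x₀ u a a • b - metricBil x₀ u a b • a ≠ 0 := fun h0 ↦ by
      have := LinearIndependent.pair_iff.1 hab (- metricBil x₀ u a b) (metricBil x₀ u a a)
        (by
          have h1 := congrArg (fun v : EuclideanSpace ℝ (Fin m) ↦ (v : Fin m → ℝ)) h0
          simp only [WithLp.ofLp_sub, WithLp.ofLp_smul, WithLp.ofLp_zero] at h1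
          rw [← h1]; simp only [neg_smul]; abel)
      exact hpa.ne' this.2
    have hp := metricBil_pos hu hw
    simp only [map_sub, map_smul, sub_apply, smul_apply, smul_eq_mul,
      metricBil_symm x₀ u b a] at hp
    have : 0 < metricBil x₀ u a a * (metricBil x₀ u a a * metricBil x₀ u b b
      - metricBil x₀ u a b ^ 2) := by linarith
    exact (pos_of_mul_pos_right this hpa.le).ne'
  · have hself := curv_smul_self (chrMap x₀) u
    by_cases ha : a = 0
    · have h0 := hself 0 b b
      rw [zero_smul] at h0
      rw [ha, curv_antisymm, h0]
      simp
    · rw [LinearIndependent.pair_iff' (by simpa using ha)] at hab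
      push Not at hab
      obtain ⟨t, ht⟩ := hab
      have hb : b = t • a := by ext i; exact (congrFun ht i).symm
      rw [hb, hself]
      simp only [map_smul, smul_apply, map_zero, zero_apply, smul_eq_mul]
      ring

end Charts

/-! ### Maps between manifolds in charts, and independence of the tension field from the charts. -/

section Maps

variable {m n : ℕ}
  {M : Type*} [TopologicalSpace M] [ChartedSpace (EuclideanSpace ℝ (Fin m)) M]
  [IsManifold (𝓡 m) ∞ M]
  {N : Type*} [TopologicalSpace N] [ChartedSpace (EuclideanSpace ℝ (Fin n)) N]
  [IsManifold (𝓡 n) ∞ N]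

variable (m n) in
/-- The map `φ` in the charts around `x₀` and `y₀`. -/
def locMap (φ : M → N) (x₀ : M) (y₀ : N) (u : EuclideanSpace ℝ (Fin m)) :
    EuclideanSpace ℝ (Fin n) :=
  extChartAt (𝓡 n) y₀ (φ ((extChartAt (𝓡 m) x₀).symm u))

variable (m n) in
/-- The domain of the map `φ` in the charts around `x₀` and `y₀`. -/
def locDom (φ : M → N) (x₀ : M) (y₀ : N) : Set (EuclideanSpace ℝ (Fin m)) :=
  (extChartAt (𝓡 m) x₀).target ∩
    (fun u ↦ φ ((extChartAt (𝓡 m) x₀).symm u)) ⁻¹' (extChartAt (𝓡 n) y₀).source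

theorem locDom_subset (φ : M → N) (x₀ : M) (y₀ : N) :
    locDom m n φ x₀ y₀ ⊆ (extChartAt (𝓡 m) x₀).target := Set.inter_subset_left

theorem isOpen_locDom {φ : M → N} (hφ : Continuous φ) (x₀ : M) (y₀ : N) :
    IsOpen (locDom m n φ x₀ y₀) :=
  (hφ.comp_continuousOn (continuousOn_extChartAt_symm x₀)).isOpen_inter_preimage
    (isOpen_extChartAt_target x₀) (isOpen_extChartAt_source y₀)

theorem mapsTo_locMap (φ : M → N) (x₀ : M) (y₀ : N) :
    Set.MapsTo (locMap m n φ x₀ y₀) (locDom m n φ x₀ y₀) (extChartAt (𝓡 n) y₀).target :=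
  fun _ hu ↦ (extChartAt (𝓡 n) y₀).map_source hu.2

theorem contDiffOn_locMap {φ : M → N} (hφ : ContMDiff (𝓡 m) (𝓡 n) ∞ φ) (x₀ : M) (y₀ : N) :
    ContDiffOn ℝ ∞ (locMap m n φ x₀ y₀) (locDom m n φ x₀ y₀) := by
  rw [← contMDiffOn_iff_contDiffOn]
  refine (contMDiffOn_extChartAt (x := y₀)).comp (hφ.comp_contMDiffOn
    ((contMDiffOn_extChartAt_symm x₀).mono (locDom_subset φ x₀ y₀))) fun u hu ↦ ?_
  simpa using hu.2

/-- The trivialization of the tangent bundle over a chart is the differential of that chart, so this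
is the chain rule for chart, map and inverse chart. With `φ = id` it governs changes of coordinates.
-/
theorem mfderiv_tangentVec {φ : M → N} {x₀ : M} {y₀ : N} {u : EuclideanSpace ℝ (Fin m)}
    (hu : u ∈ locDom m n φ x₀ y₀)
    (hφ : MDifferentiableAt (𝓡 m) (𝓡 n) φ ((extChartAt (𝓡 m) x₀).symm u))
    (a : EuclideanSpace ℝ (Fin m)) :
    mfderiv (𝓡 m) (𝓡 n) φ ((extChartAt (𝓡 m) x₀).symm u)
      (tangentVec x₀ ((extChartAt (𝓡 m) x₀).symm u) a) =
    tangentVec y₀ (φ ((extChartAt (𝓡 m) x₀).symm u)) (fderiv ℝ (locMap m n φ x₀ y₀) u a) := by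
  set x := (extChartAt (𝓡 m) x₀).symm u with hx
  have hxs : x ∈ (chartAt (EuclideanSpace ℝ (Fin m)) x₀).source := chart_symm_mem_source hu.1
  have hys : φ x ∈ (chartAt (EuclideanSpace ℝ (Fin n)) y₀).source := by
    have h := hu.2
    rwa [Set.mem_preimage, extChartAt_source] at h
  have hux : extChartAt (𝓡 m) x₀ x = u := (extChartAt (𝓡 m) x₀).right_inv hu.1
  have e1 : tangentVec x₀ x a = mfderiv 𝓘(ℝ, EuclideanSpace ℝ (Fin m)) (𝓡 m)
      (extChartAt (𝓡 m) x₀).symm u a := by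
    rw [tangentVec, TangentBundle.symmL_trivializationAt hxs, hux, ModelWithCorners.range_eq_univ,
      mfderivWithin_univ]
    rfl
  have hd1 : MDifferentiableAt 𝓘(ℝ, EuclideanSpace ℝ (Fin m)) (𝓡 m)
      (extChartAt (𝓡 m) x₀).symm u :=
    ((contMDiffOn_extChartAt_symm (n := ∞) x₀).contMDiffAt
      ((isOpen_extChartAt_target x₀).mem_nhds hu.1)).mdifferentiableAt (by simp)
  have hd2 : MDifferentiableAt (𝓡 n) 𝓘(ℝ, EuclideanSpace ℝ (Fin n)) (extChartAt (𝓡 n) y₀)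
      (φ x) := mdifferentiableAt_extChartAt hys
  have hc : mfderiv 𝓘(ℝ, EuclideanSpace ℝ (Fin m)) 𝓘(ℝ, EuclideanSpace ℝ (Fin n))
      (locMap m n φ x₀ y₀) u =
      (mfderiv (𝓡 n) 𝓘(ℝ, EuclideanSpace ℝ (Fin n)) (extChartAt (𝓡 n) y₀) (φ x)).comp
        ((mfderiv (𝓡 m) (𝓡 n) φ x).comp (mfderiv 𝓘(ℝ, EuclideanSpace ℝ (Fin m)) (𝓡 m)
      (extChartAt (𝓡 m) x₀).symm u)) := by
    have h2 : HasMFDerivAt (𝓡 m) (𝓡 n) φ ((extChartAt (𝓡 m) x₀).symm u) _ := hφ.hasMFDerivAt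
    exact (hd2.hasMFDerivAt.comp u (h2.comp u hd1.hasMFDerivAt)).mfderiv
  rw [mfderiv_eq_fderiv, ← TangentBundle.continuousLinearMapAt_trivializationAt hys] at hc
  have h3 : φ x ∈ (trivializationAt (EuclideanSpace ℝ (Fin n)) (TangentSpace (𝓡 n)) y₀).baseSet := by
    simpa using hys
  rw [hc, e1]
  exact (Trivialization.symmL_continuousLinearMapAt _ h3 _).symm

theorem fderiv_apply_coord {E : Type*} [NormedAddCommGroup E] [NormedSpace ℝ E]
    {f : E → EuclideanSpace ℝ (Fin n)} {u : E} (hf : DifferentiableAt ℝ f u) (γ : Fin n) (a : E) :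
    fderiv ℝ f u a γ = fderiv ℝ (fun w ↦ f w γ) u a := by
  have := ((EuclideanSpace.proj γ : EuclideanSpace ℝ (Fin n) →L[ℝ] ℝ).hasFDerivAt.comp u
    hf.hasFDerivAt).fderiv
  exact (DFunLike.congr_fun this a).symm

variable [RiemannianBundle (fun x : M ↦ TangentSpace (𝓡 m) x)]
  [RiemannianBundle (fun y : N ↦ TangentSpace (𝓡 n) y)]

theorem sff_stdVec_apply {φ : M → N} (hφ : ContMDiff (𝓡 m) (𝓡 n) ∞ φ) {x₀ : M}
    {u : EuclideanSpace ℝ (Fin m)} (hu : u ∈ locDom m n φ x₀ (φ x₀)) (γ : Fin n) (i j : Fin m) :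
    sff (chrMap x₀) (chrMap (φ x₀)) (locMap m n φ x₀ (φ x₀)) u (stdVec i) (stdVec j) γ =
      secondFundamentalForm φ x₀ γ i j u := by
  have hU := isOpen_locDom (m := m) (n := n) hφ.continuous x₀ (φ x₀)
  have hf := contDiffOn_locMap hφ x₀ (φ x₀)
  set f := locMap m n φ x₀ (φ x₀) with hfdef
  have hf1 : ∀ w ∈ locDom m n φ x₀ (φ x₀), DifferentiableAt ℝ f w := fun w hw ↦
    ContDiffOn.differentiableAt_of_isOpen hU hf hw
  have hf2 := ContDiffOn.differentiableAt_of_isOpen hU (contDiffOn_fderiv hU hf) hu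
  have e0 : ∀ γ, coordMap φ x₀ γ = fun w ↦ f w γ := fun γ ↦ rfl
  have e1 : ∀ w ∈ locDom m n φ x₀ (φ x₀), ∀ γ j, pderiv j (coordMap φ x₀ γ) w =
      fderiv ℝ f w (stdVec j) γ := fun w hw γ j ↦ by
    rw [e0, fderiv_apply_coord (hf1 w hw)]; rfl
  have e2 : pderiv i (pderiv j (coordMap φ x₀ γ)) u =
      fderiv ℝ (fderiv ℝ f) u (stdVec i) (stdVec j) γ := by
    rw [pderiv, fderiv_congr_of_isOpen hU (fun w hw ↦ e1 w hw γ j) hu,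
      ← fderiv_fderiv_const hf2, fderiv_apply_coord (hf2.clm_apply (differentiableAt_const _))]
  have e3 : writtenInExtChartAt (𝓡 m) (𝓡 n) x₀ φ u = f u := rfl
  rw [secondFundamentalForm, sff, e2, e3]
  simp only [e1 u hu, PiLp.add_apply, PiLp.sub_apply, chrMap_apply]
  congr 2
  rw [clm_apply_eq_sum]
  simp [chrMap_stdVec]

/-- The tension field of `f` in the charts around `x₀` and `y₀`. -/
def locTension (x₀ : M) (y₀ : N) (f : EuclideanSpace ℝ (Fin m) → EuclideanSpace ℝ (Fin n))
    (u : EuclideanSpace ℝ (Fin m)) : EuclideanSpace ℝ (Fin n) :=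
  metricTrace (metricMatrix x₀ u) (sff (chrMap x₀) (chrMap y₀) f u)

theorem mem_locDom_self (φ : M → N) (x : M) :
    extChartAt (𝓡 m) x x ∈ locDom m n φ x (φ x) :=
  ⟨mem_extChartAt_target x, by simp⟩

theorem tensionField_eq {φ : M → N} (hφ : ContMDiff (𝓡 m) (𝓡 n) ∞ φ) (x : M) :
    tensionField m n φ x = tangentVec (φ x) (φ x)
      (locTension x (φ x) (locMap m n φ x (φ x)) (extChartAt (𝓡 m) x x)) := by
  rw [← sum_smul_coordVec, tensionField]
  refine Finset.sum_congr rfl fun γ _ ↦ ?_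
  congr 1
  simp only [locTension, metricTrace, WithLp.ofLp_sum, Finset.sum_apply, PiLp.smul_apply,
    sff_stdVec_apply hφ (mem_locDom_self φ x), smul_eq_mul]

variable [IsContMDiffRiemannianBundle (𝓡 m) ∞ (EuclideanSpace ℝ (Fin m))
    (fun x : M ↦ TangentSpace (𝓡 m) x)]
  [IsContMDiffRiemannianBundle (𝓡 n) ∞ (EuclideanSpace ℝ (Fin n))
    (fun y : N ↦ TangentSpace (𝓡 n) y)]

omit [IsContMDiffRiemannianBundle (𝓡 m) ∞ (EuclideanSpace ℝ (Fin m))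
    (fun x : M ↦ TangentSpace (𝓡 m) x)] in
/-- The metrics in two charts are related by the change of coordinates. -/
theorem metricBil_chartChange (x₀ x₁ : M) {u : EuclideanSpace ℝ (Fin m)}
    (hu : u ∈ locDom m m (id : M → M) x₁ x₀) (a b : EuclideanSpace ℝ (Fin m)) :
    metricBil x₁ u a b = metricBil x₀ (locMap m m (id : M → M) x₁ x₀ u)
      (fderiv ℝ (locMap m m (id : M → M) x₁ x₀) u a)
      (fderiv ℝ (locMap m m (id : M → M) x₁ x₀) u b) := by
  have hx : (extChartAt (𝓡 m) x₀).symm (locMap m m (id : M → M) x₁ x₀ u) =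
    (extChartAt (𝓡 m) x₁).symm u := (extChartAt (𝓡 m) x₀).left_inv hu.2
  have h := mfderiv_tangentVec (m := m) (n := m) (φ := (id : M → M)) hu mdifferentiableAt_id
  simp only [mfderiv_id, ContinuousLinearMap.id_apply, id] at h
  rw [metricBil_eq_inner, metricBil_eq_inner, hx, h a, h b]

theorem metricBil_gram (x₀ x₁ : M) {u : EuclideanSpace ℝ (Fin m)}
    (hu : u ∈ locDom m m (id : M → M) x₁ x₀) (i j : Fin m) :
    bil (metricMatrix x₀ (locMap m m (id : M → M) x₁ x₀ u))
      (fderiv ℝ (locMap m m (id : M → M) x₁ x₀) u (stdVec i))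
      (fderiv ℝ (locMap m m (id : M → M) x₁ x₀) u (stdVec j)) = metricMatrix x₁ u i j := by
  rw [← bil_stdVec (metricMatrix x₁ u)]
  exact (metricBil_chartChange x₀ x₁ hu _ _).symm

theorem fderiv_chartChange_surjective (x₀ x₁ : M) {u : EuclideanSpace ℝ (Fin m)}
    (hu : u ∈ locDom m m (id : M → M) x₁ x₀) :
    Function.Surjective (fderiv ℝ (locMap m m (id : M → M) x₁ x₀) u) := by
  refine LinearMap.surjective_of_injective (f := (fderiv ℝ (locMap m m (id : M → M) x₁ x₀) u :
    EuclideanSpace ℝ (Fin m) →ₗ[ℝ] EuclideanSpace ℝ (Fin m))) ?_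
  rw [← LinearMap.ker_eq_bot, LinearMap.ker_eq_bot']
  intro a ha
  by_contra hne
  have h1 := metricBil_pos hu.1 hne
  rw [metricBil_chartChange x₀ x₁ hu] at h1
  have ha' : fderiv ℝ (locMap m m (id : M → M) x₁ x₀) u a = 0 := ha
  simp [ha'] at h1

theorem sff_congr {E F : Type*} [NormedAddCommGroup E] [NormedSpace ℝ E]
    [NormedAddCommGroup F] [NormedSpace ℝ F] {Γ : E → E →L[ℝ] E →L[ℝ] E}
    {Γ' : F → F →L[ℝ] F →L[ℝ] F} {f f' : E → F} {U : Set E} (hU : IsOpen U)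
    (h : ∀ u ∈ U, f u = f' u) {u : E} (hu : u ∈ U) (a b : E) :
    sff Γ Γ' f u a b = sff Γ Γ' f' u a b := by
  have h1 : ∀ w ∈ U, fderiv ℝ f w = fderiv ℝ f' w := fun w hw ↦ fderiv_congr_of_isOpen hU h hw
  rw [sff, sff, fderiv_congr_of_isOpen hU h1 hu, h1 u hu, h u hu]

/-- The norm of the tension field can be computed in any pair of charts. -/
theorem norm_tensionField_sq {φ : M → N} (hφ : ContMDiff (𝓡 m) (𝓡 n) ∞ φ) (x₀ : M) (y₀ : N)
    {u : EuclideanSpace ℝ (Fin m)} (hu : u ∈ locDom m n φ x₀ y₀) :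
    ‖tensionField m n φ ((extChartAt (𝓡 m) x₀).symm u)‖ ^ 2 =
      metricBil y₀ (locMap m n φ x₀ y₀ u) (locTension x₀ y₀ (locMap m n φ x₀ y₀) u)
        (locTension x₀ y₀ (locMap m n φ x₀ y₀) u) := by
  obtain ⟨x, hx⟩ : ∃ x, x = (extChartAt (𝓡 m) x₀).symm u := ⟨_, rfl⟩
  have hux : u = extChartAt (𝓡 m) x₀ x := by rw [hx, (extChartAt (𝓡 m) x₀).right_inv hu.1]
  have hxs : x ∈ (extChartAt (𝓡 m) x₀).source := by
    rw [hx]; exact (extChartAt (𝓡 m) x₀).map_target hu.1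
  have hys : φ x ∈ (extChartAt (𝓡 n) y₀).source := by rw [hx]; exact hu.2
  have hy : φ x ∈ (extChartAt (𝓡 n) (φ x)).source := by simp
  rw [← hx]
  -- The tension field at `x` is defined in the charts centred at `x` and `φ x`, which move with
  -- `x`. The passage to the fixed charts is through the transition maps `χ` in the source and `ζ`
  -- in the target: the map in centred charts is `ζ ∘ f ∘ χ`.
  set v := extChartAt (𝓡 m) x x with hv
  have hvx : (extChartAt (𝓡 m) x).symm v = x := by simp [hv]
  set χ := locMap m m (id : M → M) x x₀ with hχ
  set ζ := locMap n n (id : N → N) y₀ (φ x) with hζ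
  set f := locMap m n φ x₀ y₀ with hf
  have hid : ContMDiff (𝓡 m) (𝓡 m) ∞ (id : M → M) := contMDiff_id
  have hid' : ContMDiff (𝓡 n) (𝓡 n) ∞ (id : N → N) := contMDiff_id
  have hvD : v ∈ locDom m m (id : M → M) x x₀ :=
    ⟨mem_extChartAt_target x, by rw [Set.mem_preimage, hvx]; exact hxs⟩
  have hχv : χ v = u := by rw [hχ, locMap, hvx, hux]; rfl
  have hfu : f u = extChartAt (𝓡 n) y₀ (φ x) := by rw [hf, locMap, ← hx]
  have hfuD : f u ∈ locDom n n (id : N → N) y₀ (φ x) :=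
    ⟨mapsTo_locMap φ x₀ y₀ hu, by
      rw [hfu, Set.mem_preimage, (extChartAt (𝓡 n) y₀).left_inv hys]; exact hy⟩
  have hζfu : ζ (f u) = extChartAt (𝓡 n) (φ x) (φ x) := by
    rw [hζ, locMap, hfu, (extChartAt (𝓡 n) y₀).left_inv hys]; rfl
  -- a neighbourhood of `v` on which everything is defined
  have hV₁ : IsOpen (locDom n n (id : N → N) y₀ (φ x)) := isOpen_locDom hid'.continuous y₀ (φ x)
  have hU₀ : IsOpen (locDom m n φ x₀ y₀) := isOpen_locDom hφ.continuous x₀ y₀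
  have hf0 : ContDiffOn ℝ ∞ f (locDom m n φ x₀ y₀) := contDiffOn_locMap hφ x₀ y₀
  set U₁ := locDom m n φ x₀ y₀ ∩ f ⁻¹' locDom n n (id : N → N) y₀ (φ x) with hU₁
  have hU₁o : IsOpen U₁ := hf0.continuousOn.isOpen_inter_preimage hU₀ hV₁
  have hχ0 : ContDiffOn ℝ ∞ χ (locDom m m (id : M → M) x x₀) := contDiffOn_locMap hid x x₀
  set W := locDom m m (id : M → M) x x₀ ∩ χ ⁻¹' U₁ with hW
  have hWo : IsOpen W := hχ0.continuousOn.isOpen_inter_preimage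
    (isOpen_locDom hid.continuous x x₀) hU₁o
  have hvW : v ∈ W := ⟨hvD, by rw [Set.mem_preimage, hχv]; exact ⟨hu, hfuD⟩⟩
  have hcomp : ∀ w ∈ W, locMap m n φ x (φ x) w = (ζ ∘ (f ∘ χ)) w := by
    intro w hw
    have h1 : (extChartAt (𝓡 m) x₀).symm (χ w) = (extChartAt (𝓡 m) x).symm w :=
      (extChartAt (𝓡 m) x₀).left_inv hw.1.2
    have h2 : (extChartAt (𝓡 n) y₀).symm (f (χ w)) = φ ((extChartAt (𝓡 m) x).symm w) := by
      rw [hf, locMap, h1]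
      exact (extChartAt (𝓡 n) y₀).left_inv (by have := hw.2.1.2; rwa [Set.mem_preimage, h1] at this)
    simp only [Function.comp_apply, hζ, locMap, h2, id]
  have hχW : ContDiffOn ℝ ∞ χ W := hχ0.mono Set.inter_subset_left
  have hfU₁ : ContDiffOn ℝ ∞ f U₁ := hf0.mono Set.inter_subset_left
  have hζ0 : ContDiffOn ℝ ∞ ζ (locDom n n (id : N → N) y₀ (φ x)) :=
    contDiffOn_locMap hid' y₀ (φ x)
  have hgx := (isLocalMetric x).mono hWo (fun w hw ↦ locDom_subset _ _ _ hw.1)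
  have hgx₀ := isLocalMetric (m := m) x₀
  have hhy := (isLocalMetric (m := n) y₀).mono hV₁ (locDom_subset _ _ _)
  have hhφ := isLocalMetric (m := n) (φ x)
  -- Transition maps are isometries, so their second fundamental forms vanish and the composition
  -- formula leaves only the term of `f`.
  have key : ∀ a b, sff (chrMap x) (chrMap (φ x)) (locMap m n φ x (φ x)) v a b =
      fderiv ℝ ζ (f u) (sff (chrMap x₀) (chrMap y₀) f u (fderiv ℝ χ v a) (fderiv ℝ χ v b)) := by
    intro a b
    rw [sff_congr hWo hcomp hvW,
      sff_comp hWo hV₁ (hfU₁.comp hχW fun w hw ↦ hw.2) (fun w hw ↦ hw.2.2) hζ0 (chrMap x)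
        (chrMap y₀) (chrMap (φ x)) hvW,
      sff_comp hWo hU₁o hχW (fun w hw ↦ hw.2) hfU₁ (chrMap x) (chrMap x₀) (chrMap y₀) hvW,
      sff_eq_zero_of_isometry hgx hgx₀ hχW (fun w hw ↦ mapsTo_locMap _ _ _ hw.1)
        (fun w hw ↦ metricBil_chartChange x₀ x hw.1) hvW (fderiv_chartChange_surjective x₀ x hvD)]
    simp only [Function.comp_apply, hχv]
    rw [sff_eq_zero_of_isometry hhy hhφ hζ0 (fun w hw ↦ mapsTo_locMap _ _ _ hw)
        (fun w hw ↦ metricBil_chartChange (φ x) y₀ hw) hfuD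
        (fderiv_chartChange_surjective (φ x) y₀ hfuD)]
    simp
  have htr : locTension x (φ x) (locMap m n φ x (φ x)) v =
      fderiv ℝ ζ (f u) (locTension x₀ y₀ f u) := by
    have h1 := metricTrace_eq_of_gram (A := metricMatrix x₀ u) (B := metricMatrix x v)
      (v := fun i ↦ fderiv ℝ χ v (stdVec i))
      (fun i j ↦ by rw [← metricBil_gram x₀ x hvD, ← hχ, hχv])
      (metricMatrix_det_pos hvD.1).ne' (sff_isBilinear (chrMap x₀) (chrMap y₀) f u)
    rw [locTension, locTension, ← h1, metricTrace]
    simp only [map_sum, map_smul, key]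
  rw [tensionField_eq hφ, ← hv, htr, ← real_inner_self_eq_norm_sq,
    metricBil_chartChange (φ x) y₀ hfuD, ← hζ, metricBil_eq_inner, hζfu,
    (extChartAt (𝓡 n) (φ x)).left_inv hy]

end Maps

/-! ### Horizontal lifts. -/

/-- Polarization turns preservation of lengths on the orthogonal complement of the kernel into
preservation of inner products. The lift is the part of any preimage orthogonal to the kernel, and
the kernel part of a test vector contributes to neither side. -/
theorem exists_horizontal_lift {T T' : Type*} [NormedAddCommGroup T] [InnerProductSpace ℝ T]
    [FiniteDimensional ℝ T] [NormedAddCommGroup T'] [InnerProductSpace ℝ T'] (D : T →ₗ[ℝ] T')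
    (hD : Function.Surjective D)
    (hn : ∀ v : T, (∀ w : T, D w = 0 → inner ℝ v w = 0) → ‖D v‖ = ‖v‖) (w : T') :
    ∃ x : T, D x = w ∧ ∀ a, inner ℝ x a = inner ℝ w (D a) := by
  set K := LinearMap.ker D
  have hor : ∀ p ∈ Kᗮ, ∀ w : T, D w = 0 → inner ℝ p w = 0 := fun p hp w hw ↦
    (Submodule.mem_orthogonal' K p).1 hp w (LinearMap.mem_ker.2 hw)
  have hinner : ∀ p ∈ Kᗮ, ∀ q ∈ Kᗮ, inner ℝ p q = inner ℝ (D p) (D q) := by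
    intro p hp q hq
    rw [real_inner_eq_norm_add_mul_self_sub_norm_mul_self_sub_norm_mul_self_div_two,
      real_inner_eq_norm_add_mul_self_sub_norm_mul_self_sub_norm_mul_self_div_two, ← map_add,
      hn p (hor p hp), hn q (hor q hq), hn (p + q) (hor _ (Kᗮ.add_mem hp hq))]
  obtain ⟨v, rfl⟩ := hD w
  obtain ⟨k, hk, p, hp, rfl⟩ := K.exists_add_mem_mem_orthogonal v
  refine ⟨p, by simp [LinearMap.mem_ker.1 hk], fun a ↦ ?_⟩
  obtain ⟨k', hk', q, hq, rfl⟩ := K.exists_add_mem_mem_orthogonal a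
  rw [map_add, map_add, LinearMap.mem_ker.1 hk, LinearMap.mem_ker.1 hk', zero_add, zero_add,
    inner_add_right, hinner p hp q hq, hor p hp k' (LinearMap.mem_ker.1 hk'), zero_add]

section Maps

variable {m n : ℕ}
  {M : Type*} [TopologicalSpace M] [ChartedSpace (EuclideanSpace ℝ (Fin m)) M]
  [IsManifold (𝓡 m) ∞ M]
  {N : Type*} [TopologicalSpace N] [ChartedSpace (EuclideanSpace ℝ (Fin n)) N]
  [IsManifold (𝓡 n) ∞ N]
  [RiemannianBundle (fun x : M ↦ TangentSpace (𝓡 m) x)]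
  [RiemannianBundle (fun y : N ↦ TangentSpace (𝓡 n) y)]

/-- Existence of horizontal lifts for a Riemannian submersion, in charts. -/
theorem IsRiemannianSubmersion.exists_lift {φ : M → N} (hφ : IsRiemannianSubmersion m n φ) (x₀ : M)
    (y₀ : N) {u : EuclideanSpace ℝ (Fin m)} (hu : u ∈ locDom m n φ x₀ y₀)
    (w : EuclideanSpace ℝ (Fin n)) :
    ∃ x, fderiv ℝ (locMap m n φ x₀ y₀) u x = w ∧ ∀ a, metricBil x₀ u x a =
      metricBil y₀ (locMap m n φ x₀ y₀ u) w (fderiv ℝ (locMap m n φ x₀ y₀) u a) := by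
  have hT := mfderiv_tangentVec hu (hφ.contMDiff.mdifferentiableAt (by simp))
  have hy : (extChartAt (𝓡 n) y₀).symm (locMap m n φ x₀ y₀ u) =
    φ ((extChartAt (𝓡 m) x₀).symm u) := (extChartAt (𝓡 n) y₀).left_inv hu.2
  have hys : φ ((extChartAt (𝓡 m) x₀).symm u) ∈ (chartAt (EuclideanSpace ℝ (Fin n)) y₀).source := by
    have h := hu.2
    rwa [Set.mem_preimage, extChartAt_source] at h
  have : FiniteDimensional ℝ (TangentSpace (𝓡 m) ((extChartAt (𝓡 m) x₀).symm u)) :=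
    inferInstanceAs (FiniteDimensional ℝ (EuclideanSpace ℝ (Fin m)))
  obtain ⟨X, hX, hXa⟩ := exists_horizontal_lift
    (mfderiv (𝓡 m) (𝓡 n) φ ((extChartAt (𝓡 m) x₀).symm u)).toLinearMap
    (hφ.surjective _) (fun v hv ↦ hφ.norm_eq _ v hv)
    (tangentVec y₀ (φ ((extChartAt (𝓡 m) x₀).symm u)) w)
  obtain ⟨x, rfl⟩ := tangentVec_surjective (chart_symm_mem_source hu.1) X
  refine ⟨x, tangentVec_injective hys ((hT x).symm.trans hX), fun a ↦ ?_⟩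
  rw [metricBil_eq_inner, metricBil_eq_inner, hXa, hy]
  congr 1
  exact hT a

end Maps

/-! ### The Riemannian volume and integration in charts. -/

theorem det_eq_det_of_stdVec {m : ℕ} (L : EuclideanSpace ℝ (Fin m) →L[ℝ] EuclideanSpace ℝ (Fin m)) :
    L.det = (Matrix.of fun k i ↦ L (stdVec i) k).det := by
  rw [ContinuousLinearMap.det, ← LinearMap.det_toMatrix (EuclideanSpace.basisFun (Fin m) ℝ).toBasis]
  congr 1

section Charts

variable {m : ℕ} {M : Type*} [TopologicalSpace M] [ChartedSpace (EuclideanSpace ℝ (Fin m)) M]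
  [IsManifold (𝓡 m) ∞ M] [RiemannianBundle (fun x : M ↦ TangentSpace (𝓡 m) x)]
  [IsContMDiffRiemannianBundle (𝓡 m) ∞ (EuclideanSpace ℝ (Fin m))
    (fun x : M ↦ TangentSpace (𝓡 m) x)]

/-- The density `√(det g)` of the Riemannian volume in the chart around `x₀`. -/
def volDensity (x₀ : M) (u : EuclideanSpace ℝ (Fin m)) : ℝ := √(metricMatrix x₀ u).det

theorem volDensity_pos {x₀ : M} {u : EuclideanSpace ℝ (Fin m)}
    (hu : u ∈ (extChartAt (𝓡 m) x₀).target) : 0 < volDensity x₀ u :=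
  Real.sqrt_pos.2 (metricMatrix_det_pos hu)

theorem contDiffOn_volDensity (x₀ : M) :
    ContDiffOn ℝ ∞ (volDensity (m := m) x₀) (extChartAt (𝓡 m) x₀).target :=
  (contDiffOn_det (contDiffOn_metricMatrix x₀)).sqrt fun _ hu ↦ (metricMatrix_det_pos hu).ne'

theorem volDensity_chartChange (x₀ x₁ : M) {u : EuclideanSpace ℝ (Fin m)}
    (hu : u ∈ locDom m m (id : M → M) x₁ x₀) :
    volDensity x₁ u = |(fderiv ℝ (locMap m m (id : M → M) x₁ x₀) u).det| *
      volDensity x₀ (locMap m m (id : M → M) x₁ x₀ u) := by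
  rw [volDensity, volDensity, det_eq_det_of_stdVec,
    eq_transpose_mul_mul_of_gram (metricBil_gram x₀ x₁ hu), Matrix.det_mul, Matrix.det_mul,
    Matrix.det_transpose, mul_right_comm, ← pow_two, Real.sqrt_mul (sq_nonneg _), Real.sqrt_sq_eq_abs]

variable [MeasurableSpace M] [BorelSpace M]

theorem aemeasurable_chart_symm (x₀ : M) :
    AEMeasurable (extChartAt (𝓡 m) x₀).symm
      ((volume.restrict (extChartAt (𝓡 m) x₀).target).withDensity
        fun u ↦ ENNReal.ofReal (volDensity x₀ u)) :=
  ((continuousOn_extChartAt_symm x₀).aemeasurable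
    (isOpen_extChartAt_target x₀).measurableSet).mono_ac (withDensity_absolutelyContinuous _ _)

theorem measurableSet_chart_preimage (x₀ : M) {A : Set M} (hA : MeasurableSet A) :
    MeasurableSet ((extChartAt (𝓡 m) x₀).symm ⁻¹' A ∩ (extChartAt (𝓡 m) x₀).target) := by
  have h : Measurable ((extChartAt (𝓡 m) x₀).target.domRestrict (extChartAt (𝓡 m) x₀).symm) :=
    (continuousOn_iff_continuous_domRestrict.1 (continuousOn_extChartAt_symm x₀)).measurable
  have := (isOpen_extChartAt_target (I := 𝓡 m) x₀).measurableSet.subtype_image (h hA)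
  convert this using 1
  ext u
  simp [and_comm]

theorem chartVolume_apply (x₀ : M) {A : Set M} (hA : MeasurableSet A) :
    chartVolume (m := m) x₀ A =
      ∫⁻ u in (extChartAt (𝓡 m) x₀).symm ⁻¹' A ∩ (extChartAt (𝓡 m) x₀).target,
        ENNReal.ofReal (volDensity x₀ u) := by
  have ht := (isOpen_extChartAt_target (I := 𝓡 m) x₀).measurableSet
  rw [show chartVolume (m := m) x₀ = Measure.map (extChartAt (𝓡 m) x₀).symm
    ((volume.restrict (extChartAt (𝓡 m) x₀).target).withDensity
        fun u ↦ ENNReal.ofReal (volDensity x₀ u)) from rfl, Measure.map_apply_of_aemeasurable (aemeasurable_chart_symm x₀) hA,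
    withDensity_apply' _ _, Measure.restrict_restrict' ht]

/-- Change of variables under the transition map. Only an inequality holds, since the part of `A`
outside the chart around `x₁` is invisible to the left-hand side. -/
theorem chartVolume_le (x₀ x₁ : M) {A : Set M} (hA : MeasurableSet A)
    (hAs : A ⊆ (extChartAt (𝓡 m) x₀).source) :
    chartVolume (m := m) x₁ A ≤ chartVolume (m := m) x₀ A := by
  rw [chartVolume_apply x₁ hA, chartVolume_apply x₀ hA]
  set χ := locMap m m (id : M → M) x₁ x₀ with hχ
  set S := (extChartAt (𝓡 m) x₁).symm ⁻¹' A ∩ (extChartAt (𝓡 m) x₁).target with hS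
  have hSD : S ⊆ locDom m m (id : M → M) x₁ x₀ := fun u hu ↦ ⟨hu.2, hAs hu.1⟩
  have hSm : MeasurableSet S := measurableSet_chart_preimage x₁ hA
  have hid : ContMDiff (𝓡 m) (𝓡 m) ∞ (id : M → M) := contMDiff_id
  have hs : ∀ u ∈ S, (extChartAt (𝓡 m) x₀).symm (χ u) = (extChartAt (𝓡 m) x₁).symm u :=
    fun u hu ↦ (extChartAt (𝓡 m) x₀).left_inv (hSD hu).2
  have hinj : Set.InjOn χ S := by
    intro u hu v hv huv
    have h1 := hs u hu
    rw [huv, hs v hv] at h1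
    exact ((extChartAt (𝓡 m) x₁).symm.injOn hv.2 hu.2 h1).symm
  have hd : ∀ u ∈ S, HasFDerivWithinAt χ (fderiv ℝ χ u) S u := fun u hu ↦
    (ContDiffOn.differentiableAt_of_isOpen (isOpen_locDom hid.continuous x₁ x₀)
      (contDiffOn_locMap hid x₁ x₀) (hSD hu)).hasFDerivAt.hasFDerivWithinAt
  have e1 : ∫⁻ u in S, ENNReal.ofReal (volDensity x₁ u) =
      ∫⁻ u in S, ENNReal.ofReal |(fderiv ℝ χ u).det| * ENNReal.ofReal (volDensity x₀ (χ u)) := by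
    refine setLIntegral_congr_fun hSm fun u hu ↦ ?_
    rw [volDensity_chartChange x₀ x₁ (hSD hu), ENNReal.ofReal_mul (abs_nonneg _)]
  rw [e1, ← lintegral_image_eq_lintegral_abs_det_fderiv_mul volume hSm hd hinj
    (fun v ↦ ENNReal.ofReal (volDensity x₀ v))]
  refine lintegral_mono_set ?_
  rintro _ ⟨u, hu, rfl⟩
  exact ⟨by rw [Set.mem_preimage, hs u hu]; exact hu.1, mapsTo_locMap _ _ _ (hSD hu)⟩

/-- Each chart measure, hence the supremum, is at most the chart measure of `x₀` on the domain `s`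
plus the supremum itself off `s`. Restricting this bound to `s` removes the second summand. -/
theorem riemannianVolume_restrict (x₀ : M) :
    (riemannianVolume m M).restrict (extChartAt (𝓡 m) x₀).source =
      (chartVolume (m := m) x₀).restrict (extChartAt (𝓡 m) x₀).source := by
  have hs := (isOpen_extChartAt_source (I := 𝓡 m) x₀).measurableSet
  set s := (extChartAt (𝓡 m) x₀).source
  refine le_antisymm ?_ (Measure.restrict_mono le_rfl (le_iSup _ x₀))
  have h : riemannianVolume m M ≤
      (chartVolume (m := m) x₀).restrict s + (riemannianVolume m M).restrict sᶜ := by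
    refine iSup_le fun x₁ ↦ ?_
    rw [← Measure.restrict_add_restrict_compl (μ := chartVolume (m := m) x₁) hs]
    refine add_le_add ?_ (Measure.restrict_mono le_rfl (le_iSup _ x₁))
    refine Measure.le_intro fun A hA _ ↦ ?_
    rw [Measure.restrict_apply hA, Measure.restrict_apply hA]
    exact chartVolume_le x₀ x₁ (hA.inter hs) Set.inter_subset_right
  have h2 := Measure.restrict_mono (s := s) le_rfl h
  rw [Measure.restrict_add, Measure.restrict_restrict hs, Measure.restrict_restrict hs,
    Set.inter_self, Set.inter_compl_self, Measure.restrict_empty, add_zero] at h2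
  exact h2

theorem riemannianVolume_apply (x₀ : M) {A : Set M} (hA : MeasurableSet A)
    (hAs : A ⊆ (extChartAt (𝓡 m) x₀).source) :
    riemannianVolume m M A =
      ∫⁻ u in (extChartAt (𝓡 m) x₀).symm ⁻¹' A ∩ (extChartAt (𝓡 m) x₀).target,
        ENNReal.ofReal (volDensity x₀ u) := by
  have h := congrArg (fun μ ↦ μ A) (riemannianVolume_restrict (m := m) x₀)
  rw [Measure.restrict_apply hA, Measure.restrict_apply hA, Set.inter_eq_left.2 hAs] at h
  rw [h, chartVolume_apply x₀ hA]

theorem riemannianVolume_lt_top_of_isCompact {Ω : Set M} (hΩ : IsCompact Ω) :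
    riemannianVolume m M Ω < ⊤ := by
  refine hΩ.measure_lt_top_of_nhdsWithin fun x _ ↦ ?_
  obtain ⟨r, hr, hrt⟩ := Metric.nhds_basis_closedBall.mem_iff.1
    ((isOpen_extChartAt_target (I := 𝓡 m) x).mem_nhds (mem_extChartAt_target x))
  set A := (extChartAt (𝓡 m) x).source ∩ extChartAt (𝓡 m) x ⁻¹'
    Metric.ball (extChartAt (𝓡 m) x x) r with hA
  have hAo : IsOpen A := (continuousOn_extChartAt x).isOpen_inter_preimage
    (isOpen_extChartAt_source x) Metric.isOpen_ball
  refine ⟨A, mem_nhdsWithin_of_mem_nhds (hAo.mem_nhds ⟨mem_extChartAt_source x,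
    Metric.mem_ball_self hr⟩), ?_⟩
  rw [riemannianVolume_apply x hAo.measurableSet Set.inter_subset_left]
  have hi : IntegrableOn (volDensity (m := m) x) (Metric.closedBall (extChartAt (𝓡 m) x x) r) :=
    ((contDiffOn_volDensity x).continuousOn.mono hrt).integrableOn_compact
      (isCompact_closedBall _ _)
  refine lt_of_le_of_lt (lintegral_mono_set ?_) hi.lintegral_lt_top
  intro u hu
  have := hu.1.2
  rw [Set.mem_preimage, (extChartAt (𝓡 m) x).right_inv hu.2] at this
  exact Metric.ball_subset_closedBall this

/-- Integration against the Riemannian volume over a compact subset of a chart. -/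
theorem setIntegral_riemannianVolume (x₀ : M) {K : Set (EuclideanSpace ℝ (Fin m))}
    (hK : IsCompact K) (hKt : K ⊆ (extChartAt (𝓡 m) x₀).target) [T2Space M] {F : M → ℝ}
    (hF : ContinuousOn F ((extChartAt (𝓡 m) x₀).symm '' K)) :
    ∫ x in (extChartAt (𝓡 m) x₀).symm '' K, F x ∂(riemannianVolume m M) =
      ∫ u in K, volDensity x₀ u * F ((extChartAt (𝓡 m) x₀).symm u) := by
  set Ω := (extChartAt (𝓡 m) x₀).symm '' K with hΩ
  have hΩc : IsCompact Ω := hK.image_of_continuousOn ((continuousOn_extChartAt_symm x₀).mono hKt)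
  have hΩm : MeasurableSet Ω := hΩc.measurableSet
  have hΩs : Ω ⊆ (extChartAt (𝓡 m) x₀).source := by
    rintro _ ⟨u, hu, rfl⟩
    exact (extChartAt (𝓡 m) x₀).map_target (hKt hu)
  have ht := (isOpen_extChartAt_target (I := 𝓡 m) x₀).measurableSet
  have hs := (isOpen_extChartAt_source (I := 𝓡 m) x₀).measurableSet
  have e1 : (riemannianVolume m M).restrict Ω = (chartVolume (m := m) x₀).restrict Ω := by
    have := congrArg (fun μ ↦ μ.restrict Ω) (riemannianVolume_restrict (m := m) x₀)
    simpa only [Measure.restrict_restrict hΩm, Set.inter_eq_left.2 hΩs] using this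
  have hpre : (extChartAt (𝓡 m) x₀).symm ⁻¹' Ω ∩ (extChartAt (𝓡 m) x₀).target = K := by
    ext u
    constructor
    · rintro ⟨⟨v, hv, hvu⟩, hu⟩
      rwa [← (extChartAt (𝓡 m) x₀).symm.injOn (hKt hv) hu hvu]
    · exact fun hu ↦ ⟨⟨u, hu, rfl⟩, hKt hu⟩
  have hρ : AEMeasurable (fun u ↦ ENNReal.ofReal (volDensity x₀ u)) (volume.restrict K) :=
    (((contDiffOn_volDensity x₀).continuousOn.mono hKt).aemeasurable
      hK.measurableSet).ennreal_ofReal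
  have e2 : (chartVolume (m := m) x₀).restrict Ω = Measure.map (extChartAt (𝓡 m) x₀).symm
      ((volume.restrict K).withDensity fun u ↦ ENNReal.ofReal (volDensity x₀ u)) := by
    have h := Measure.restrict_map_of_aemeasurable (aemeasurable_chart_symm (m := m) x₀) hΩm
    rw [restrict_withDensity', Measure.restrict_restrict' ht, hpre] at h
    exact h
  have hm : AEMeasurable (extChartAt (𝓡 m) x₀).symm
      ((volume.restrict K).withDensity fun u ↦ ENNReal.ofReal (volDensity x₀ u)) :=
    (((continuousOn_extChartAt_symm x₀).mono hKt).aemeasurable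
      hK.measurableSet).mono_ac (withDensity_absolutelyContinuous _ _)
  have hFm : AEStronglyMeasurable F (Measure.map (extChartAt (𝓡 m) x₀).symm
      ((volume.restrict K).withDensity fun u ↦ ENNReal.ofReal (volDensity x₀ u))) := by
    rw [← e2]
    exact hF.aestronglyMeasurable hΩm
  rw [e1, e2, integral_map hm hFm, integral_withDensity_eq_integral_toReal_smul₀ hρ
    (by simp)]
  refine setIntegral_congr_fun hK.measurableSet fun u hu ↦ ?_
  simp [ENNReal.toReal_ofReal (volDensity_pos (hKt hu)).le]

end Charts

/-! ### Smooth families of maps; harmonic maps are biharmonic. -/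

section Variation

variable {E F : Type*} [NormedAddCommGroup E] [NormedSpace ℝ E]
  [NormedAddCommGroup F] [NormedSpace ℝ F]

theorem fderiv_slice {G : ℝ × E → F} {t : ℝ} {u : E} (hG : DifferentiableAt ℝ G (t, u)) (a : E) :
    fderiv ℝ (fun w ↦ G (t, w)) u a = fderiv ℝ G (t, u) (0, a) := by
  have h : HasFDerivAt (fun w ↦ G (t, w)) _ u :=
    hG.hasFDerivAt.comp u (hasFDerivAt_prodMk_right t u)
  rw [h.fderiv]
  simp

theorem contDiffOn_slice {G : ℝ × E → F} {O : Set (ℝ × E)} (hG : ContDiffOn ℝ ∞ G O) (t : ℝ) :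
    ContDiffOn ℝ ∞ (fun w ↦ G (t, w)) ((fun w ↦ (t, w)) ⁻¹' O) :=
  hG.comp (contDiff_prodMk_right t).contDiffOn fun _ h ↦ h

/-- The second fundamental forms of a smooth family of maps depend smoothly on the parameter. -/
theorem contDiffOn_sff_family {O : Set (ℝ × E)} (hO : IsOpen O) {Ψ : ℝ × E → F}
    (hΨ : ContDiffOn ℝ ∞ Ψ O) {U : Set E} {Γ : E → E →L[ℝ] E →L[ℝ] E} (hΓ : ContDiffOn ℝ ∞ Γ U)
    (hOU : ∀ p ∈ O, p.2 ∈ U) {V : Set F} {Γ' : F → F →L[ℝ] F →L[ℝ] F}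
    (hΓ' : ContDiffOn ℝ ∞ Γ' V) (hOV : Set.MapsTo Ψ O V) (a b : E) :
    ContDiffOn ℝ ∞ (fun p : ℝ × E ↦ sff Γ Γ' (fun w ↦ Ψ (p.1, w)) p.2 a b) O := by
  have hd : ∀ p ∈ O, DifferentiableAt ℝ Ψ p := fun p hp ↦
    ContDiffOn.differentiableAt_of_isOpen hO hΨ hp
  have h1 : ∀ p ∈ O, ∀ a, fderiv ℝ (fun w ↦ Ψ (p.1, w)) p.2 a = fderiv ℝ Ψ p (0, a) :=
    fun p hp a ↦ fderiv_slice (hd p hp) a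
  have hD : ∀ a : E, ContDiffOn ℝ ∞ (fun p ↦ fderiv ℝ Ψ p (0, a)) O := fun a ↦
    (contDiffOn_fderiv hO hΨ).clm_apply contDiffOn_const
  have hOt : ∀ t : ℝ, IsOpen ((fun w : E ↦ (t, w)) ⁻¹' O) := fun t ↦
    hO.preimage (by fun_prop)
  -- Derivatives of a slice are derivatives of `Ψ` on the product in the directions `(0, a)` and
  -- `(0, b)`; in this form they are jointly smooth in the parameter and the point.
  have h2 : ∀ p ∈ O, fderiv ℝ (fderiv ℝ (fun w ↦ Ψ (p.1, w))) p.2 a b =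
      fderiv ℝ (fun q ↦ fderiv ℝ Ψ q (0, b)) p (0, a) := by
    rintro ⟨t, u⟩ hp
    have hs := contDiffOn_fderiv (hOt t) (contDiffOn_slice hΨ t)
    rw [← fderiv_fderiv_const (ContDiffOn.differentiableAt_of_isOpen (hOt t) hs hp),
      fderiv_congr_of_isOpen (hOt t) (fun w hw ↦ h1 (t, w) hw b) hp,
      fderiv_slice (G := fun q ↦ fderiv ℝ Ψ q (0, b))
        (ContDiffOn.differentiableAt_of_isOpen hO (hD b) hp)]
  have hsnd : ContDiffOn ℝ ∞ (fun p : ℝ × E ↦ Γ p.2) O :=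
    hΓ.comp contDiff_snd.contDiffOn hOU
  have hΓΨ : ContDiffOn ℝ ∞ (fun p : ℝ × E ↦ Γ' (Ψ p)) O := hΓ'.comp hΨ hOV
  have hpair : ContDiffOn ℝ ∞ (fun p : ℝ × E ↦ ((0 : ℝ), Γ p.2 a b)) O :=
    contDiffOn_const.prodMk ((hsnd.clm_apply contDiffOn_const).clm_apply contDiffOn_const)
  refine ((((contDiffOn_fderiv hO (hD b)).clm_apply
    (contDiffOn_const (c := ((0 : ℝ), a)))).sub
    ((contDiffOn_fderiv hO hΨ).clm_apply hpair)).add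
      ((hΓΨ.clm_apply (hD a)).clm_apply (hD b))).congr fun p hp ↦ ?_
  simp only [sff, h1 p hp, h2 p hp]

end Variation

section Maps

variable {m n : ℕ}
  {M : Type*} [TopologicalSpace M] [ChartedSpace (EuclideanSpace ℝ (Fin m)) M]
  [IsManifold (𝓡 m) ∞ M]
  {N : Type*} [TopologicalSpace N] [ChartedSpace (EuclideanSpace ℝ (Fin n)) N]
  [IsManifold (𝓡 n) ∞ N]

variable (m n) in
/-- The domain of a variation in the charts around `x₀` and `y₀`. -/
def variationDom (Φ : ℝ → M → N) (x₀ : M) (y₀ : N) : Set (ℝ × EuclideanSpace ℝ (Fin m)) :=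
  {p | p.2 ∈ locDom m n (Φ p.1) x₀ y₀}

theorem contMDiff_slice {Φ : ℝ → M → N}
    (hΦ : ContMDiff (𝓘(ℝ, ℝ).prod (𝓡 m)) (𝓡 n) ∞ (fun p : ℝ × M ↦ Φ p.1 p.2)) (t : ℝ) :
    ContMDiff (𝓡 m) (𝓡 n) ∞ (Φ t) :=
  hΦ.comp (contMDiff_const.prodMk contMDiff_id)

theorem contMDiffOn_variation_aux (x₀ : M) :
    ContMDiffOn 𝓘(ℝ, ℝ × EuclideanSpace ℝ (Fin m)) (𝓘(ℝ, ℝ).prod (𝓡 m)) ∞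
      (fun p : ℝ × EuclideanSpace ℝ (Fin m) ↦ (p.1, (extChartAt (𝓡 m) x₀).symm p.2))
      {p | p.2 ∈ (extChartAt (𝓡 m) x₀).target} := by
  refine ContMDiffOn.prodMk ?_ ?_
  · exact contDiff_fst.contMDiff.contMDiffOn
  · exact (contMDiffOn_extChartAt_symm x₀).comp contDiff_snd.contMDiff.contMDiffOn fun p hp ↦ hp

theorem isOpen_variationDom {Φ : ℝ → M → N}
    (hΦ : ContMDiff (𝓘(ℝ, ℝ).prod (𝓡 m)) (𝓡 n) ∞ (fun p : ℝ × M ↦ Φ p.1 p.2)) (x₀ : M) (y₀ : N) :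
    IsOpen (variationDom m n Φ x₀ y₀) :=
  (hΦ.continuous.comp_continuousOn (contMDiffOn_variation_aux x₀).continuousOn).isOpen_inter_preimage
    ((isOpen_extChartAt_target x₀).preimage continuous_snd) (isOpen_extChartAt_source y₀)

theorem contDiffOn_variation {Φ : ℝ → M → N}
    (hΦ : ContMDiff (𝓘(ℝ, ℝ).prod (𝓡 m)) (𝓡 n) ∞ (fun p : ℝ × M ↦ Φ p.1 p.2)) (x₀ : M) (y₀ : N) :
    ContDiffOn ℝ ∞ (fun p : ℝ × EuclideanSpace ℝ (Fin m) ↦ locMap m n (Φ p.1) x₀ y₀ p.2)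
      (variationDom m n Φ x₀ y₀) := by
  rw [← contMDiffOn_iff_contDiffOn]
  refine (contMDiffOn_extChartAt (x := y₀)).comp (hΦ.comp_contMDiffOn
    ((contMDiffOn_variation_aux x₀).mono fun p hp ↦ hp.1)) fun p hp ↦ ?_
  have h := hp.2
  rwa [Set.mem_preimage, extChartAt_source] at h

variable [RiemannianBundle (fun x : M ↦ TangentSpace (𝓡 m) x)]
  [RiemannianBundle (fun y : N ↦ TangentSpace (𝓡 n) y)]
  [IsContMDiffRiemannianBundle (𝓡 m) ∞ (EuclideanSpace ℝ (Fin m))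
    (fun x : M ↦ TangentSpace (𝓡 m) x)]
  [IsContMDiffRiemannianBundle (𝓡 n) ∞ (EuclideanSpace ℝ (Fin n))
    (fun y : N ↦ TangentSpace (𝓡 n) y)]

theorem contDiffOn_locTension_family {O : Set (ℝ × EuclideanSpace ℝ (Fin m))} (hO : IsOpen O)
    {Ψ : ℝ × EuclideanSpace ℝ (Fin m) → EuclideanSpace ℝ (Fin n)} (hΨ : ContDiffOn ℝ ∞ Ψ O)
    {x₀ : M} {y₀ : N} (hO₁ : ∀ p ∈ O, p.2 ∈ (extChartAt (𝓡 m) x₀).target)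
    (hO₂ : ∀ p ∈ O, Ψ p ∈ (extChartAt (𝓡 n) y₀).target) :
    ContDiffOn ℝ ∞ (fun p : ℝ × EuclideanSpace ℝ (Fin m) ↦
      locTension x₀ y₀ (fun w ↦ Ψ (p.1, w)) p.2) O := by
  unfold locTension metricTrace
  refine ContDiffOn.sum fun i _ ↦ ContDiffOn.sum fun j _ ↦ ?_
  have hinv := contDiffOn_inv_matrix (contDiffOn_metricMatrix (m := m) x₀)
      (fun u hu ↦ (metricMatrix_det_pos hu).ne') i j
  have hinv' : ContDiffOn ℝ ∞ (fun p : ℝ × EuclideanSpace ℝ (Fin m) ↦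
    (metricMatrix x₀ p.2)⁻¹ i j) O := hinv.comp contDiff_snd.contDiffOn hO₁
  exact hinv'.smul (contDiffOn_sff_family hO hΨ (isLocalMetric x₀).contDiffOn_chr hO₁
      (isLocalMetric y₀).contDiffOn_chr hO₂ _ _)

theorem continuousAt_norm_comp {X W : Type*} [TopologicalSpace X] [NormedAddCommGroup W] {f : X → W}
    {x : X} (hf : ContinuousAt f x) : ContinuousAt (fun y ↦ ‖f y‖) x := hf.norm

/-- In fixed charts the tension is a smooth function of `(t, u)` that vanishes at `t = 0`. It is
locally Lipschitz, hence `O(t)`, and its square is `O(t²)` uniformly near `x₀`. -/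
theorem exists_norm_tensionField_sq_le {Φ : ℝ → M → N}
    (hΦ : ContMDiff (𝓘(ℝ, ℝ).prod (𝓡 m)) (𝓡 n) ∞ (fun p : ℝ × M ↦ Φ p.1 p.2))
    (h0 : IsHarmonicMap m n (Φ 0)) (x₀ : M) :
    ∃ C : ℝ, ∃ A ∈ nhds x₀, ∀ᶠ t in nhds (0 : ℝ), ∀ x ∈ A,
      ‖tensionField m n (Φ t) x‖ ^ 2 ≤ C * t ^ 2 := by
  set y₀ := Φ 0 x₀
  set O := variationDom m n Φ x₀ y₀ with hO
  have hOo : IsOpen O := isOpen_variationDom hΦ x₀ y₀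
  set Ψ := fun p : ℝ × EuclideanSpace ℝ (Fin m) ↦ locMap m n (Φ p.1) x₀ y₀ p.2 with hΨ
  have hΨd : ContDiffOn ℝ ∞ Ψ O := contDiffOn_variation hΦ x₀ y₀
  set T := fun p : ℝ × EuclideanSpace ℝ (Fin m) ↦ locTension x₀ y₀ (fun w ↦ Ψ (p.1, w)) p.2
    with hT
  have hO₂ : ∀ p ∈ O, Ψ p ∈ (extChartAt (𝓡 n) y₀).target := fun p hp ↦ mapsTo_locMap _ _ _ hp
  have hTd : ContDiffOn ℝ ∞ T O := contDiffOn_locTension_family hOo hΨd (fun p hp ↦ hp.1) hO₂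
  set u₀ := extChartAt (𝓡 m) x₀ x₀ with hu₀
  have hp₀ : ((0 : ℝ), u₀) ∈ O := mem_locDom_self (Φ 0) x₀
  have hnorm : ∀ p ∈ O, ‖tensionField m n (Φ p.1) ((extChartAt (𝓡 m) x₀).symm p.2)‖ ^ 2 =
      metricBil y₀ (Ψ p) (T p) (T p) := fun p hp ↦
    norm_tensionField_sq (contMDiff_slice hΦ p.1) x₀ y₀ hp
  have hT0 : ∀ u, ((0 : ℝ), u) ∈ O → T (0, u) = 0 := by
    intro u hu
    by_contra hne
    have h1 := metricBil_pos (hO₂ _ hu) hne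
    rw [← hnorm _ hu, norm_eq_zero.2 (h0 _)] at h1
    norm_num at h1
  obtain ⟨K, s, hs, hKs⟩ := ((hTd.contDiffAt (hOo.mem_nhds hp₀)).of_le
    (by exact_mod_cast le_top : (1 : WithTop ℕ∞) ≤ ∞)).exists_lipschitzOnWith
  have hg : ContinuousAt (fun p ↦ ‖metricBil y₀ (Ψ p)‖) (0, u₀) := by
    have h1 : ContinuousOn (fun p ↦ metricBil y₀ (Ψ p)) O :=
      (isLocalMetric y₀).contDiffOn.continuousOn.comp hΨd.continuousOn hO₂
    exact continuousAt_norm_comp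
      (W := EuclideanSpace ℝ (Fin n) →L[ℝ] EuclideanSpace ℝ (Fin n) →L[ℝ] ℝ) (h1.continuousAt (hOo.mem_nhds hp₀))
  set B := ‖metricBil y₀ (Ψ (0, u₀))‖ + 1 with hB
  have hgB : ∀ᶠ p in nhds ((0 : ℝ), u₀), ‖metricBil y₀ (Ψ p)‖ < B :=
    hg.eventually_lt_const (lt_add_one _)
  have hev : ∀ᶠ p in nhds ((0 : ℝ), u₀), p ∈ O ∧ p ∈ s ∧ ‖metricBil y₀ (Ψ p)‖ < B :=
    Filter.Eventually.and (hOo.mem_nhds hp₀) (Filter.Eventually.and hs hgB)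
  rw [nhds_prod_eq] at hev
  obtain ⟨I, hI, A', hA', hIA⟩ := Filter.eventually_prod_iff.1 hev
  refine ⟨B * K ^ 2, (extChartAt (𝓡 m) x₀).source ∩ extChartAt (𝓡 m) x₀ ⁻¹' {u | A' u},
    Filter.inter_mem (extChartAt_source_mem_nhds x₀)
      ((continuousAt_extChartAt x₀).preimage_mem_nhds hA'), ?_⟩
  filter_upwards [hI] with t ht x hx
  have hu := hIA ht hx.2
  have hu0 := hIA hI.self_of_nhds hx.2
  have h1 := hnorm _ hu.1
  dsimp only at h1
  rw [(extChartAt (𝓡 m) x₀).left_inv hx.1] at h1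
  rw [h1]
  have h2 := hKs.norm_sub_le hu.2.1 hu0.2.1
  rw [hT0 _ hu0.1, sub_zero] at h2
  have h3 : ‖T (t, extChartAt (𝓡 m) x₀ x)‖ ≤ K * |t| := by
    refine h2.trans_eq ?_
    simp [Prod.norm_def]
  obtain ⟨τ, hτ⟩ : ∃ τ, τ = T (t, extChartAt (𝓡 m) x₀ x) := ⟨_, rfl⟩
  obtain ⟨β, hβ⟩ : ∃ β, β = metricBil y₀ (Ψ (t, extChartAt (𝓡 m) x₀ x)) := ⟨_, rfl⟩
  have h4 := hu.2.2.le
  rw [← hτ] at h3 ⊢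
  rw [← hβ] at h4 ⊢
  calc β τ τ ≤ ‖β τ τ‖ := Real.le_norm_self _
    _ ≤ ‖β‖ * ‖τ‖ * ‖τ‖ := ContinuousLinearMap.le_opNorm₂ _ _ _
    _ ≤ B * (K * |t|) * (K * |t|) := by gcongr
    _ = B * K ^ 2 * t ^ 2 := by rw [← sq_abs t]; ring

variable [MeasurableSpace M] [BorelSpace M]

/-- Harmonic maps are biharmonic. -/
theorem IsHarmonicMap.isBiharmonicMap {φ : M → N} (hφ : IsHarmonicMap m n φ) :
    IsBiharmonicMap m n φ := by
  intro Ω hΩ Φ hΦ hΦ0 _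
  rw [← hΦ0] at hφ
  -- The local bounds are patched over the compact set `Ω`.
  have key : ∃ C : ℝ, ∀ᶠ t in nhds (0 : ℝ), ∀ x ∈ Ω,
      ‖tensionField m n (Φ t) x‖ ^ 2 ≤ C * t ^ 2 := by
    refine hΩ.induction_on (p := fun s ↦ ∃ C : ℝ, ∀ᶠ t in nhds (0 : ℝ), ∀ x ∈ s,
      ‖tensionField m n (Φ t) x‖ ^ 2 ≤ C * t ^ 2) ⟨0, by simp⟩ ?_ ?_ ?_
    · rintro s s' hss ⟨C, hC⟩
      exact ⟨C, hC.mono fun t ht x hx ↦ ht x (hss hx)⟩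
    · rintro s s' ⟨C, hC⟩ ⟨C', hC'⟩
      refine ⟨max C C', ?_⟩
      filter_upwards [hC, hC'] with t ht ht' x hx
      rcases hx with hx | hx
      · exact (ht x hx).trans (by gcongr; exact le_max_left _ _)
      · exact (ht' x hx).trans (by gcongr; exact le_max_right _ _)
    · intro x _
      obtain ⟨C, A, hA, hC⟩ := exists_norm_tensionField_sq_le hΦ hφ x
      exact ⟨A, mem_nhdsWithin_of_mem_nhds hA, C, hC⟩
  obtain ⟨C, hC⟩ := key
  -- A quadratic bound already forces the derivative to be zero, so nothing is differentiated under
  -- the integral in this direction.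
  have hbig : (fun t : ℝ ↦ bienergy m n (Φ t) Ω) =O[nhds 0] fun t ↦ ‖t - 0‖ ^ 2 := by
    refine Asymptotics.IsBigO.of_bound
      (1 / 2 * (C * ((riemannianVolume m M).real Ω))) ?_
    filter_upwards [hC] with t ht
    have h1 := norm_setIntegral_le_of_norm_le_const (μ := riemannianVolume m M)
      (riemannianVolume_lt_top_of_isCompact hΩ)
      (f := fun x ↦ ‖tensionField m n (Φ t) x‖ ^ 2) (C := C * t ^ 2) (fun x hx ↦ by
        rw [Real.norm_of_nonneg (by positivity)]; exact ht x hx)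
    rw [bienergy, norm_mul]
    simp only [sub_zero, Real.norm_eq_abs, sq_abs] at h1 ⊢
    rw [abs_of_nonneg (by norm_num : (0 : ℝ) ≤ 1 / 2), abs_of_nonneg (sq_nonneg t)]
    calc _ ≤ 1 / 2 * (C * t ^ 2 * (riemannianVolume m M).real Ω) := by gcongr
      _ = _ := by ring
  exact (hbig.hasFDerivAt (by norm_num)).hasDerivAt

end Maps

/-! ### Variations supported in a chart, and the first variation of the bienergy. -/

theorem fderiv_slice_left {E F : Type*} [NormedAddCommGroup E] [NormedSpace ℝ E]
    [NormedAddCommGroup F] [NormedSpace ℝ F] {G : ℝ × E → F} {t : ℝ} {u : E}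
    (hG : DifferentiableAt ℝ G (t, u)) :
    HasDerivAt (fun s ↦ G (s, u)) (fderiv ℝ G (t, u) (1, 0)) t := by
  have h : HasFDerivAt (fun s ↦ G (s, u)) _ t :=
    hG.hasFDerivAt.comp t (hasFDerivAt_prodMk_left t u)
  simpa using h.hasDerivAt

/-- Differentiation under an integral over a compact set. -/
theorem hasDerivAt_setIntegral_of_contDiffOn {E : Type*} [NormedAddCommGroup E] [NormedSpace ℝ E]
    [MeasurableSpace E] [BorelSpace E] {μ : Measure E} [IsFiniteMeasureOnCompacts μ]
    {O : Set (ℝ × E)} (hO : IsOpen O) {F : ℝ × E → ℝ} (hF : ContDiffOn ℝ ∞ F O) {K : Set E}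
    (hK : IsCompact K) (hKO : ∀ u ∈ K, ((0 : ℝ), u) ∈ O) :
    HasDerivAt (fun s ↦ ∫ u in K, F (s, u) ∂μ) (∫ u in K, deriv (fun s ↦ F (s, u)) 0 ∂μ) 0 := by
  -- Compactness of `K` gives one interval of parameters valid for all points of `K`, and thereby a
  -- constant dominating the derivative.
  obtain ⟨I, W, hIo, hWo, h0I, hKW, hIW⟩ := generalized_tube_lemma
    (isCompact_singleton (x := (0 : ℝ))) hK (n := O) hO (by
      rintro ⟨s, u⟩ ⟨hs, hu⟩
      obtain rfl : s = 0 := hs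
      exact hKO u hu)
  obtain ⟨δ, hδ, hδI⟩ := Metric.nhds_basis_closedBall.mem_iff.1
    (hIo.mem_nhds (h0I (Set.mem_singleton _)))
  have hsub : ∀ s ∈ Metric.closedBall (0 : ℝ) δ, ∀ u ∈ K, (s, u) ∈ O := fun s hs u hu ↦
    hIW ⟨hδI hs, hKW hu⟩
  have hcF : ∀ s ∈ Metric.closedBall (0 : ℝ) δ, ContinuousOn (fun u ↦ F (s, u)) K := fun s hs ↦
    hF.continuousOn.comp (by fun_prop) fun u hu ↦ hsub s hs u hu
  have hcF' : ContinuousOn (fun p ↦ fderiv ℝ F p (1, 0)) O :=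
    ((contDiffOn_fderiv hO hF).clm_apply contDiffOn_const).continuousOn
  obtain ⟨C, hC⟩ := ((isCompact_closedBall (0 : ℝ) δ).prod hK).exists_bound_of_continuousOn
    (hcF'.mono fun p hp ↦ hsub p.1 hp.1 p.2 hp.2)
  have hd : ∀ s ∈ Metric.closedBall (0 : ℝ) δ, ∀ u ∈ K,
      HasDerivAt (fun s ↦ F (s, u)) (fderiv ℝ F (s, u) (1, 0)) s := fun s hs u hu ↦
    fderiv_slice_left (ContDiffOn.differentiableAt_of_isOpen hO hF (hsub s hs u hu))
  have h0 : (0 : ℝ) ∈ Metric.closedBall (0 : ℝ) δ := Metric.mem_closedBall_self hδ.le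
  have h := (hasDerivAt_integral_of_dominated_loc_of_deriv_le (μ := μ.restrict K)
    (F := fun s u ↦ F (s, u)) (F' := fun s u ↦ fderiv ℝ F (s, u) (1, 0)) (x₀ := 0)
    (s := Metric.closedBall 0 δ) (bound := fun _ ↦ C) (Metric.closedBall_mem_nhds _ hδ)
    (Filter.eventually_of_mem (Metric.closedBall_mem_nhds _ hδ) fun s hs ↦
      (hcF s hs).aestronglyMeasurable_of_isCompact hK hK.measurableSet)
    ((hcF 0 h0).integrableOn_compact hK)
    ((hcF'.comp (by fun_prop) fun u hu ↦ hsub 0 h0 u hu).aestronglyMeasurable_of_isCompact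
      hK hK.measurableSet)
    ((ae_restrict_iff' hK.measurableSet).2 (Filter.Eventually.of_forall fun u hu s hs ↦
      hC (s, u) ⟨hs, hu⟩))
    (integrableOn_const hK.measure_lt_top.ne)
    ((ae_restrict_iff' hK.measurableSet).2 (Filter.Eventually.of_forall fun u hu s hs ↦
      hd s hs u hu))).2
  rwa [setIntegral_congr_fun hK.measurableSet fun u hu ↦ (hd 0 h0 u hu).deriv]

section Maps

variable {m n : ℕ}
  {M : Type*} [TopologicalSpace M] [ChartedSpace (EuclideanSpace ℝ (Fin m)) M]
  [IsManifold (𝓡 m) ∞ M]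
  {N : Type*} [TopologicalSpace N] [ChartedSpace (EuclideanSpace ℝ (Fin n)) N]
  [IsManifold (𝓡 n) ∞ N]

theorem contMDiffOn_chart_family (x₀ : M) (y₀ : N) {D : Set (EuclideanSpace ℝ (Fin m))}
    {G : ℝ × EuclideanSpace ℝ (Fin m) → EuclideanSpace ℝ (Fin n)}
    (hG : ContDiffOn ℝ ∞ G {p | p.2 ∈ D})
    (hGt : ∀ t : ℝ, ∀ u ∈ D, G (t, u) ∈ (extChartAt (𝓡 n) y₀).target) :
    ContMDiffOn (𝓘(ℝ, ℝ).prod (𝓡 m)) (𝓡 n) ∞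
      (fun p : ℝ × M ↦ (extChartAt (𝓡 n) y₀).symm (G (p.1, extChartAt (𝓡 m) x₀ p.2)))
      {p | p.2 ∈ (extChartAt (𝓡 m) x₀).source ∩ extChartAt (𝓡 m) x₀ ⁻¹' D} := by
  have hloc : ContMDiffOn 𝓘(ℝ, ℝ × EuclideanSpace ℝ (Fin m)) 𝓘(ℝ, EuclideanSpace ℝ (Fin n)) ∞
      G {p | p.2 ∈ D} := contMDiffOn_iff_contDiffOn.2 hG
  have hchart : ContMDiffOn (𝓘(ℝ, ℝ).prod (𝓡 m)) 𝓘(ℝ, ℝ × EuclideanSpace ℝ (Fin m)) ∞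
      (fun p : ℝ × M ↦ (p.1, extChartAt (𝓡 m) x₀ p.2))
      {p | p.2 ∈ (extChartAt (𝓡 m) x₀).source ∩ extChartAt (𝓡 m) x₀ ⁻¹' D} := by
    have h2 : ContMDiffOn (𝓘(ℝ, ℝ).prod (𝓡 m)) 𝓘(ℝ, EuclideanSpace ℝ (Fin m)) ∞
        (fun p : ℝ × M ↦ extChartAt (𝓡 m) x₀ p.2)
        {p | p.2 ∈ (extChartAt (𝓡 m) x₀).source ∩ extChartAt (𝓡 m) x₀ ⁻¹' D} :=
      (contMDiffOn_extChartAt (x := x₀)).comp contMDiff_snd.contMDiffOn fun p hp ↦ by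
        have := hp.1
        rwa [extChartAt_source] at this
    exact contMDiff_fst.contMDiffOn.prodMk_space h2
  have h3 := hloc.comp hchart fun p hp ↦ hp.2
  exact (contMDiffOn_extChartAt_symm y₀).comp h3 fun p hp ↦ hGt p.1 _ hp.2

/-- A compactly supported vector field along `φ` in a chart integrates to a smooth variation
of `φ`. -/
theorem exists_variation [T2Space M] {φ : M → N} (hφ : ContMDiff (𝓡 m) (𝓡 n) ∞ φ) (x₀ : M) (y₀ : N)
    {V : EuclideanSpace ℝ (Fin m) → EuclideanSpace ℝ (Fin n)} (hV : ContDiff ℝ ∞ V)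
    (hVc : HasCompactSupport V) (hVs : tsupport V ⊆ locDom m n φ x₀ y₀) :
    ∃ ε > 0, ∃ Φ : ℝ → M → N,
      ContMDiff (𝓘(ℝ, ℝ).prod (𝓡 m)) (𝓡 n) ∞ (fun p : ℝ × M ↦ Φ p.1 p.2) ∧ Φ 0 = φ ∧
      (∀ t : ℝ, ∀ x ∉ (extChartAt (𝓡 m) x₀).symm '' tsupport V, Φ t x = φ x) ∧
      ∀ t : ℝ, ∀ u ∈ locDom m n φ x₀ y₀, u ∈ locDom m n (Φ t) x₀ y₀ ∧
        locMap m n (Φ t) x₀ y₀ u = locMap m n φ x₀ y₀ u + (ε * Real.sin t) • V u := by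
  set D := locDom m n φ x₀ y₀ with hD
  set ψ := locMap m n φ x₀ y₀ with hψ
  set K := tsupport V with hK
  have hKc : IsCompact K := hVc
  have hDo : IsOpen D := isOpen_locDom hφ.continuous x₀ y₀
  have hψD : ContDiffOn ℝ ∞ ψ D := contDiffOn_locMap hφ x₀ y₀
  have hDt : D ⊆ (extChartAt (𝓡 m) x₀).target := locDom_subset φ x₀ y₀
  have hψt : ∀ u ∈ D, ψ u ∈ (extChartAt (𝓡 n) y₀).target := mapsTo_locMap φ x₀ y₀
  obtain ⟨δ, hδ, hδt⟩ := (hKc.image_of_continuousOn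
    (hψD.continuousOn.mono hVs)).exists_thickening_subset_open
      (isOpen_extChartAt_target (I := 𝓡 n) y₀) (by rintro _ ⟨u, hu, rfl⟩; exact hψt u (hVs hu))
  obtain ⟨B, hB⟩ := hKc.exists_bound_of_continuousOn hV.continuous.continuousOn
  set B' := max B 0 + 1 with hB'
  have hB'0 : 0 < B' := by positivity
  -- With `|sin t| ≤ 1` and `|V| < B'` on the support, the displacement `ε sin t V` stays shorter
  -- than `δ`. A variation has to be defined for every real `t`, which `ψ + t V` would not allow
  -- inside a chart; `sin` is bounded and has derivative `1` at `0`.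
  set ε := δ / B' with hε
  have hε0 : 0 < ε := by positivity
  have hst : ∀ t : ℝ, ∀ u ∈ D, ψ u + (ε * Real.sin t) • V u ∈ (extChartAt (𝓡 n) y₀).target := by
    intro t u hu
    by_cases huK : u ∈ K
    · refine hδt (Metric.mem_thickening_iff.2 ⟨ψ u, ⟨u, huK, rfl⟩, ?_⟩)
      rw [dist_eq_norm, add_sub_cancel_left, norm_smul, norm_mul, Real.norm_of_nonneg hε0.le]
      have h1 : ‖V u‖ < B' := by
        have := hB u huK
        have := le_max_left B 0
        linarith
      have h2 : ‖Real.sin t‖ ≤ 1 := Real.abs_sin_le_one t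
      calc ε * ‖Real.sin t‖ * ‖V u‖ ≤ ε * 1 * ‖V u‖ := by gcongr
        _ < ε * 1 * B' := by gcongr
        _ = δ := by rw [hε]; field_simp
    · rw [image_eq_zero_of_notMem_tsupport huK, smul_zero, add_zero]
      exact hψt u hu
  set Ω := (extChartAt (𝓡 m) x₀).symm '' K with hΩ
  have hΩc : IsCompact Ω :=
    hKc.image_of_continuousOn ((continuousOn_extChartAt_symm x₀).mono (hVs.trans hDt))
  set P : ℝ → M → N := fun t x ↦ (extChartAt (𝓡 n) y₀).symm
    (ψ (extChartAt (𝓡 m) x₀ x) + (ε * Real.sin t) • V (extChartAt (𝓡 m) x₀ x)) with hP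
  set A := (extChartAt (𝓡 m) x₀).source ∩ extChartAt (𝓡 m) x₀ ⁻¹' D with hA
  have hAo : IsOpen A := (continuousOn_extChartAt x₀).isOpen_inter_preimage
    (isOpen_extChartAt_source x₀) hDo
  classical
  -- Smoothness follows from two open sets that cover `M`: the complement of `Ω`, closed because `Ω`
  -- is compact in a Hausdorff space, where `Φ t = φ`; and `A`, which contains `Ω`, where `Φ t = P
  -- t` since `V` vanishes off its support.
  set Φ : ℝ → M → N := fun t x ↦ if x ∈ Ω then P t x else φ x with hΦ
  have hψx : ∀ x ∈ A, (extChartAt (𝓡 n) y₀).symm (ψ (extChartAt (𝓡 m) x₀ x)) = φ x := by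
    intro x hx
    have h1 := hx.2.2
    rw [Set.mem_preimage, (extChartAt (𝓡 m) x₀).left_inv hx.1] at h1
    rw [hψ, locMap, (extChartAt (𝓡 m) x₀).left_inv hx.1, (extChartAt (𝓡 n) y₀).left_inv h1]
  have hΦA : ∀ t, ∀ x ∈ A, Φ t x = P t x := by
    intro t x hx
    by_cases hxΩ : x ∈ Ω
    · simp only [hΦ, if_pos hxΩ]
    · have hxK : extChartAt (𝓡 m) x₀ x ∉ K := fun h ↦
        hxΩ ⟨_, h, (extChartAt (𝓡 m) x₀).left_inv hx.1⟩
      simp only [hΦ, if_neg hxΩ, hP, image_eq_zero_of_notMem_tsupport hxK, smul_zero, add_zero,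
        hψx x hx]
  have hΩA : Ω ⊆ A := by
    rintro _ ⟨u, hu, rfl⟩
    exact ⟨(extChartAt (𝓡 m) x₀).map_target (hDt (hVs hu)), by
      rw [Set.mem_preimage, (extChartAt (𝓡 m) x₀).right_inv (hDt (hVs hu))]; exact hVs hu⟩
  have hPs : ContMDiffOn (𝓘(ℝ, ℝ).prod (𝓡 m)) (𝓡 n) ∞ (fun p : ℝ × M ↦ P p.1 p.2)
      {p | p.2 ∈ A} := by
    refine contMDiffOn_chart_family x₀ y₀
      (G := fun p ↦ ψ p.2 + (ε * Real.sin p.1) • V p.2) ?_ fun t u hu ↦ hst t u hu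
    refine (hψD.comp contDiff_snd.contDiffOn fun p hp ↦ hp).add (ContDiff.contDiffOn ?_)
    exact (contDiff_const.mul (Real.contDiff_sin.comp contDiff_fst)).smul (hV.comp contDiff_snd)
  refine ⟨ε, hε0, Φ, ?_, ?_, ?_, ?_⟩
  · rintro ⟨t, x⟩
    by_cases hxΩ : x ∈ Ω
    · have hn : {p : ℝ × M | p.2 ∈ A} ∈ nhds (t, x) :=
        (hAo.preimage continuous_snd).mem_nhds (hΩA hxΩ)
      exact (hPs.contMDiffAt hn).congr_of_eventuallyEq
        (Filter.eventuallyEq_of_mem hn fun p hp ↦ hΦA p.1 p.2 hp)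
    · have hn : {p : ℝ × M | p.2 ∈ Ωᶜ} ∈ nhds (t, x) :=
        (hΩc.isClosed.isOpen_compl.preimage continuous_snd).mem_nhds hxΩ
      exact ((hφ.comp contMDiff_snd).contMDiffAt).congr_of_eventuallyEq
        (Filter.eventuallyEq_of_mem hn fun p hp ↦ by simp only [hΦ, if_neg hp, Function.comp_apply])
  · funext x
    by_cases hxΩ : x ∈ Ω
    · rw [hΦA 0 x (hΩA hxΩ)]
      simp only [hP, Real.sin_zero, mul_zero, zero_smul, add_zero, hψx x (hΩA hxΩ)]
    · simp only [hΦ, if_neg hxΩ]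
  · intro t x hx
    simp only [hΦ, if_neg hx]
  · intro t u hu
    have hx : (extChartAt (𝓡 m) x₀).symm u ∈ A :=
      ⟨(extChartAt (𝓡 m) x₀).map_target (hDt hu), by
        rw [Set.mem_preimage, (extChartAt (𝓡 m) x₀).right_inv (hDt hu)]; exact hu⟩
    have e : Φ t ((extChartAt (𝓡 m) x₀).symm u) = (extChartAt (𝓡 n) y₀).symm
        (ψ u + (ε * Real.sin t) • V u) := by
      rw [hΦA t _ hx, hP]
      simp only [(extChartAt (𝓡 m) x₀).right_inv (hDt hu)]
    refine ⟨⟨hDt hu, ?_⟩, ?_⟩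
    · rw [Set.mem_preimage, e]
      exact (extChartAt (𝓡 n) y₀).map_target (hst t u hu)
    · rw [locMap, e, (extChartAt (𝓡 n) y₀).right_inv (hst t u hu)]

variable [RiemannianBundle (fun x : M ↦ TangentSpace (𝓡 m) x)]
  [RiemannianBundle (fun y : N ↦ TangentSpace (𝓡 n) y)]
  [IsContMDiffRiemannianBundle (𝓡 m) ∞ (EuclideanSpace ℝ (Fin m))
    (fun x : M ↦ TangentSpace (𝓡 m) x)]
  [IsContMDiffRiemannianBundle (𝓡 n) ∞ (EuclideanSpace ℝ (Fin n))
    (fun y : N ↦ TangentSpace (𝓡 n) y)]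

/-- The squared norm of the tension field of `f` in the charts around `x₀` and `y₀`. -/
def locBienergyDensity (x₀ : M) (y₀ : N)
    (f : EuclideanSpace ℝ (Fin m) → EuclideanSpace ℝ (Fin n)) (u : EuclideanSpace ℝ (Fin m)) : ℝ :=
  metricBil y₀ (f u) (locTension x₀ y₀ f u) (locTension x₀ y₀ f u)

theorem locTension_congr {x₀ : M} {y₀ : N}
    {f f' : EuclideanSpace ℝ (Fin m) → EuclideanSpace ℝ (Fin n)}
    {U : Set (EuclideanSpace ℝ (Fin m))} (hU : IsOpen U) (h : ∀ u ∈ U, f u = f' u)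
    {u : EuclideanSpace ℝ (Fin m)} (hu : u ∈ U) :
    locTension x₀ y₀ f u = locTension x₀ y₀ f' u := by
  simp only [locTension, metricTrace, sff_congr hU h hu]

variable [MeasurableSpace M] [BorelSpace M]

/-- Biharmonicity is applied to the variation with displacement `ε sin t V`. The chain rule produces
the derivative along the linear family `ψ + s V` times `ε ≠ 0`, so the linear family, defined only
in the chart, can be used from here on. -/
theorem IsBiharmonicMap.integral_deriv_eq_zero [T2Space M] {φ : M → N}
    (hbi : IsBiharmonicMap m n φ) (hφ : ContMDiff (𝓡 m) (𝓡 n) ∞ φ) (x₀ : M) (y₀ : N)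
    {V : EuclideanSpace ℝ (Fin m) → EuclideanSpace ℝ (Fin n)} (hV : ContDiff ℝ ∞ V)
    (hVc : HasCompactSupport V) (hVs : tsupport V ⊆ locDom m n φ x₀ y₀) :
    ∫ u in tsupport V, deriv (fun s : ℝ ↦ volDensity x₀ u *
      locBienergyDensity x₀ y₀ (fun w ↦ locMap m n φ x₀ y₀ w + s • V w) u) 0 = 0 := by
  obtain ⟨ε, hε, Φ, hΦ, hΦ0, hΦc, hΦloc⟩ := exists_variation hφ x₀ y₀ hV hVc hVs
  set D := locDom m n φ x₀ y₀ with hD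
  set ψ := locMap m n φ x₀ y₀ with hψ
  set K := tsupport V with hK
  have hKc : IsCompact K := hVc
  have hDo : IsOpen D := isOpen_locDom hφ.continuous x₀ y₀
  have hψD : ContDiffOn ℝ ∞ ψ D := contDiffOn_locMap hφ x₀ y₀
  have hDt : D ⊆ (extChartAt (𝓡 m) x₀).target := locDom_subset φ x₀ y₀
  set Ω := (extChartAt (𝓡 m) x₀).symm '' K with hΩ
  have hΩc : IsCompact Ω :=
    hKc.image_of_continuousOn ((continuousOn_extChartAt_symm x₀).mono (hVs.trans hDt))
  -- the family of maps in coordinates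
  set Ψ : ℝ × EuclideanSpace ℝ (Fin m) → EuclideanSpace ℝ (Fin n) :=
    fun p ↦ ψ p.2 + p.1 • V p.2 with hΨ
  have hΨd : ContDiffOn ℝ ∞ Ψ {p | p.2 ∈ D} :=
    (hψD.comp contDiff_snd.contDiffOn fun p hp ↦ hp).add
      (contDiff_fst.smul (hV.comp contDiff_snd)).contDiffOn
  set O : Set (ℝ × EuclideanSpace ℝ (Fin m)) :=
    {p | p.2 ∈ D} ∩ Ψ ⁻¹' (extChartAt (𝓡 n) y₀).target with hO
  have hOo : IsOpen O := hΨd.continuousOn.isOpen_inter_preimage (hDo.preimage continuous_snd)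
    (isOpen_extChartAt_target y₀)
  have hΨO : ContDiffOn ℝ ∞ Ψ O := hΨd.mono Set.inter_subset_left
  have hTd := contDiffOn_locTension_family (x₀ := x₀) (y₀ := y₀) hOo hΨO
    (fun p hp ↦ hDt hp.1) (fun p hp ↦ hp.2)
  set F : ℝ × EuclideanSpace ℝ (Fin m) → ℝ := fun p ↦ volDensity x₀ p.2 *
    locBienergyDensity x₀ y₀ (fun w ↦ Ψ (p.1, w)) p.2 with hF
  have hFd : ContDiffOn ℝ ∞ F O := by
    refine ((contDiffOn_volDensity x₀).comp contDiff_snd.contDiffOn fun p hp ↦ hDt hp.1).mul ?_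
    exact (((isLocalMetric y₀).contDiffOn.comp hΨO fun p hp ↦ hp.2).clm_apply hTd).clm_apply hTd
  have h0O : ∀ u ∈ D, ((0 : ℝ), u) ∈ O := fun u hu ↦
    ⟨hu, by simpa [hΨ] using mapsTo_locMap φ x₀ y₀ hu⟩
  have hder := hasDerivAt_setIntegral_of_contDiffOn (μ := volume) hOo hFd hKc
    fun u hu ↦ h0O u (hVs hu)
  have hsin : HasDerivAt (fun t : ℝ ↦ ε * Real.sin t) ε 0 := by
    simpa using (Real.hasDerivAt_sin 0).const_mul ε
  have hOt : ∀ t : ℝ, ∀ u ∈ D, (ε * Real.sin t, u) ∈ O := fun t u hu ↦ by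
    refine ⟨hu, ?_⟩
    have h1 := mapsTo_locMap _ _ _ (hΦloc t u hu).1
    rw [(hΦloc t u hu).2] at h1
    exact h1
  have hnorm : ∀ t : ℝ, ∀ u ∈ D,
      volDensity x₀ u * ‖tensionField m n (Φ t) ((extChartAt (𝓡 m) x₀).symm u)‖ ^ 2 =
        F (ε * Real.sin t, u) := by
    intro t u hu
    rw [norm_tensionField_sq (contMDiff_slice hΦ t) x₀ y₀ (hΦloc t u hu).1,
      locTension_congr hDo (fun w hw ↦ (hΦloc t w hw).2) hu, (hΦloc t u hu).2]
    rfl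
  have hbe : ∀ t : ℝ, bienergy m n (Φ t) Ω = 1 / 2 * ∫ u in K, F (ε * Real.sin t, u) := by
    intro t
    rw [bienergy, setIntegral_riemannianVolume x₀ hKc (hVs.trans hDt)]
    · congr 1
      exact setIntegral_congr_fun hKc.measurableSet fun u hu ↦ hnorm t u (hVs hu)
    -- The tension field is defined pointwise in moving charts, so the continuity of its squared
    -- norm on `Ω` is read off from the formula in fixed charts.
    · have hc : ContinuousOn (fun x ↦ F (ε * Real.sin t, extChartAt (𝓡 m) x₀ x) /
          volDensity x₀ (extChartAt (𝓡 m) x₀ x)) Ω := by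
        have hΩs : ∀ x ∈ Ω, x ∈ (extChartAt (𝓡 m) x₀).source ∧ extChartAt (𝓡 m) x₀ x ∈ K := by
          rintro _ ⟨u, hu, rfl⟩
          exact ⟨(extChartAt (𝓡 m) x₀).map_target (hDt (hVs hu)), by
            rwa [(extChartAt (𝓡 m) x₀).right_inv (hDt (hVs hu))]⟩
        have hce : ContinuousOn (extChartAt (𝓡 m) x₀) Ω :=
          (continuousOn_extChartAt x₀).mono fun x hx ↦ (hΩs x hx).1
        refine ContinuousOn.div ?_ ?_ fun x hx ↦
          (volDensity_pos (hDt (hVs (hΩs x hx).2))).ne'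
        · exact hFd.continuousOn.comp (continuousOn_const.prodMk hce) fun x hx ↦
            hOt t _ (hVs (hΩs x hx).2)
        · exact (contDiffOn_volDensity x₀).continuousOn.comp hce fun x hx ↦
            hDt (hVs (hΩs x hx).2)
      refine hc.congr ?_
      rintro _ ⟨u, hu, rfl⟩
      simp only [(extChartAt (𝓡 m) x₀).right_inv (hDt (hVs hu))]
      rw [← hnorm t u (hVs hu), mul_div_cancel_left₀ _ (volDensity_pos (hDt (hVs hu))).ne']
  have hd1 : HasDerivAt (fun t ↦ bienergy m n (Φ t) Ω)
      (1 / 2 * ((∫ u in K, deriv (fun s ↦ F (s, u)) 0) * ε)) 0 := by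
    have h2 : HasDerivAt (fun s ↦ ∫ u in K, F (s, u)) (∫ u in K, deriv (fun s ↦ F (s, u)) 0)
        (ε * Real.sin 0) := by simpa using hder
    have h3 := (h2.comp (0 : ℝ) hsin).const_mul (1 / 2 : ℝ)
    rw [show (fun t ↦ bienergy m n (Φ t) Ω) = fun t ↦ 1 / 2 * ∫ u in K, F (ε * Real.sin t, u)
      from funext hbe]
    exact h3
  have h0 := hd1.unique (hbi Ω hΩc Φ hΦ hΦ0 hΦc)
  have h4 : (∫ u in K, deriv (fun s ↦ F (s, u)) 0) * ε = 0 := by linarith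
  exact (mul_eq_zero.1 h4).resolve_right hε.ne'

end Maps

/-! ### Orthonormal frames and their connection coefficients. -/

section Frame

variable {E F : Type*} [NormedAddCommGroup E] [NormedSpace ℝ E]
  [NormedAddCommGroup F] [NormedSpace ℝ F] {ι : Type*} [Fintype ι] [DecidableEq ι]

/-- `e` is a smooth frame on `U`, orthonormal with respect to `g`. -/
structure IsOrthonormalFrame (U : Set E) (g : E → E →L[ℝ] E →L[ℝ] ℝ) (e : ι → E → E) : Prop where
  contDiffOn : ∀ i, ContDiffOn ℝ ∞ (e i) U
  inner : ∀ u ∈ U, ∀ i j, g u (e i u) (e j u) = if i = j then 1 else 0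
  sum_eq : ∀ u ∈ U, ∀ a, ∑ i, g u a (e i u) • e i u = a

/-- The connection coefficients `⟨∇_{e i} e j, e k⟩`. -/
def connCoeff (g : E → E →L[ℝ] E →L[ℝ] ℝ) (Γ : E → E →L[ℝ] E →L[ℝ] E) (e : ι → E → E)
    (i j k : ι) (u : E) : ℝ :=
  g u (cov Γ (e i) (e j) u) (e k u)

theorem contDiffOn_cov {U : Set E} (hU : IsOpen U) {Γ : E → E →L[ℝ] E →L[ℝ] E}
    (hΓ : ContDiffOn ℝ ∞ Γ U) {X Y : E → E} (hX : ContDiffOn ℝ ∞ X U) (hY : ContDiffOn ℝ ∞ Y U) :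
    ContDiffOn ℝ ∞ (cov Γ X Y) U :=
  ((contDiffOn_fderiv hU hY).clm_apply hX).add ((hΓ.clm_apply hX).clm_apply hY)

theorem cov_congr {U : Set E} (hU : IsOpen U) (Γ : E → E →L[ℝ] E →L[ℝ] E) (X : E → E)
    {Y Y' : E → E} (h : ∀ u ∈ U, Y u = Y' u) {u : E} (hu : u ∈ U) :
    cov Γ X Y u = cov Γ X Y' u := by
  simp only [cov, fderiv_congr_of_isOpen hU h hu, h u hu]

theorem cov_sum_smul {Γ : E → E →L[ℝ] E →L[ℝ] E} {X : E → E} {f : ι → E → ℝ} {Y : ι → E → E}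
    {u : E} (hf : ∀ i, DifferentiableAt ℝ (f i) u) (hY : ∀ i, DifferentiableAt ℝ (Y i) u) :
    cov Γ X (fun w ↦ ∑ i, f i w • Y i w) u =
      ∑ i, (fderiv ℝ (f i) u (X u) • Y i u + f i u • cov Γ X (Y i) u) := by
  have h : HasFDerivAt (fun w ↦ ∑ i, f i w • Y i w) _ u :=
    HasFDerivAt.fun_sum fun i _ ↦ (hf i).hasFDerivAt.smul (hY i).hasFDerivAt
  rw [cov, h.fderiv, sum_apply, map_sum, ← Finset.sum_add_distrib]
  refine Finset.sum_congr rfl fun i _ ↦ ?_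
  simp only [cov, add_apply, smul_apply, ContinuousLinearMap.smulRight_apply, map_smul, smul_add]
  abel

theorem cov_eq_sum_left (Γ : E → E →L[ℝ] E →L[ℝ] E) {X : E → E} (Y : E → E) {e : ι → E → E}
    {a : ι → ℝ} {u : E} (h : X u = ∑ i, a i • e i u) :
    cov Γ X Y u = ∑ i, a i • cov Γ (e i) Y u := by
  simp only [cov, h, map_sum, sum_apply, smul_add, Finset.sum_add_distrib]
  simp only [(fderiv ℝ Y u).map_smul, (Γ u).map_smul, smul_apply]

namespace IsOrthonormalFrame

variable {U : Set E} {g : E → E →L[ℝ] E →L[ℝ] ℝ} {Γ : E → E →L[ℝ] E →L[ℝ] E} {e : ι → E → E}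
  (he : IsOrthonormalFrame U g e) (h : IsLocalMetric U g Γ) {u : E} (hu : u ∈ U)

include he

theorem mono {V : Set E} (hV : V ⊆ U) : IsOrthonormalFrame V g e where
  contDiffOn i := (he.contDiffOn i).mono hV
  inner u hu := he.inner u (hV hu)
  sum_eq u hu := he.sum_eq u (hV hu)

include h

theorem contDiffOn_connCoeff (i j k : ι) : ContDiffOn ℝ ∞ (connCoeff g Γ e i j k) U :=
  (h.contDiffOn.clm_apply (contDiffOn_cov h.isOpen h.contDiffOn_chr (he.contDiffOn i)
    (he.contDiffOn j))).clm_apply (he.contDiffOn k)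

include hu

theorem differentiableAt (i : ι) : DifferentiableAt ℝ (e i) u :=
  ContDiffOn.differentiableAt_of_isOpen h.isOpen (he.contDiffOn i) hu

theorem cov_eq_sum (i j : ι) : cov Γ (e i) (e j) u = ∑ k, connCoeff g Γ e i j k u • e k u :=
  (he.sum_eq u hu _).symm

theorem connCoeff_antisymm (i j k : ι) : connCoeff g Γ e i j k u = - connCoeff g Γ e i k j u := by
  have h1 := h.fderiv_metric (Γ := Γ) hu (he.differentiableAt h hu j) (he.differentiableAt h hu k)
    (e i)
  rw [fderiv_congr_of_isOpen h.isOpen (fun w hw ↦ he.inner w hw j k) hu,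
    h.symm u hu (e j u)] at h1
  simp only [fderiv_fun_const, Pi.zero_apply, zero_apply] at h1
  simp only [connCoeff]
  linarith

theorem connCoeff_self (i j : ι) : connCoeff g Γ e i j j u = 0 := by
  have := he.connCoeff_antisymm h hu i j j
  linarith

theorem lie_eq (i j : ι) : fderiv ℝ (e j) u (e i u) - fderiv ℝ (e i) u (e j u) =
    ∑ k, (connCoeff g Γ e i j k u - connCoeff g Γ e j i k u) • e k u := by
  simp only [sub_smul, Finset.sum_sub_distrib, ← he.cov_eq_sum h hu, cov,
    h.chr_symm hu (e i u) (e j u)]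
  abel

/-- The connection has no torsion, so these differences involve only brackets of the frame; this is
how information about the submersion enters the coefficients. -/
theorem connCoeff_sub (i j k : ι) : connCoeff g Γ e i j k u - connCoeff g Γ e j i k u =
    g u (fderiv ℝ (e j) u (e i u) - fderiv ℝ (e i) u (e j u)) (e k u) := by
  rw [he.lie_eq h hu, map_sum, sum_apply]
  simp only [(g u).map_smul, smul_apply, he.inner u hu, smul_eq_mul, mul_ite, mul_one, mul_zero,
    Finset.sum_ite_eq', Finset.mem_univ, if_true]

/-- Cartan's second structure equation: `∇_{e j} e k` is expanded in the frame before the second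
covariant derivative is taken. -/
theorem curv_eq (i j k l : ι) : g u (curv Γ u (e i u) (e j u) (e k u)) (e l u) =
    fderiv ℝ (connCoeff g Γ e j k l) u (e i u) - fderiv ℝ (connCoeff g Γ e i k l) u (e j u)
    + ∑ p, (connCoeff g Γ e j k p u * connCoeff g Γ e i p l u
      - connCoeff g Γ e i k p u * connCoeff g Γ e j p l u)
    - ∑ p, (connCoeff g Γ e i j p u - connCoeff g Γ e j i p u) * connCoeff g Γ e p k l u := by
  have hC : ∀ i j k, DifferentiableAt ℝ (connCoeff g Γ e i j k) u := fun i j k ↦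
    ContDiffOn.differentiableAt_of_isOpen h.isOpen (he.contDiffOn_connCoeff h i j k) hu
  have h1 : ∀ i j k, g u (cov Γ (e i) (cov Γ (e j) (e k)) u) (e l u) =
      fderiv ℝ (connCoeff g Γ e j k l) u (e i u)
        + ∑ p, connCoeff g Γ e j k p u * connCoeff g Γ e i p l u := by
    intro i j k
    rw [cov_congr h.isOpen Γ (e i) (fun w hw ↦ he.cov_eq_sum h hw j k) hu,
      cov_sum_smul (fun p ↦ hC j k p) (fun p ↦ he.differentiableAt h hu p), map_sum, sum_apply]
    simp only [map_add, add_apply, (g u).map_smul, smul_apply, he.inner u hu, smul_eq_mul,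
      mul_ite, mul_one, mul_zero, Finset.sum_add_distrib, Finset.sum_ite_eq', Finset.mem_univ,
      if_true]
    rfl
  have h2 : g u (cov Γ (fun w ↦ cov Γ (e i) (e j) w - cov Γ (e j) (e i) w) (e k) u) (e l u) =
      ∑ p, (connCoeff g Γ e i j p u - connCoeff g Γ e j i p u) * connCoeff g Γ e p k l u := by
    rw [cov_eq_sum_left Γ (e k) (e := e)
      (a := fun p ↦ connCoeff g Γ e i j p u - connCoeff g Γ e j i p u), map_sum, sum_apply]
    · simp only [(g u).map_smul, smul_apply, smul_eq_mul]
      rfl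
    · simp only [sub_smul, Finset.sum_sub_distrib, ← he.cov_eq_sum h hu]
  rw [h.curv_eq_cov hu (he.contDiffOn i) (he.contDiffOn j) (he.contDiffOn k)]
  simp only [map_sub, sub_apply, h1, h2, Finset.sum_sub_distrib]
  ring

end IsOrthonormalFrame

end Frame

/-! ### Frames adapted to a Riemannian submersion. -/

section Adapted

variable {E F : Type*} [NormedAddCommGroup E] [NormedSpace ℝ E]
  [NormedAddCommGroup F] [NormedSpace ℝ F]

theorem fderiv_fderiv_apply {U : Set E} (hU : IsOpen U) {f : E → F} (hf : ContDiffOn ℝ ∞ f U)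
    {Y : E → E} (hY : ContDiffOn ℝ ∞ Y U) {u : E} (hu : u ∈ U) (a : E) :
    fderiv ℝ (fun w ↦ fderiv ℝ f w (Y w)) u a =
      fderiv ℝ (fderiv ℝ f) u a (Y u) + fderiv ℝ f u (fderiv ℝ Y u a) :=
  fderiv_clm_apply₁ (ContDiffOn.differentiableAt_of_isOpen hU (contDiffOn_fderiv hU hf) hu)
    (ContDiffOn.differentiableAt_of_isOpen hU hY hu) a

theorem fderiv_lie {U : Set E} (hU : IsOpen U) {f : E → F} (hf : ContDiffOn ℝ ∞ f U)
    {X Y : E → E} (hX : ContDiffOn ℝ ∞ X U) (hY : ContDiffOn ℝ ∞ Y U) {u : E} (hu : u ∈ U) :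
    fderiv ℝ f u (fderiv ℝ Y u (X u) - fderiv ℝ X u (Y u)) =
      fderiv ℝ (fun w ↦ fderiv ℝ f w (Y w)) u (X u)
        - fderiv ℝ (fun w ↦ fderiv ℝ f w (X w)) u (Y u) := by
  rw [fderiv_fderiv_apply hU hf hY hu, fderiv_fderiv_apply hU hf hX hu,
    fderiv_fderiv_symm hU hf hu (X u), map_sub]
  abel

/-- An orthonormal frame `e` whose first two fields are the horizontal lifts, under the Riemannian
submersion `ψ`, of the orthonormal frame `ε`. -/
structure IsAdaptedFrame (U : Set E) (g : E → E →L[ℝ] E →L[ℝ] ℝ) (Γ : E → E →L[ℝ] E →L[ℝ] E)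
    (U' : Set F) (g' : F → F →L[ℝ] F →L[ℝ] ℝ) (Γ' : F → F →L[ℝ] F →L[ℝ] F) (ψ : E → F)
    (e : Fin 3 → E → E) (ε : Fin 2 → F → F) : Prop where
  metric : IsLocalMetric U g Γ
  metric' : IsLocalMetric U' g' Γ'
  smooth : ContDiffOn ℝ ∞ ψ U
  mapsTo : Set.MapsTo ψ U U'
  frame : IsOrthonormalFrame U g e
  frame' : IsOrthonormalFrame U' g' ε
  lift : ∀ u ∈ U, ∀ a, ∀ k : Fin 2,
    g u a (e k.castSucc u) = g' (ψ u) (fderiv ℝ ψ u a) (ε k (ψ u))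

/-- The table of the connection coefficients of an adapted frame. -/
def connTable {R : Type*} [Ring R] (θ : Fin 2 → R) (κ : Fin 2 → R) (σ : R) :
    Fin 3 → Fin 3 → Fin 3 → R :=
  ![![![0, θ 0, 0], ![-θ 0, 0, -σ], ![0, σ, 0]],
    ![![0, θ 1, σ], ![-θ 1, 0, 0], ![-σ, 0, 0]],
    ![![0, σ, -κ 0], ![-σ, 0, -κ 1], ![κ 0, κ 1, 0]]]

namespace IsAdaptedFrame

variable {U : Set E} {g : E → E →L[ℝ] E →L[ℝ] ℝ} {Γ : E → E →L[ℝ] E →L[ℝ] E}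
  {U' : Set F} {g' : F → F →L[ℝ] F →L[ℝ] ℝ} {Γ' : F → F →L[ℝ] F →L[ℝ] F} {ψ : E → F}
  {e : Fin 3 → E → E} {ε : Fin 2 → F → F} (H : IsAdaptedFrame U g Γ U' g' Γ' ψ e ε)

include H

theorem mono {V : Set E} (hVo : IsOpen V) (hV : V ⊆ U) :
    IsAdaptedFrame V g Γ U' g' Γ' ψ e ε where
  metric := H.metric.mono hVo hV
  metric' := H.metric'
  smooth := H.smooth.mono hV
  mapsTo _ hu := H.mapsTo (hV hu)
  frame := H.frame.mono hV
  frame' := H.frame'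
  lift u hu := H.lift u (hV hu)

variable {u : E} (hu : u ∈ U)
include hu

theorem fderiv_castSucc (k : Fin 2) : fderiv ℝ ψ u (e k.castSucc u) = ε k (ψ u) := by
  rw [← H.frame'.sum_eq _ (H.mapsTo hu) (fderiv ℝ ψ u (e k.castSucc u))]
  simp only [← H.lift u hu, H.frame.inner u hu, Fin.castSucc_inj, ite_smul, one_smul, zero_smul,
    Finset.sum_ite_eq, Finset.mem_univ, if_true]

theorem fderiv_last : fderiv ℝ ψ u (e 2 u) = 0 := by
  rw [← H.frame'.sum_eq _ (H.mapsTo hu) (fderiv ℝ ψ u (e 2 u))]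
  refine Finset.sum_eq_zero fun k _ ↦ ?_
  rw [← H.lift u hu, H.frame.inner u hu, if_neg, zero_smul]
  fin_cases k <;> simp

theorem fderiv_comp_castSucc {G : Type*} [NormedAddCommGroup G] [NormedSpace ℝ G] {f : F → G}
    (hf : ContDiffOn ℝ ∞ f U') (k : Fin 2) :
    fderiv ℝ (fun w ↦ f (ψ w)) u (e k.castSucc u) = fderiv ℝ f (ψ u) (ε k (ψ u)) := by
  rw [fderiv_comp_apply (ContDiffOn.differentiableAt_of_isOpen H.metric.isOpen H.smooth hu)
    (ContDiffOn.differentiableAt_of_isOpen H.metric'.isOpen hf (H.mapsTo hu)),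
    H.fderiv_castSucc hu]

theorem fderiv_comp_last {G : Type*} [NormedAddCommGroup G] [NormedSpace ℝ G] {f : F → G}
    (hf : ContDiffOn ℝ ∞ f U') : fderiv ℝ (fun w ↦ f (ψ w)) u (e 2 u) = 0 := by
  rw [fderiv_comp_apply (ContDiffOn.differentiableAt_of_isOpen H.metric.isOpen H.smooth hu)
    (ContDiffOn.differentiableAt_of_isOpen H.metric'.isOpen hf (H.mapsTo hu)),
    H.fderiv_last hu, map_zero]

/-- Each `e k.castSucc` is `ψ`-related to `ε k`, so brackets are related too, and the horizontal
part of the bracket upstairs is the bracket downstairs. -/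
theorem connCoeff_sub_castSucc (i j k : Fin 2) :
    connCoeff g Γ e i.castSucc j.castSucc k.castSucc u
      - connCoeff g Γ e j.castSucc i.castSucc k.castSucc u =
    connCoeff g' Γ' ε i j k (ψ u) - connCoeff g' Γ' ε j i k (ψ u) := by
  rw [H.frame.connCoeff_sub H.metric hu, H.lift u hu,
    fderiv_lie H.metric.isOpen H.smooth (H.frame.contDiffOn _) (H.frame.contDiffOn _) hu,
    fderiv_congr_of_isOpen H.metric.isOpen (fun w hw ↦ H.fderiv_castSucc hw j) hu,
    fderiv_congr_of_isOpen H.metric.isOpen (fun w hw ↦ H.fderiv_castSucc hw i) hu,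
    H.fderiv_comp_castSucc hu (H.frame'.contDiffOn j),
    H.fderiv_comp_castSucc hu (H.frame'.contDiffOn i),
    H.frame'.connCoeff_sub H.metric' (H.mapsTo hu)]

/-- The vertical field is related to zero, so its bracket with a horizontal lift is vertical. -/
theorem connCoeff_sub_last (i k : Fin 2) :
    connCoeff g Γ e i.castSucc 2 k.castSucc u - connCoeff g Γ e 2 i.castSucc k.castSucc u = 0 := by
  rw [H.frame.connCoeff_sub H.metric hu, H.lift u hu,
    fderiv_lie H.metric.isOpen H.smooth (H.frame.contDiffOn _) (H.frame.contDiffOn _) hu,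
    fderiv_congr_of_isOpen H.metric.isOpen (fun w hw ↦ H.fderiv_last hw) hu,
    fderiv_congr_of_isOpen H.metric.isOpen (fun w hw ↦ H.fderiv_castSucc hw i) hu,
    H.fderiv_comp_last hu (H.frame'.contDiffOn i)]
  simp

/-- Antisymmetry leaves nine coefficients. The brackets identify two of them with the connection of
the base and give four relations that involve the vertical field; only the two components of κ and σ
remain free. -/
theorem connCoeff_eq (i j k : Fin 3) : connCoeff g Γ e i j k u =
    connTable (fun i ↦ connCoeff g' Γ' ε i 0 1 (ψ u)) (fun k ↦ connCoeff g Γ e 2 2 k.castSucc u)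
      (connCoeff g Γ e 0 2 1 u) i j k := by
  have a := H.frame.connCoeff_antisymm H.metric hu
  have a0 := H.frame.connCoeff_self H.metric hu
  have b := H.frame'.connCoeff_antisymm H.metric' (H.mapsTo hu)
  have b0 := H.frame'.connCoeff_self H.metric' (H.mapsTo hu)
  have s1 := H.connCoeff_sub_castSucc hu
  have s2 := H.connCoeff_sub_last hu
  have s010 := s1 0 1 0
  have s011 := s1 0 1 1
  have s200 := s2 0 0
  have s201 := s2 0 1
  have s210 := s2 1 0
  have s211 := s2 1 1
  simp only [Fin.castSucc_zero, Fin.castSucc_one, a0, b0] at s010 s011 s200 s201 s210 s211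
  have a001 := a 0 0 1
  have a101 := a 1 0 1
  have a201 := a 2 0 1
  have a002 := a 0 0 2
  have a102 := a 1 0 2
  have a202 := a 2 0 2
  have a012 := a 0 1 2
  have a112 := a 1 1 2
  have a212 := a 2 1 2
  have b001 := b 0 0 1
  have b101 := b 1 0 1
  fin_cases i <;> fin_cases j <;> fin_cases k <;> simp [connTable, a0] <;> linarith

end IsAdaptedFrame

end Adapted

/-! ### The algebraic contradiction in a ring with three derivations. -/

section Algebra

variable {R : Type*} [CommRing R] [Algebra ℝ R]

/-- The structure equations of a Riemannian submersion from a space of constant curvature `c` to a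
surface: `θ` is the connection of the surface, `κ` the mean curvature and `σ` the integrability
tensor. -/
structure StructureEquations (d₁ d₂ d₃ : Derivation ℝ R R) (θ₁ θ₂ κ₁ κ₂ σ c : R) : Prop where
  lie₁₂ : ∀ f, d₁ (d₂ f) - d₂ (d₁ f) = - θ₁ * d₁ f - θ₂ * d₂ f - 2 * σ * d₃ f
  lie₁₃ : ∀ f, d₁ (d₃ f) - d₃ (d₁ f) = κ₁ * d₃ f
  lie₂₃ : ∀ f, d₂ (d₃ f) - d₃ (d₂ f) = κ₂ * d₃ f
  dc₁ : d₁ c = 0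
  dc₂ : d₂ c = 0
  dc₃ : d₃ c = 0
  dθ₁ : d₃ θ₁ = 0
  dθ₂ : d₃ θ₂ = 0
  κ₁₁ : d₁ κ₁ - θ₁ * κ₂ = c - σ ^ 2 + κ₁ ^ 2
  κ₁₂ : d₁ κ₂ + θ₁ * κ₁ = d₃ σ + κ₁ * κ₂
  κ₂₁ : d₂ κ₁ - θ₂ * κ₂ = - d₃ σ + κ₁ * κ₂
  κ₂₂ : d₂ κ₂ + θ₂ * κ₁ = c - σ ^ 2 + κ₂ ^ 2
  σ₁ : d₁ σ = 2 * κ₁ * σ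
  σ₂ : d₂ σ = 2 * κ₂ * σ
  gauss : d₂ θ₁ - d₁ θ₂ - θ₁ ^ 2 - θ₂ ^ 2 = c + 3 * σ ^ 2

/-- The Jacobi operator on the sections `a₁ ε₁ + a₂ ε₂` in the direction of `ε₁`; the component in
the direction of `ε₂` is obtained from `(-θ, a₂, a₁)`. -/
def jacobi (d₁ d₂ d₃ : Derivation ℝ R R) (b₁ b₂ K θ₁ θ₂ a₁ a₂ : R) : R :=
  d₁ (d₁ a₁ - θ₁ * a₂) + b₁ * (d₁ a₁ - θ₁ * a₂) - θ₁ * (d₁ a₂ + θ₁ * a₁)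
    + (d₂ (d₂ a₁ - θ₂ * a₂) + b₂ * (d₂ a₁ - θ₂ * a₂) - θ₂ * (d₂ a₂ + θ₂ * a₁))
    + d₃ (d₃ a₁) + K * a₁

/-- Numerals are invertible in a real algebra; this replaces division by constants in the ring
computations. -/
theorem eq_zero_of_ofNat_mul {n : ℕ} [n.AtLeastTwo] {x : R}
    (h : (OfNat.ofNat n : R) * x = 0) : x = 0 := by
  have h1 : algebraMap ℝ R (OfNat.ofNat n : ℝ)⁻¹ * OfNat.ofNat n = 1 := by
    rw [← map_ofNat (algebraMap ℝ R), ← map_mul, inv_mul_cancel₀, map_one]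
    exact NeZero.ne (OfNat.ofNat n : ℝ)
  linear_combination (algebraMap ℝ R (OfNat.ofNat n : ℝ)⁻¹) * h - x * h1

theorem derivation_ofNat (d : Derivation ℝ R R) (n : ℕ) [n.AtLeastTwo] :
    d (ofNat(n) : R) = 0 := by
  rw [← Nat.cast_ofNat, d.map_natCast]

namespace StructureEquations

variable {d₁ d₂ d₃ : Derivation ℝ R R} {θ₁ θ₂ κ₁ κ₂ σ c : R}
  (S : StructureEquations d₁ d₂ d₃ θ₁ θ₂ κ₁ κ₂ σ c)

include S

/-- The left side of `gauss` is the curvature of the surface, constant along the fibres: `d₃ θ = 0`,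
and the bracket relations carry this over to `d₂ θ₁` and `d₁ θ₂`. The vertical derivative of `c + 3
σ²` therefore vanishes, that is, `6 σ d₃ σ = 0`. -/
theorem sigma_mul_deriv : σ * d₃ σ = 0 := by
  have h1 := S.lie₂₃ θ₁
  have h2 := S.lie₁₃ θ₂
  rw [S.dθ₁, map_zero] at h1
  rw [S.dθ₂, map_zero] at h2
  have h3 := congrArg d₃ S.gauss
  simp only [map_sub, map_add, Derivation.leibniz, Derivation.leibniz_pow, smul_eq_mul, S.dθ₁,
    S.dθ₂, S.dc₃, derivation_ofNat, nsmul_eq_mul] at h3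
  refine eq_zero_of_ofNat_mul (n := 6) ?_
  push_cast at h3
  linear_combination -h3 - h1 + h2

/-- On the set where `σ` does not vanish, neither `κ` nor `σ` can vary along the fibres. -/
theorem false_of_sigma_ne_zero [Nontrivial R] (hσ : ∀ x, σ * x = 0 → x = 0)
    (hp : ∀ x, x * (κ₁ ^ 2 + κ₂ ^ 2) = 0 → x = 0)
    (hJ₁ : jacobi d₁ d₂ d₃ (θ₂ - κ₁) (-(κ₂ + θ₁)) (d₂ θ₁ - d₁ θ₂ - θ₁ ^ 2 - θ₂ ^ 2)
      θ₁ θ₂ κ₁ κ₂ = 0)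
    (hJ₂ : jacobi d₁ d₂ d₃ (θ₂ - κ₁) (-(κ₂ + θ₁)) (d₂ θ₁ - d₁ θ₂ - θ₁ ^ 2 - θ₂ ^ 2)
      (-θ₁) (-θ₂) κ₂ κ₁ = 0) : False := by
  have h0 : d₃ σ = 0 := hσ _ S.sigma_mul_deriv
  -- Since `d₃ σ = 0` and `d₁ σ = 2 κ₁ σ`, the bracket relation `lie₁₃` applied to `σ` reduces to `2
  -- σ d₃ κ₁ = 0`.
  have hk1 : d₃ κ₁ = 0 := by
    have h1 := S.lie₁₃ σ
    rw [h0, map_zero, S.σ₁] at h1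
    simp only [Derivation.leibniz, smul_eq_mul, derivation_ofNat, h0] at h1
    exact eq_zero_of_ofNat_mul (n := 2) (hσ _ (by linear_combination -h1))
  have hk2 : d₃ κ₂ = 0 := by
    have h1 := S.lie₂₃ σ
    rw [h0, map_zero, S.σ₂] at h1
    simp only [Derivation.leibniz, smul_eq_mul, derivation_ofNat, h0] at h1
    exact eq_zero_of_ofNat_mul (n := 2) (hσ _ (by linear_combination -h1))
  have e11 := S.κ₁₁
  have e12 := S.κ₁₂
  have e21 := S.κ₂₁
  have e22 := S.κ₂₂
  rw [h0] at e12 e21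
  -- With no vertical derivatives left, the structure equations eliminate every derivative from the
  -- Jacobi equation.
  have q1 : (3 * c - 3 * σ ^ 2 + (κ₁ ^ 2 + κ₂ ^ 2)) * κ₁ = 0 := by
    rw [jacobi, e11, e12, e21, e22, S.gauss, hk1, map_zero] at hJ₁
    simp only [map_sub, map_add, map_neg, Derivation.leibniz, Derivation.leibniz_pow, smul_eq_mul,
      S.dc₁, S.dc₂, S.σ₁, S.σ₂, nsmul_eq_mul, map_zero] at hJ₁
    push_cast at hJ₁
    linear_combination hJ₁ - 2 * κ₁ * e11 - κ₂ * e21 - κ₁ * e22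
  have q2 : (3 * c - 3 * σ ^ 2 + (κ₁ ^ 2 + κ₂ ^ 2)) * κ₂ = 0 := by
    simp only [jacobi, neg_mul, sub_neg_eq_add, ← sub_eq_add_neg] at hJ₂
    rw [e11, e12, e21, e22, S.gauss, hk2, map_zero] at hJ₂
    simp only [map_sub, map_add, map_neg, Derivation.leibniz, Derivation.leibniz_pow, smul_eq_mul,
      S.dc₁, S.dc₂, S.σ₁, S.σ₂, nsmul_eq_mul, map_zero] at hJ₂
    push_cast at hJ₂
    linear_combination hJ₂ - κ₂ * e11 - κ₁ * e12 - 2 * κ₂ * e22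
  have q : 3 * c - 3 * σ ^ 2 + (κ₁ ^ 2 + κ₂ ^ 2) = 0 :=
    hp _ (by linear_combination κ₁ * q1 + κ₂ * q2)
  have r1 := congrArg d₁ q
  have r2 := congrArg d₂ q
  simp only [map_sub, map_add, Derivation.leibniz, Derivation.leibniz_pow, smul_eq_mul,
    S.dc₁, S.dc₂, S.σ₁, S.σ₂, derivation_ofNat, nsmul_eq_mul, map_zero] at r1 r2
  push_cast at r1 r2
  -- By the structure equations `d₁` of the quantity `q` is `2 κ₁ (c - 7 σ² + |κ|²)`; subtracting `2
  -- κ₁ q` leaves `-4 κ₁ (c + 2 σ²)`.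
  have m1 : (c + 2 * σ ^ 2) * κ₁ = 0 := eq_zero_of_ofNat_mul (n := 4) (by
    linear_combination -r1 + 2 * κ₁ * e11 + 2 * κ₂ * e12 + 2 * κ₁ * q)
  have m2 : (c + 2 * σ ^ 2) * κ₂ = 0 := eq_zero_of_ofNat_mul (n := 4) (by
    linear_combination -r2 + 2 * κ₁ * e21 + 2 * κ₂ * e22 + 2 * κ₂ * q)
  have m : c + 2 * σ ^ 2 = 0 := hp _ (by linear_combination κ₁ * m1 + κ₂ * m2)
  have n1 := congrArg d₁ m
  have n2 := congrArg d₂ m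
  simp only [map_add, Derivation.leibniz, Derivation.leibniz_pow, smul_eq_mul,
    S.dc₁, S.dc₂, S.σ₁, S.σ₂, derivation_ofNat, nsmul_eq_mul, map_zero] at n1 n2
  push_cast at n1 n2
  -- `d₁ (c + 2 σ²) = 8 κ₁ σ²`, and `σ` is not a zero divisor.
  have z1 : κ₁ = 0 := hσ _ (hσ _ (eq_zero_of_ofNat_mul (n := 8) (by linear_combination n1)))
  have z2 : κ₂ = 0 := hσ _ (hσ _ (eq_zero_of_ofNat_mul (n := 8) (by linear_combination n2)))
  exact one_ne_zero (hp 1 (by rw [z1, z2]; ring))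

/-- Now κ may vary along the fibres, and the Jacobi equation is a second-order equation there.
Commuting `d₃` with the horizontal derivatives gives `3 κᵢ' κⱼ' - (7c + |κ|²) κᵢ κⱼ + δᵢⱼ c (3c +
|κ|²) = 0`, with primes for `d₃`. These overdetermine κ: they force `κ' = 0`, then `c = 0` and `|κ|²
= 0`. -/
theorem false_of_sigma_eq_zero [Nontrivial R] [IsReduced R] (hσ : σ = 0)
    (hp : ∀ x, x * (κ₁ ^ 2 + κ₂ ^ 2) = 0 → x = 0)
    (hJ₁ : jacobi d₁ d₂ d₃ (θ₂ - κ₁) (-(κ₂ + θ₁)) (d₂ θ₁ - d₁ θ₂ - θ₁ ^ 2 - θ₂ ^ 2)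
      θ₁ θ₂ κ₁ κ₂ = 0)
    (hJ₂ : jacobi d₁ d₂ d₃ (θ₂ - κ₁) (-(κ₂ + θ₁)) (d₂ θ₁ - d₁ θ₂ - θ₁ ^ 2 - θ₂ ^ 2)
      (-θ₁) (-θ₂) κ₂ κ₁ = 0) : False := by
  subst hσ
  have e11 := S.κ₁₁
  have e12 := S.κ₁₂
  have e21 := S.κ₂₁
  have e22 := S.κ₂₂
  have hK := S.gauss
  simp only [map_zero, neg_zero, zero_add, ne_eq, OfNat.ofNat_ne_zero, not_false_eq_true,
    zero_pow, sub_zero, mul_zero, add_zero] at e11 e12 e21 e22 hK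
  -- the biharmonic equation along the fibres
  have q1 : d₃ (d₃ κ₁) = - (3 * c + (κ₁ ^ 2 + κ₂ ^ 2)) * κ₁ := by
    rw [jacobi, e11, e12, e21, e22, hK] at hJ₁
    simp only [map_sub, map_add, map_neg, Derivation.leibniz, Derivation.leibniz_pow, smul_eq_mul,
      S.dc₁, S.dc₂, nsmul_eq_mul, map_zero] at hJ₁
    push_cast at hJ₁
    linear_combination hJ₁ - 2 * κ₁ * e11 - κ₂ * e21 - κ₁ * e22
  have q2 : d₃ (d₃ κ₂) = - (3 * c + (κ₁ ^ 2 + κ₂ ^ 2)) * κ₂ := by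
    simp only [jacobi, neg_mul, sub_neg_eq_add, ← sub_eq_add_neg] at hJ₂
    rw [e11, e12, e21, e22, hK] at hJ₂
    simp only [map_sub, map_add, map_neg, Derivation.leibniz, Derivation.leibniz_pow, smul_eq_mul,
      S.dc₁, S.dc₂, nsmul_eq_mul, map_zero] at hJ₂
    push_cast at hJ₂
    linear_combination hJ₂ - κ₂ * e11 - κ₁ * e12 - 2 * κ₂ * e22
  -- horizontal derivatives of the vertical derivative of `κ`
  have f11 : d₁ (d₃ κ₁) - θ₁ * d₃ κ₂ = 3 * κ₁ * d₃ κ₁ := by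
    have := congrArg d₃ e11
    simp only [map_sub, map_add, Derivation.leibniz, Derivation.leibniz_pow, smul_eq_mul,
      S.dc₃, S.dθ₁, nsmul_eq_mul] at this
    push_cast at this
    linear_combination this + S.lie₁₃ κ₁
  have f12 : d₁ (d₃ κ₂) + θ₁ * d₃ κ₁ = 2 * κ₁ * d₃ κ₂ + κ₂ * d₃ κ₁ := by
    have := congrArg d₃ e12
    simp only [map_sub, map_add, Derivation.leibniz, Derivation.leibniz_pow, smul_eq_mul,
      S.dc₃, S.dθ₁, nsmul_eq_mul] at this
    linear_combination this + S.lie₁₃ κ₂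
  have f21 : d₂ (d₃ κ₁) - θ₂ * d₃ κ₂ = 2 * κ₂ * d₃ κ₁ + κ₁ * d₃ κ₂ := by
    have := congrArg d₃ e21
    simp only [map_sub, map_add, Derivation.leibniz, Derivation.leibniz_pow, smul_eq_mul,
      S.dc₃, S.dθ₂, nsmul_eq_mul] at this
    linear_combination this + S.lie₂₃ κ₁
  have f22 : d₂ (d₃ κ₂) + θ₂ * d₃ κ₁ = 3 * κ₂ * d₃ κ₂ := by
    have := congrArg d₃ e22
    simp only [map_sub, map_add, Derivation.leibniz, Derivation.leibniz_pow, smul_eq_mul,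
      S.dc₃, S.dθ₂, nsmul_eq_mul] at this
    push_cast at this
    linear_combination this + S.lie₂₃ κ₂
  -- the horizontal derivatives of the biharmonic equation
  have t11 : 3 * d₃ κ₁ * d₃ κ₁ - (7 * c + (κ₁ ^ 2 + κ₂ ^ 2)) * κ₁ * κ₁
      + c * (3 * c + (κ₁ ^ 2 + κ₂ ^ 2)) = 0 := by
    have b := congrArg d₃ f11
    have l := S.lie₁₃ (d₃ κ₁)
    simp only [map_sub, map_add, map_neg, Derivation.leibniz, Derivation.leibniz_pow, smul_eq_mul,
      S.dc₁, S.dc₃, S.dθ₁, nsmul_eq_mul, derivation_ofNat, q1, q2] at b l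
    linear_combination -b - l - 2 * κ₁ * (κ₁ * e11 + κ₂ * e12)
      - (3 * c + (κ₁ ^ 2 + κ₂ ^ 2)) * e11
  have t12 : 3 * d₃ κ₁ * d₃ κ₂ - (7 * c + (κ₁ ^ 2 + κ₂ ^ 2)) * κ₁ * κ₂ = 0 := by
    have b := congrArg d₃ f12
    have l := S.lie₁₃ (d₃ κ₂)
    simp only [map_sub, map_add, map_neg, Derivation.leibniz, Derivation.leibniz_pow, smul_eq_mul,
      S.dc₁, S.dc₃, S.dθ₁, nsmul_eq_mul, derivation_ofNat, q1, q2] at b l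
    linear_combination -b - l - 2 * κ₂ * (κ₁ * e11 + κ₂ * e12)
      - (3 * c + (κ₁ ^ 2 + κ₂ ^ 2)) * e12
  have t22 : 3 * d₃ κ₂ * d₃ κ₂ - (7 * c + (κ₁ ^ 2 + κ₂ ^ 2)) * κ₂ * κ₂
      + c * (3 * c + (κ₁ ^ 2 + κ₂ ^ 2)) = 0 := by
    have b := congrArg d₃ f22
    have l := S.lie₂₃ (d₃ κ₂)
    simp only [map_sub, map_add, map_neg, Derivation.leibniz, Derivation.leibniz_pow, smul_eq_mul,
      S.dc₂, S.dc₃, S.dθ₂, nsmul_eq_mul, derivation_ofNat, q1, q2] at b l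
    linear_combination -b - l - 2 * κ₂ * (κ₁ * e21 + κ₂ * e22)
      - (3 * c + (κ₁ ^ 2 + κ₂ ^ 2)) * e22
  -- `|κ|²` is constant along the fibres
  have w : (κ₁ * d₃ κ₁ + κ₂ * d₃ κ₂) * (14 * c + 5 * (κ₁ ^ 2 + κ₂ ^ 2)) = 0 := by
    have a := congrArg d₃ t11
    have b := congrArg d₃ t22
    simp only [map_sub, map_add, map_neg, Derivation.leibniz, Derivation.leibniz_pow, smul_eq_mul,
      S.dc₃, nsmul_eq_mul, derivation_ofNat, q1, q2, map_zero] at a b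
    push_cast at a b
    refine eq_zero_of_ofNat_mul (n := 2) ?_
    linear_combination -a - b
  -- Write `w` as `x (14c + 5|κ|²) = 0` with `x = κ·κ'`. Its vertical derivative multiplied by `x`
  -- is `x'` times `w` plus `10 x³`, so `x³ = 0` and `x = 0` because the ring is reduced.
  have x0 : κ₁ * d₃ κ₁ + κ₂ * d₃ κ₂ = 0 := by
    have a := congrArg d₃ w
    simp only [map_sub, map_add, map_neg, Derivation.leibniz, Derivation.leibniz_pow, smul_eq_mul,
      S.dc₃, nsmul_eq_mul, derivation_ofNat, map_zero] at a
    push_cast at a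
    refine eq_zero_of_pow_eq_zero (n := 3) (eq_zero_of_ofNat_mul (n := 10) ?_)
    linear_combination (κ₁ * d₃ κ₁ + κ₂ * d₃ κ₂) * a - (d₃ κ₁ * d₃ κ₁ + κ₁ * d₃ (d₃ κ₁)
      + (d₃ κ₂ * d₃ κ₂ + κ₂ * d₃ (d₃ κ₂))) * w
  have p1 : d₃ κ₁ * (c + (κ₁ ^ 2 + κ₂ ^ 2)) = 0 := by
    have b := congrArg d₁ x0
    simp only [map_sub, map_add, map_neg, Derivation.leibniz, Derivation.leibniz_pow, smul_eq_mul,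
      map_zero] at b
    linear_combination b - κ₁ * f11 - κ₂ * f12 - d₃ κ₁ * e11 - d₃ κ₂ * e12 - 3 * κ₁ * x0
  have p2 : d₃ κ₂ * (c + (κ₁ ^ 2 + κ₂ ^ 2)) = 0 := by
    have b := congrArg d₂ x0
    simp only [map_sub, map_add, map_neg, Derivation.leibniz, Derivation.leibniz_pow, smul_eq_mul,
      S.dc₃, nsmul_eq_mul, map_zero] at b
    linear_combination b - κ₁ * f21 - κ₂ * f22 - d₃ κ₁ * e21 - d₃ κ₂ * e22 - 3 * κ₂ * x0
  have a11 : (4 * c + (κ₁ ^ 2 + κ₂ ^ 2)) * (κ₁ * d₃ κ₁) = 0 := by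
    have a := congrArg d₃ t11
    simp only [map_sub, map_add, map_neg, Derivation.leibniz, Derivation.leibniz_pow, smul_eq_mul,
      S.dc₃, nsmul_eq_mul, derivation_ofNat, q1, q2, map_zero] at a
    push_cast at a
    refine eq_zero_of_ofNat_mul (n := 8) ?_
    linear_combination -a + 2 * (c - κ₁ ^ 2) * x0
  have a22 : (4 * c + (κ₁ ^ 2 + κ₂ ^ 2)) * (κ₂ * d₃ κ₂) = 0 := by
    have a := congrArg d₃ t22
    simp only [map_sub, map_add, map_neg, Derivation.leibniz, Derivation.leibniz_pow, smul_eq_mul,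
      S.dc₃, nsmul_eq_mul, derivation_ofNat, q1, q2, map_zero] at a
    push_cast at a
    refine eq_zero_of_ofNat_mul (n := 8) ?_
    linear_combination -a + 2 * (c - κ₂ ^ 2) * x0
  have a12 : (4 * c + (κ₁ ^ 2 + κ₂ ^ 2)) * (κ₁ * d₃ κ₂ + κ₂ * d₃ κ₁) = 0 := by
    have a := congrArg d₃ t12
    simp only [map_sub, map_add, map_neg, Derivation.leibniz, Derivation.leibniz_pow, smul_eq_mul,
      S.dc₃, nsmul_eq_mul, derivation_ofNat, q1, q2, map_zero] at a
    push_cast at a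
    refine eq_zero_of_ofNat_mul (n := 4) ?_
    linear_combination -a - 2 * κ₁ * κ₂ * x0
  -- The products `κᵢ κⱼ' + κⱼ κᵢ'` determine `|κ|² κ'`, and `|κ|²` is not a zero divisor.
  have b1 : (4 * c + (κ₁ ^ 2 + κ₂ ^ 2)) * d₃ κ₁ = 0 :=
    hp _ (by linear_combination κ₁ * a11 + κ₂ * a12 - κ₁ * a22)
  have b2 : (4 * c + (κ₁ ^ 2 + κ₂ ^ 2)) * d₃ κ₂ = 0 :=
    hp _ (by linear_combination κ₂ * a22 + κ₁ * a12 - κ₂ * a11)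
  -- Both `c + |κ|²` and `4c + |κ|²` annihilate `κ'`, hence so does `4 (c + |κ|²) - (4c + |κ|²) = 3
  -- |κ|²`.
  have c1 : d₃ κ₁ = 0 := by
    refine hp _ (eq_zero_of_ofNat_mul (n := 3) ?_)
    linear_combination 4 * p1 - b1
  have c2 : d₃ κ₂ = 0 := by
    refine hp _ (eq_zero_of_ofNat_mul (n := 3) ?_)
    linear_combination 4 * p2 - b2
  rw [c1, map_zero] at q1
  rw [c2, map_zero] at q2
  have q : 3 * c + (κ₁ ^ 2 + κ₂ ^ 2) = 0 := hp _ (by linear_combination κ₁ * q1 + κ₂ * q2)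
  rw [c1] at t11
  rw [c2] at t22
  -- With `κ' = 0` the sum of `t11` and `t22` is a relation between `c` and `|κ|²` alone; it is
  -- combined with `|κ|² = -3c`.
  have r : (2 * c) * (κ₁ ^ 2 + κ₂ ^ 2) = 0 := by
    refine eq_zero_of_ofNat_mul (n := 2) ?_
    linear_combination -t11 - t22 + (2 * c - (κ₁ ^ 2 + κ₂ ^ 2)) * q
  have hc : c = 0 := eq_zero_of_ofNat_mul (n := 2) (hp _ r)
  rw [hc] at q
  exact one_ne_zero (hp 1 (by linear_combination q))

end StructureEquations

end Algebra

/-! ### The algebra of smooth functions on an open set and its derivations. -/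

section SmoothFun

variable {E F : Type*} [NormedAddCommGroup E] [NormedSpace ℝ E]
  [NormedAddCommGroup F] [NormedSpace ℝ F]

/-- The algebra of smooth functions on an open set. -/
def SmoothFun (U : TopologicalSpace.Opens E) : Subalgebra ℝ (U → ℝ) where
  carrier := {f | ∃ F : E → ℝ, ContDiffOn ℝ ∞ F U ∧ ∀ u : U, F u = f u}
  mul_mem' := by
    rintro _ _ ⟨F, hF, h⟩ ⟨G, hG, h'⟩
    exact ⟨fun u ↦ F u * G u, hF.mul hG, fun u ↦ by simp [h, h']⟩
  add_mem' := by
    rintro _ _ ⟨F, hF, h⟩ ⟨G, hG, h'⟩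
    exact ⟨fun u ↦ F u + G u, hF.add hG, fun u ↦ by simp [h, h']⟩
  algebraMap_mem' r := ⟨fun _ ↦ r, contDiffOn_const, fun _ ↦ rfl⟩

namespace SmoothFun

variable {U : TopologicalSpace.Opens E}

/-- The restriction of a function that is smooth on `U`. -/
def mk (F : E → ℝ) (hF : ContDiffOn ℝ ∞ F U) : SmoothFun U :=
  ⟨fun u ↦ F u, F, hF, fun _ ↦ rfl⟩

theorem mk_apply (F : E → ℝ) (hF : ContDiffOn ℝ ∞ F U) (u : U) : (mk F hF : U → ℝ) u = F u := rfl

theorem exists_eq_mk (f : SmoothFun U) : ∃ F : E → ℝ, ∃ hF : ContDiffOn ℝ ∞ F U, f = mk F hF := by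
  obtain ⟨f, F, hF, h⟩ := f
  exact ⟨F, hF, Subtype.ext (funext fun u ↦ (h u).symm)⟩

theorem ext_apply {f f' : SmoothFun U} (h : ∀ u : U, (f : U → ℝ) u = (f' : U → ℝ) u) : f = f' :=
  Subtype.ext (funext h)

/-- The value of the directional derivative along `X`. -/
def derivAux (X : E → E) (f : SmoothFun U) (u : U) : ℝ :=
  fderiv ℝ f.2.choose u (X u)

/-- Any two extensions agree on the open set `U`, so the derivative does not depend on the extension
that was chosen. -/
theorem derivAux_mk (X : E → E) (F : E → ℝ) (hF : ContDiffOn ℝ ∞ F U) (u : U) :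
    derivAux X (mk F hF) u = fderiv ℝ F u (X u) := by
  rw [derivAux, fderiv_congr_of_isOpen U.isOpen (f' := F) _ u.2]
  intro w hw
  exact (mk F hF).2.choose_spec.2 ⟨w, hw⟩

/-- The derivation of the algebra of smooth functions along a smooth vector field. -/
def deriv (X : E → E) (hX : ContDiffOn ℝ ∞ X U) : Derivation ℝ (SmoothFun U) (SmoothFun U) :=
  Derivation.mk'
    { toFun := fun f ↦ ⟨derivAux X f, by
        obtain ⟨F, hF, rfl⟩ := exists_eq_mk f
        exact ⟨fun u ↦ fderiv ℝ F u (X u), (contDiffOn_fderiv U.isOpen hF).clm_apply hX,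
          fun u ↦ (derivAux_mk X F hF u).symm⟩⟩
      map_add' := by
        intro f f'
        obtain ⟨F, hF, rfl⟩ := exists_eq_mk f
        obtain ⟨F', hF', rfl⟩ := exists_eq_mk f'
        refine ext_apply fun u ↦ ?_
        have h : mk F hF + mk F' hF' = mk (fun u ↦ F u + F' u) (hF.add hF') := rfl
        have h1 := ContDiffOn.differentiableAt_of_isOpen U.isOpen hF u.2
        have h2 := ContDiffOn.differentiableAt_of_isOpen U.isOpen hF' u.2
        change derivAux X _ u = derivAux X _ u + derivAux X _ u
        rw [h, derivAux_mk, derivAux_mk, derivAux_mk, fderiv_fun_add h1 h2, add_apply]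
      map_smul' := by
        intro r f
        obtain ⟨F, hF, rfl⟩ := exists_eq_mk f
        refine ext_apply fun u ↦ ?_
        have h : r • mk F hF = mk (fun u ↦ r * F u) (contDiffOn_const.mul hF) := rfl
        have h1 := ContDiffOn.differentiableAt_of_isOpen U.isOpen hF u.2
        change derivAux X _ u = r * derivAux X _ u
        rw [h, derivAux_mk, derivAux_mk, fderiv_const_mul h1, smul_apply, smul_eq_mul] }
    (by
      intro f f'
      obtain ⟨F, hF, rfl⟩ := exists_eq_mk f
      obtain ⟨F', hF', rfl⟩ := exists_eq_mk f'
      refine ext_apply fun u ↦ ?_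
      have h : mk F hF * mk F' hF' = mk (fun u ↦ F u * F' u) (hF.mul hF') := rfl
      have h1 := ContDiffOn.differentiableAt_of_isOpen U.isOpen hF u.2
      have h2 := ContDiffOn.differentiableAt_of_isOpen U.isOpen hF' u.2
      change derivAux X _ u = F u * derivAux X _ u + F' u * derivAux X _ u
      rw [h, derivAux_mk, derivAux_mk, derivAux_mk, fderiv_fun_mul h1 h2, add_apply,
        smul_apply, smul_apply, smul_eq_mul, smul_eq_mul])

theorem contDiffOn_fderiv_apply {F : E → ℝ} (hF : ContDiffOn ℝ ∞ F U) {X : E → E}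
    (hX : ContDiffOn ℝ ∞ X U) : ContDiffOn ℝ ∞ (fun u ↦ fderiv ℝ F u (X u)) U :=
  (contDiffOn_fderiv U.isOpen hF).clm_apply hX

theorem deriv_mk {X : E → E} (hX : ContDiffOn ℝ ∞ X U) {F : E → ℝ} (hF : ContDiffOn ℝ ∞ F U) :
    deriv X hX (mk F hF) = mk (fun u ↦ fderiv ℝ F u (X u)) (contDiffOn_fderiv_apply hF hX) :=
  ext_apply fun u ↦ derivAux_mk X F hF u

theorem deriv_mk_apply {X : E → E} (hX : ContDiffOn ℝ ∞ X U) {F : E → ℝ}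
    (hF : ContDiffOn ℝ ∞ F U) (u : U) :
    (deriv X hX (mk F hF) : U → ℝ) u = fderiv ℝ F u (X u) := derivAux_mk X F hF u

theorem deriv_deriv_sub {X Y : E → E} (hX : ContDiffOn ℝ ∞ X U) (hY : ContDiffOn ℝ ∞ Y U)
    {F : E → ℝ} (hF : ContDiffOn ℝ ∞ F U) (u : U) :
    ((deriv X hX (deriv Y hY (mk F hF)) - deriv Y hY (deriv X hX (mk F hF)) : SmoothFun U) :
      U → ℝ) u = fderiv ℝ F u (fderiv ℝ Y u (X u) - fderiv ℝ X u (Y u)) := by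
  rw [deriv_mk, deriv_mk, deriv_mk, deriv_mk, fderiv_lie U.isOpen hF hX hY u.2]
  rfl

instance : IsReduced (SmoothFun U) :=
  isReduced_of_injective (SmoothFun U).val Subtype.val_injective

end SmoothFun

end SmoothFun

/-! ### The structure equations of a submersion from a space of constant curvature. -/

section Structure

open SmoothFun

variable {E F : Type*} [NormedAddCommGroup E] [NormedSpace ℝ E]
  [NormedAddCommGroup F] [NormedSpace ℝ F]

namespace IsOrthonormalFrame

variable {ι : Type*} [Fintype ι] [DecidableEq ι] {U : TopologicalSpace.Opens E}
  {g : E → E →L[ℝ] E →L[ℝ] ℝ} {Γ : E → E →L[ℝ] E →L[ℝ] E} {e : ι → E → E}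
  (he : IsOrthonormalFrame U g e) (h : IsLocalMetric U g Γ)

/-- The derivation along a field of the frame. -/
def der (i : ι) : Derivation ℝ (SmoothFun U) (SmoothFun U) := deriv (e i) (he.contDiffOn i)

/-- The connection coefficients as smooth functions. -/
def coef (i j k : ι) : SmoothFun U := SmoothFun.mk (connCoeff g Γ e i j k) (he.contDiffOn_connCoeff h i j k)

theorem der_der_sub (i j : ι) (f : SmoothFun U) : he.der i (he.der j f) - he.der j (he.der i f) =
    ∑ k, (he.coef h i j k - he.coef h j i k) * he.der k f := by
  obtain ⟨F, hF, rfl⟩ := exists_eq_mk f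
  refine ext_apply fun u ↦ ?_
  rw [der, der, deriv_deriv_sub, he.lie_eq h u.2, map_sum, AddSubmonoidClass.coe_finsetSum,
    Finset.sum_apply]
  refine Finset.sum_congr rfl fun k _ ↦ ?_
  rw [(fderiv ℝ F u).map_smul, ← deriv_mk_apply (he.contDiffOn k) hF]
  rfl

theorem coef_curv {c : ℝ} (hc : ∀ u ∈ U, ∀ x y z,
    curv Γ u x y z = c • (g u y z • x - g u x z • y)) (i j k l : ι) :
    he.der i (he.coef h j k l) - he.der j (he.coef h i k l)
      + ∑ p, (he.coef h j k p * he.coef h i p l - he.coef h i k p * he.coef h j p l)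
      - ∑ p, (he.coef h i j p - he.coef h j i p) * he.coef h p k l =
    algebraMap ℝ _ c * ((if j = k then 1 else 0) * (if i = l then 1 else 0)
      - (if i = k then 1 else 0) * (if j = l then 1 else 0)) := by
  refine ext_apply fun u ↦ ?_
  have h1 := he.curv_eq h u.2 i j k l
  rw [hc u u.2] at h1
  simp only [map_smul, map_sub, smul_apply, sub_apply, he.inner u u.2, smul_eq_mul] at h1
  rw [coef, coef, der, der, deriv_mk, deriv_mk]
  simp only [Subalgebra.coe_sub, Subalgebra.coe_add, Subalgebra.coe_mul,
    AddSubmonoidClass.coe_finsetSum, Pi.sub_apply, Pi.add_apply, Pi.mul_apply, Finset.sum_apply,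
    SmoothFun.mk_apply, coef]
  rw [← h1]
  split_ifs <;> simp

end IsOrthonormalFrame

namespace IsAdaptedFrame

variable {U : TopologicalSpace.Opens E} {g : E → E →L[ℝ] E →L[ℝ] ℝ} {Γ : E → E →L[ℝ] E →L[ℝ] E}
  {U' : Set F} {g' : F → F →L[ℝ] F →L[ℝ] ℝ} {Γ' : F → F →L[ℝ] F →L[ℝ] F} {ψ : E → F}
  {e : Fin 3 → E → E} {ε : Fin 2 → F → F} (H : IsAdaptedFrame U g Γ U' g' Γ' ψ e ε)

include H in
theorem contDiffOn_theta (i : Fin 2) :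
    ContDiffOn ℝ ∞ (fun u ↦ connCoeff g' Γ' ε i 0 1 (ψ u)) U :=
  (H.frame'.contDiffOn_connCoeff H.metric' i 0 1).comp H.smooth H.mapsTo

/-- The connection of the base, pulled back. -/
def theta (i : Fin 2) : SmoothFun U := SmoothFun.mk _ (H.contDiffOn_theta i)

/-- The components of the mean curvature of the fibres. -/
def kappa (k : Fin 2) : SmoothFun U := H.frame.coef H.metric 2 2 k.castSucc

/-- The integrability function of the horizontal distribution. -/
def sigma : SmoothFun U := H.frame.coef H.metric 0 2 1

theorem coef_eq (i j k : Fin 3) :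
    H.frame.coef H.metric i j k = connTable H.theta H.kappa H.sigma i j k := by
  refine ext_apply fun u ↦ ?_
  refine (H.connCoeff_eq u.2 i j k).trans ?_
  fin_cases i <;> fin_cases j <;> fin_cases k <;> rfl

/-- In the frame numbering 0, 1, 2 the curvature components `(i, 2, j, 2)` give the derivatives of
κ, the components `(i, 2, 0, 1)` give those of σ, and `(0, 1, 0, 1)` is O'Neill's formula. The
derivatives of θ along the fibre vanish because θ is pulled back from the base. -/
theorem structureEquations {c : ℝ} (hc : ∀ u ∈ U, ∀ x y z,
    curv Γ u x y z = c • (g u y z • x - g u x z • y)) :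
    StructureEquations (H.frame.der 0) (H.frame.der 1) (H.frame.der 2) (H.theta 0) (H.theta 1)
      (H.kappa 0) (H.kappa 1) H.sigma (algebraMap ℝ _ c) := by
  have lie := H.frame.der_der_sub H.metric
  have cu := H.frame.coef_curv H.metric hc
  have hθ : ∀ i, H.frame.der 2 (H.theta i) = 0 := fun i ↦ ext_apply fun u ↦ by
    rw [theta, IsOrthonormalFrame.der, deriv_mk_apply]
    exact H.fderiv_comp_last u.2 (H.frame'.contDiffOn_connCoeff H.metric' i 0 1)
  constructor
  · intro f
    have := lie 0 1 f
    simp only [H.coef_eq, connTable, Fin.sum_univ_three, Fin.isValue, Matrix.cons_val] at this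
    linear_combination this
  · intro f
    have := lie 0 2 f
    simp only [H.coef_eq, connTable, Fin.sum_univ_three, Fin.isValue, Matrix.cons_val] at this
    linear_combination this
  · intro f
    have := lie 1 2 f
    simp only [H.coef_eq, connTable, Fin.sum_univ_three, Fin.isValue, Matrix.cons_val] at this
    linear_combination this
  · exact Derivation.map_algebraMap _ c
  · exact Derivation.map_algebraMap _ c
  · exact Derivation.map_algebraMap _ c
  · exact hθ 0
  · exact hθ 1
  · have := cu 0 2 0 2
    simp [H.coef_eq, connTable, Fin.sum_univ_three] at this
    linear_combination -this
  · have := cu 0 2 1 2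
    simp [H.coef_eq, connTable, Fin.sum_univ_three] at this
    linear_combination -this
  · have := cu 1 2 0 2
    simp [H.coef_eq, connTable, Fin.sum_univ_three] at this
    linear_combination -this
  · have := cu 1 2 1 2
    simp [H.coef_eq, connTable, Fin.sum_univ_three] at this
    linear_combination -this
  · have := cu 0 2 0 1
    simp [H.coef_eq, connTable, Fin.sum_univ_three, hθ] at this
    linear_combination this
  · have := cu 1 2 0 1
    simp [H.coef_eq, connTable, Fin.sum_univ_three, hθ] at this
    linear_combination this
  · have := cu 0 1 0 1
    simp [H.coef_eq, connTable, Fin.sum_univ_three] at this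
    linear_combination -this

end IsAdaptedFrame

end Structure

/-! ### Vector fields along a map, and the variation of the second fundamental form. -/

section Along

variable {E F : Type*} [NormedAddCommGroup E] [NormedSpace ℝ E]
  [NormedAddCommGroup F] [NormedSpace ℝ F]

/-- The covariant derivative of a vector field `V` along `ψ` in the direction of `X`. -/
def covAlong (Γ' : F → F →L[ℝ] F →L[ℝ] F) (ψ : E → F) (X : E → E) (V : E → F) (u : E) : F :=
  fderiv ℝ V u (X u) + Γ' (ψ u) (fderiv ℝ ψ u (X u)) (V u)

theorem covAlong_congr {U : Set E} (hU : IsOpen U) (Γ' : F → F →L[ℝ] F →L[ℝ] F) (ψ : E → F)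
    (X : E → E) {V V' : E → F} (h : ∀ u ∈ U, V u = V' u) {u : E} (hu : u ∈ U) :
    covAlong Γ' ψ X V u = covAlong Γ' ψ X V' u := by
  simp only [covAlong, fderiv_congr_of_isOpen hU h hu, h u hu]

theorem covAlong_smul {Γ' : F → F →L[ℝ] F →L[ℝ] F} {ψ : E → F} {X : E → E} {f : E → ℝ}
    {V : E → F} {u : E} (hf : DifferentiableAt ℝ f u) (hV : DifferentiableAt ℝ V u) :
    covAlong Γ' ψ X (fun w ↦ f w • V w) u =
      fderiv ℝ f u (X u) • V u + f u • covAlong Γ' ψ X V u := by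
  rw [covAlong, fderiv_fun_smul hf hV]
  simp only [covAlong, add_apply, smul_apply, ContinuousLinearMap.smulRight_apply, map_smul,
    smul_add]
  abel

theorem covAlong_add {Γ' : F → F →L[ℝ] F →L[ℝ] F} {ψ : E → F} {X : E → E}
    {V W : E → F} {u : E} (hV : DifferentiableAt ℝ V u) (hW : DifferentiableAt ℝ W u) :
    covAlong Γ' ψ X (fun w ↦ V w + W w) u = covAlong Γ' ψ X V u + covAlong Γ' ψ X W u := by
  rw [covAlong, fderiv_fun_add hV hW]
  simp only [covAlong, add_apply, map_add]
  abel

theorem covAlong_eq_sum {ι : Type*} [Fintype ι] (Γ' : F → F →L[ℝ] F →L[ℝ] F) (ψ : E → F)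
    {X : E → E} (V : E → F) {e : ι → E → E} {a : ι → ℝ} {u : E} (h : X u = ∑ i, a i • e i u) :
    covAlong Γ' ψ X V u = ∑ i, a i • covAlong Γ' ψ (e i) V u := by
  simp only [covAlong, h, map_sum, sum_apply, smul_add, Finset.sum_add_distrib]
  simp only [(fderiv ℝ V u).map_smul, (fderiv ℝ ψ u).map_smul, (Γ' (ψ u)).map_smul, smul_apply]

theorem hasDerivAt_comp_line {W : Type*} [NormedAddCommGroup W] [NormedSpace ℝ W] {G : F → W}
    {x : F} (hG : DifferentiableAt ℝ G x) (y : F) :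
    HasDerivAt (fun s : ℝ ↦ G (x + s • y)) (fderiv ℝ G x y) 0 := by
  have h1 : HasFDerivAt G (fderiv ℝ G x) (x + (0 : ℝ) • y) := by simpa using hG.hasFDerivAt
  have h2 : HasDerivAt (fun s : ℝ ↦ x + s • y) y 0 := by
    simpa using ((hasDerivAt_id (0 : ℝ)).smul_const y).const_add x
  exact h1.comp_hasDerivAt (0 : ℝ) h2

/-- The derivative of the second fundamental form along the variation `ψ + s • V`. -/
theorem hasDerivAt_sff_add_smul {U : Set E} (hU : IsOpen U) (Γ : E → E →L[ℝ] E →L[ℝ] E)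
    {Γ' : F → F →L[ℝ] F →L[ℝ] F} {ψ V : E → F} (hψ : ContDiffOn ℝ ∞ ψ U) (hV : ContDiffOn ℝ ∞ V U)
    {u : E} (hu : u ∈ U) (hΓ' : DifferentiableAt ℝ Γ' (ψ u)) (a b : E) :
    HasDerivAt (fun s : ℝ ↦ sff Γ Γ' (fun w ↦ ψ w + s • V w) u a b)
      (fderiv ℝ (fderiv ℝ V) u a b - fderiv ℝ V u (Γ u a b)
        + (fderiv ℝ Γ' (ψ u) (V u) (fderiv ℝ ψ u a) (fderiv ℝ ψ u b)
          + Γ' (ψ u) (fderiv ℝ V u a) (fderiv ℝ ψ u b)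
          + Γ' (ψ u) (fderiv ℝ ψ u a) (fderiv ℝ V u b))) 0 := by
  have hd : ∀ s : ℝ, ∀ w ∈ U, fderiv ℝ (fun w ↦ ψ w + s • V w) w =
      fderiv ℝ ψ w + s • fderiv ℝ V w := fun s w hw ↦ by
    have h1 := ContDiffOn.differentiableAt_of_isOpen hU hψ hw
    have h2 := ContDiffOn.differentiableAt_of_isOpen hU hV hw
    exact (h1.hasFDerivAt.add (h2.hasFDerivAt.const_smul s)).fderiv
  have hdd : ∀ s : ℝ, fderiv ℝ (fderiv ℝ (fun w ↦ ψ w + s • V w)) u =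
      fderiv ℝ (fderiv ℝ ψ) u + s • fderiv ℝ (fderiv ℝ V) u := fun s ↦ by
    have h1 := ContDiffOn.differentiableAt_of_isOpen hU (contDiffOn_fderiv hU hψ) hu
    have h2 := ContDiffOn.differentiableAt_of_isOpen hU (contDiffOn_fderiv hU hV) hu
    rw [fderiv_congr_of_isOpen hU (hd s) hu]
    exact (h1.hasFDerivAt.add (h2.hasFDerivAt.const_smul s)).fderiv
  have hlin : ∀ x y : F, HasDerivAt (fun s : ℝ ↦ x + s • y) y 0 := fun x y ↦ by
    simpa using ((hasDerivAt_id (0 : ℝ)).smul_const y).const_add x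
  have hG : HasDerivAt (fun s : ℝ ↦ Γ' (ψ u + s • V u)) (fderiv ℝ Γ' (ψ u) (V u)) 0 :=
    hasDerivAt_comp_line (W := F →L[ℝ] F →L[ℝ] F) hΓ' (V u)
  have h3 := (hG.clm_apply (hlin (fderiv ℝ ψ u a) (fderiv ℝ V u a))).clm_apply
    (hlin (fderiv ℝ ψ u b) (fderiv ℝ V u b))
  have h4 := ((hlin (fderiv ℝ (fderiv ℝ ψ) u a b) (fderiv ℝ (fderiv ℝ V) u a b)).sub
    (hlin (fderiv ℝ ψ u (Γ u a b)) (fderiv ℝ V u (Γ u a b)))).add h3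
  refine (h4.congr_deriv ?_).congr_of_eventuallyEq (Filter.Eventually.of_forall fun s ↦ ?_)
  · simp only [zero_smul, add_zero, add_apply]
  · simp only [sff, hd s u hu, hdd, add_apply, smul_apply]
    rfl

/-- The derivative of the second fundamental form in terms of covariant derivatives. -/
theorem variation_sff_eq {U : Set E} (hU : IsOpen U) (Γ : E → E →L[ℝ] E →L[ℝ] E)
    {U' : Set F} {g' : F → F →L[ℝ] F →L[ℝ] ℝ} {Γ' : F → F →L[ℝ] F →L[ℝ] F}
    (h' : IsLocalMetric U' g' Γ') {ψ V : E → F} (hψ : ContDiffOn ℝ ∞ ψ U)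
    (hψU : Set.MapsTo ψ U U') (hV : ContDiffOn ℝ ∞ V U) {X : E → E} (hX : ContDiffOn ℝ ∞ X U)
    {u : E} (hu : u ∈ U) :
    fderiv ℝ (fderiv ℝ V) u (X u) (X u) - fderiv ℝ V u (Γ u (X u) (X u))
        + (fderiv ℝ Γ' (ψ u) (V u) (fderiv ℝ ψ u (X u)) (fderiv ℝ ψ u (X u))
          + Γ' (ψ u) (fderiv ℝ V u (X u)) (fderiv ℝ ψ u (X u))
          + Γ' (ψ u) (fderiv ℝ ψ u (X u)) (fderiv ℝ V u (X u)))
      + Γ' (ψ u) (V u) (sff Γ Γ' ψ u (X u) (X u)) =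
    covAlong Γ' ψ X (covAlong Γ' ψ X V) u - covAlong Γ' ψ (cov Γ X X) V u
      + curv Γ' (ψ u) (V u) (fderiv ℝ ψ u (X u)) (fderiv ℝ ψ u (X u)) := by
  -- The last Christoffel term on the left turns the coordinate derivative in the parameter into the
  -- covariant derivative in the direction of `V`. Commuting that past the derivative along `X`
  -- costs the curvature term.
  have dψ := ContDiffOn.differentiableAt_of_isOpen hU hψ hu
  have dV := ContDiffOn.differentiableAt_of_isOpen hU hV hu
  have dΓ := h'.differentiableAt_chr (hψU hu)
  have dΓψ : DifferentiableAt ℝ (fun w ↦ Γ' (ψ w)) u :=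
    differentiableAt_fun_comp (G := F →L[ℝ] F →L[ℝ] F) dψ dΓ
  have hψX : ContDiffOn ℝ ∞ (fun w ↦ fderiv ℝ ψ w (X w)) U :=
    (contDiffOn_fderiv hU hψ).clm_apply hX
  have hVX : ContDiffOn ℝ ∞ (fun w ↦ fderiv ℝ V w (X w)) U :=
    (contDiffOn_fderiv hU hV).clm_apply hX
  have dψX := ContDiffOn.differentiableAt_of_isOpen hU hψX hu
  have dVX := ContDiffOn.differentiableAt_of_isOpen hU hVX hu
  have d1 : DifferentiableAt ℝ (fun w ↦ Γ' (ψ w) (fderiv ℝ ψ w (X w)) (V w)) u :=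
    (dΓψ.clm_apply dψX).clm_apply dV
  have e1 : fderiv ℝ (covAlong Γ' ψ X V) u (X u) =
      fderiv ℝ (fderiv ℝ V) u (X u) (X u) + fderiv ℝ V u (fderiv ℝ X u (X u))
      + (fderiv ℝ Γ' (ψ u) (fderiv ℝ ψ u (X u)) (fderiv ℝ ψ u (X u)) (V u)
        + Γ' (ψ u) (fderiv ℝ (fderiv ℝ ψ) u (X u) (X u) + fderiv ℝ ψ u (fderiv ℝ X u (X u))) (V u)
        + Γ' (ψ u) (fderiv ℝ ψ u (X u)) (fderiv ℝ V u (X u))) := by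
    have : covAlong Γ' ψ X V = fun w ↦
        fderiv ℝ V w (X w) + Γ' (ψ w) (fderiv ℝ ψ w (X w)) (V w) := rfl
    rw [this, fderiv_fun_add dVX d1, add_apply, fderiv_fderiv_apply hU hV hX hu,
      fderiv_clm_apply₂ dΓψ dψX dV, fderiv_comp_apply (G := F →L[ℝ] F →L[ℝ] F) dψ dΓ, fderiv_fderiv_apply hU hψ hX hu]
  rw [covAlong, e1]
  have hs : ∀ x y : F, Γ' (ψ u) x y = Γ' (ψ u) y x := h'.chr_symm (hψU hu)
  have hs' : fderiv ℝ Γ' (ψ u) (fderiv ℝ ψ u (X u)) (V u) (fderiv ℝ ψ u (X u)) =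
      fderiv ℝ Γ' (ψ u) (fderiv ℝ ψ u (X u)) (fderiv ℝ ψ u (X u)) (V u) := by
    rw [← fderiv_clm_apply_const₂ dΓ, ← fderiv_clm_apply_const₂ dΓ,
      fderiv_congr_of_isOpen h'.isOpen (fun w hw ↦ h'.chr_symm hw _ _) (hψU hu)]
  simp only [covAlong, curv, cov, sff, map_add, map_sub, add_apply, sub_apply, hs']
  rw [hs (V u) (fderiv ℝ (fderiv ℝ ψ) u (X u) (X u)), hs (V u) (fderiv ℝ ψ u (Γ u (X u) (X u))),
    hs (fderiv ℝ V u (X u)) (fderiv ℝ ψ u (X u)), hs (V u) (fderiv ℝ ψ u (X u))]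
  abel

theorem sff_eq_covAlong {U : Set E} (hU : IsOpen U) (Γ : E → E →L[ℝ] E →L[ℝ] E)
    (Γ' : F → F →L[ℝ] F →L[ℝ] F) {ψ : E → F} (hψ : ContDiffOn ℝ ∞ ψ U) {X : E → E}
    (hX : ContDiffOn ℝ ∞ X U) {u : E} (hu : u ∈ U) :
    sff Γ Γ' ψ u (X u) (X u) =
      covAlong Γ' ψ X (fun w ↦ fderiv ℝ ψ w (X w)) u - fderiv ℝ ψ u (cov Γ X X u) := by
  simp only [sff, covAlong, fderiv_fderiv_apply hU hψ hX hu, cov, map_add]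
  abel

end Along

/-! ### Covariant derivatives, tension field and base curvature in an adapted frame. -/

section Section

variable {E F : Type*} [NormedAddCommGroup E] [NormedSpace ℝ E]
  [NormedAddCommGroup F] [NormedSpace ℝ F]

/-- The vector field `v₀ ε₀ + v₁ ε₁` along `ψ`. -/
def secAlong (ε : Fin 2 → F → F) (ψ : E → F) (v₀ v₁ : E → ℝ) (u : E) : F :=
  v₀ u • ε 0 (ψ u) + v₁ u • ε 1 (ψ u)

namespace IsAdaptedFrame

variable {U : Set E} {g : E → E →L[ℝ] E →L[ℝ] ℝ} {Γ : E → E →L[ℝ] E →L[ℝ] E}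
  {U' : Set F} {g' : F → F →L[ℝ] F →L[ℝ] ℝ} {Γ' : F → F →L[ℝ] F →L[ℝ] F} {ψ : E → F}
  {e : Fin 3 → E → E} {ε : Fin 2 → F → F} (H : IsAdaptedFrame U g Γ U' g' Γ' ψ e ε)

/-- The connection of the base along the frame. -/
def thetaFun (g' : F → F →L[ℝ] F →L[ℝ] ℝ) (Γ' : F → F →L[ℝ] F →L[ℝ] F) (ψ : E → F)
    (ε : Fin 2 → F → F) : Fin 3 → E → ℝ :=
  ![fun u ↦ connCoeff g' Γ' ε 0 0 1 (ψ u), fun u ↦ connCoeff g' Γ' ε 1 0 1 (ψ u), fun _ ↦ 0]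

include H

theorem contDiffOn_thetaFun (i : Fin 3) : ContDiffOn ℝ ∞ (thetaFun g' Γ' ψ ε i) U := by
  have h := fun j ↦ (H.frame'.contDiffOn_connCoeff H.metric' j 0 1).comp H.smooth H.mapsTo
  fin_cases i
  · exact h 0
  · exact h 1
  · exact contDiffOn_const

theorem contDiffOn_comp (k : Fin 2) : ContDiffOn ℝ ∞ (fun u ↦ ε k (ψ u)) U :=
  (H.frame'.contDiffOn k).comp H.smooth H.mapsTo

theorem contDiffOn_secAlong {v₀ v₁ : E → ℝ} (h₀ : ContDiffOn ℝ ∞ v₀ U)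
    (h₁ : ContDiffOn ℝ ∞ v₁ U) : ContDiffOn ℝ ∞ (secAlong ε ψ v₀ v₁) U :=
  (h₀.smul (H.contDiffOn_comp 0)).add (h₁.smul (H.contDiffOn_comp 1))

variable {u : E} (hu : u ∈ U)
include hu

/-- The pulled-back connection acts along the horizontal fields as on the base. Along the fibre it
kills `ε k ∘ ψ`, since `ψ` is constant to first order there; hence the third component of `thetaFun`
is zero. -/
theorem covAlong_frame (i : Fin 3) :
    covAlong Γ' ψ (e i) (fun w ↦ ε 0 (ψ w)) u = thetaFun g' Γ' ψ ε i u • ε 1 (ψ u) ∧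
    covAlong Γ' ψ (e i) (fun w ↦ ε 1 (ψ w)) u = -thetaFun g' Γ' ψ ε i u • ε 0 (ψ u) := by
  have hh : ∀ i k : Fin 2, covAlong Γ' ψ (e i.castSucc) (fun w ↦ ε k (ψ w)) u =
      ∑ l, connCoeff g' Γ' ε i k l (ψ u) • ε l (ψ u) := fun i k ↦ by
    rw [← H.frame'.cov_eq_sum H.metric' (H.mapsTo hu), covAlong,
      H.fderiv_comp_castSucc hu (H.frame'.contDiffOn k), H.fderiv_castSucc hu, cov]
  have hv : ∀ k : Fin 2, covAlong Γ' ψ (e 2) (fun w ↦ ε k (ψ w)) u = 0 := fun k ↦ by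
    rw [covAlong, H.fderiv_comp_last hu (H.frame'.contDiffOn k), H.fderiv_last hu]
    simp
  have hself := H.frame'.connCoeff_self H.metric' (H.mapsTo hu)
  have hanti := fun i ↦ H.frame'.connCoeff_antisymm H.metric' (H.mapsTo hu) i 1 0
  fin_cases i
  · have h0 := hh 0 0
    have h1 := hh 0 1
    simp only [Fin.sum_univ_two, hself, hanti, zero_smul, zero_add, add_zero] at h0 h1
    exact ⟨h0, h1⟩
  · have h0 := hh 1 0
    have h1 := hh 1 1
    simp only [Fin.sum_univ_two, hself, hanti, zero_smul, zero_add, add_zero] at h0 h1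
    exact ⟨h0, h1⟩
  · exact ⟨by simpa [thetaFun] using hv 0, by simpa [thetaFun] using hv 1⟩

theorem covAlong_secAlong {v₀ v₁ : E → ℝ} (h₀ : ContDiffOn ℝ ∞ v₀ U)
    (h₁ : ContDiffOn ℝ ∞ v₁ U) (i : Fin 3) :
    covAlong Γ' ψ (e i) (secAlong ε ψ v₀ v₁) u =
      secAlong ε ψ (fun w ↦ fderiv ℝ v₀ w (e i w) - thetaFun g' Γ' ψ ε i w * v₁ w)
        (fun w ↦ fderiv ℝ v₁ w (e i w) + thetaFun g' Γ' ψ ε i w * v₀ w) u := by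
  have dv : ∀ {f : E → ℝ}, ContDiffOn ℝ ∞ f U → DifferentiableAt ℝ f u := fun hf ↦
    ContDiffOn.differentiableAt_of_isOpen H.metric.isOpen hf hu
  have dε : ∀ k, DifferentiableAt ℝ (fun u ↦ ε k (ψ u)) u := fun k ↦
    ContDiffOn.differentiableAt_of_isOpen H.metric.isOpen (H.contDiffOn_comp k) hu
  have := covAlong_add (Γ' := Γ') (ψ := ψ) (X := e i) ((dv h₀).smul (dε 0)) ((dv h₁).smul (dε 1))
  refine this.trans ?_
  have e0 := covAlong_smul (Γ' := Γ') (ψ := ψ) (X := e i) (dv h₀) (dε 0)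
  have e1 := covAlong_smul (Γ' := Γ') (ψ := ψ) (X := e i) (dv h₁) (dε 1)
  refine (congrArg₂ _ e0 e1).trans ?_
  rw [(H.covAlong_frame hu i).1, (H.covAlong_frame hu i).2, secAlong]
  module

/-- The horizontal directions contribute nothing, because the horizontal part of the connection
upstairs is that of the base. The vertical direction contributes `-dψ(∇_{e 2} e 2)`. -/
theorem sum_sff_eq : ∑ i, sff Γ Γ' ψ u (e i u) (e i u) =
    secAlong ε ψ (fun w ↦ - connCoeff g Γ e 2 2 0 w) (fun w ↦ - connCoeff g Γ e 2 2 1 w) u := by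
  have h1 : ∀ i, sff Γ Γ' ψ u (e i u) (e i u) =
      covAlong Γ' ψ (e i) (fun w ↦ fderiv ℝ ψ w (e i w)) u
        - ∑ k, connCoeff g Γ e i i k u • fderiv ℝ ψ u (e k u) := fun i ↦ by
    rw [sff_eq_covAlong H.metric.isOpen Γ Γ' H.smooth (H.frame.contDiffOn i) hu,
      H.frame.cov_eq_sum H.metric hu, map_sum]
    simp only [map_smul]
  have f0 : ∀ w ∈ U, fderiv ℝ ψ w (e 0 w) = ε 0 (ψ w) := fun w hw ↦ H.fderiv_castSucc hw 0
  have f1 : ∀ w ∈ U, fderiv ℝ ψ w (e 1 w) = ε 1 (ψ w) := fun w hw ↦ H.fderiv_castSucc hw 1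
  have f2 : ∀ w ∈ U, fderiv ℝ ψ w (e 2 w) = 0 := fun w hw ↦ H.fderiv_last hw
  have f2' : covAlong Γ' ψ (e 2) (fun _ ↦ (0 : F)) u = 0 := by simp [covAlong]
  simp only [Fin.sum_univ_three, h1]
  rw [covAlong_congr H.metric.isOpen Γ' ψ (e 0) f0 hu,
    covAlong_congr H.metric.isOpen Γ' ψ (e 1) f1 hu,
    covAlong_congr H.metric.isOpen Γ' ψ (e 2) f2 hu, f2', (H.covAlong_frame hu 0).1,
    (H.covAlong_frame hu 1).2, f0 u hu, f1 u hu, f2 u hu]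
  have g0 := H.connCoeff_eq hu 0 0
  have g1 := H.connCoeff_eq hu 1 1
  have g00 := g0 0
  have g01 := g0 1
  have g10 := g1 0
  have g11 := g1 1
  simp only [connTable, Fin.isValue, Matrix.cons_val] at g00 g01 g10 g11
  rw [g00, g01, g10, g11]
  simp only [thetaFun, secAlong, Fin.isValue, Matrix.cons_val, zero_smul, smul_zero, neg_smul]
  abel

/-- The trace of the curvature of the base. -/
theorem sum_curv_eq (a b : ℝ) :
    curv Γ' (ψ u) (a • ε 0 (ψ u) + b • ε 1 (ψ u)) (ε 0 (ψ u)) (ε 0 (ψ u))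
      + curv Γ' (ψ u) (a • ε 0 (ψ u) + b • ε 1 (ψ u)) (ε 1 (ψ u)) (ε 1 (ψ u)) =
    (fderiv ℝ (thetaFun g' Γ' ψ ε 0) u (e 1 u) - fderiv ℝ (thetaFun g' Γ' ψ ε 1) u (e 0 u)
      - thetaFun g' Γ' ψ ε 0 u ^ 2 - thetaFun g' Γ' ψ ε 1 u ^ 2) •
        (a • ε 0 (ψ u) + b • ε 1 (ψ u)) := by
  have hy := H.mapsTo hu
  have hlin : ∀ x : F, curv Γ' (ψ u) (a • ε 0 (ψ u) + b • ε 1 (ψ u)) x x =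
      a • curv Γ' (ψ u) (ε 0 (ψ u)) x x + b • curv Γ' (ψ u) (ε 1 (ψ u)) x x := fun x ↦ by
    simp only [curv, map_add, add_apply, (fderiv ℝ Γ' (ψ u)).map_smul, (Γ' (ψ u)).map_smul,
      (fderiv ℝ Γ' (ψ u) x).map_smul, (Γ' (ψ u) x).map_smul, smul_apply]
    module
  have hz : ∀ x : F, curv Γ' (ψ u) x x x = 0 := fun x ↦ by simp [curv]
  have hC := H.frame'.curv_eq H.metric' hy
  have hself := H.frame'.connCoeff_self H.metric' hy
  have hanti := fun i ↦ H.frame'.connCoeff_antisymm H.metric' hy i 1 0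
  have hd0 : fderiv ℝ (thetaFun g' Γ' ψ ε 0) u (e 1 u) =
      fderiv ℝ (connCoeff g' Γ' ε 0 0 1) (ψ u) (ε 1 (ψ u)) :=
    H.fderiv_comp_castSucc hu (H.frame'.contDiffOn_connCoeff H.metric' 0 0 1) 1
  have hd1 : fderiv ℝ (thetaFun g' Γ' ψ ε 1) u (e 0 u) =
      fderiv ℝ (connCoeff g' Γ' ε 1 0 1) (ψ u) (ε 0 (ψ u)) :=
    H.fderiv_comp_castSucc hu (H.frame'.contDiffOn_connCoeff H.metric' 1 0 1) 0
  set K := fderiv ℝ (thetaFun g' Γ' ψ ε 0) u (e 1 u) - fderiv ℝ (thetaFun g' Γ' ψ ε 1) u (e 0 u)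
      - thetaFun g' Γ' ψ ε 0 u ^ 2 - thetaFun g' Γ' ψ ε 1 u ^ 2 with hK
  have k1 : g' (ψ u) (curv Γ' (ψ u) (ε 1 (ψ u)) (ε 0 (ψ u)) (ε 0 (ψ u))) (ε 1 (ψ u)) = K := by
    rw [hC 1 0 0 1, hK, hd0, hd1]
    simp only [Fin.sum_univ_two, hself, hanti]
    simp [thetaFun]
    ring
  have k2 : g' (ψ u) (curv Γ' (ψ u) (ε 0 (ψ u)) (ε 1 (ψ u)) (ε 1 (ψ u))) (ε 0 (ψ u)) = K := by
    rw [← k1, curv_antisymm, map_neg, neg_apply, H.metric'.curv_skew hy, neg_neg]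
  have k3 : ∀ x y z, g' (ψ u) (curv Γ' (ψ u) x y z) z = 0 := fun x y z ↦ by
    have := H.metric'.curv_skew hy x y z z
    linarith
  have s1 := H.frame'.sum_eq _ hy (curv Γ' (ψ u) (ε 1 (ψ u)) (ε 0 (ψ u)) (ε 0 (ψ u)))
  have s2 := H.frame'.sum_eq _ hy (curv Γ' (ψ u) (ε 0 (ψ u)) (ε 1 (ψ u)) (ε 1 (ψ u)))
  rw [Fin.sum_univ_two, k1, k3, zero_smul, zero_add] at s1
  rw [Fin.sum_univ_two, k2, k3, zero_smul, add_zero] at s2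
  rw [hlin, hlin, hz, hz, ← s1, ← s2]
  module

end IsAdaptedFrame

end Section

/-! ### The divergence theorem in an orthonormal frame. -/

section Divergence

variable {m : ℕ}

theorem trace_eq_of_frame {A : Matrix (Fin m) (Fin m) ℝ} {e : Fin m → EuclideanSpace ℝ (Fin m)}
    (he : ∀ i j, bil A (e i) (e j) = if i = j then 1 else 0)
    (L : EuclideanSpace ℝ (Fin m) →L[ℝ] EuclideanSpace ℝ (Fin m)) {B : Matrix (Fin m) (Fin m) ℝ}
    (hB : ∀ j, L (e j) = ∑ k, B k j • e k) : ∑ k, L (stdVec k) k = B.trace := by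
  set P : Matrix (Fin m) (Fin m) ℝ := Matrix.of fun k i ↦ e i k with hP
  have h1 : P.transpose * A * P = 1 :=
    (eq_transpose_mul_mul_of_gram (B := 1) (by simpa [Matrix.one_apply] using he)).symm
  have h2 : P * (P.transpose * A) = 1 := mul_eq_one_comm.1 h1
  set Q : Matrix (Fin m) (Fin m) ℝ := Matrix.of fun l k ↦ L (stdVec k) l with hQ
  have h3 : Q * P = P * B := by
    ext l j
    have h4 := congrArg (fun x : EuclideanSpace ℝ (Fin m) ↦ x l)
      ((clm_apply_eq_sum L (e j)).symm.trans (hB j))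
    simp only [WithLp.ofLp_sum, Finset.sum_apply, PiLp.smul_apply, smul_eq_mul] at h4
    simp only [Matrix.mul_apply, hQ, hP, Matrix.of_apply]
    rw [← (by simpa [mul_comm] using h4 :
      ∑ k, L (stdVec k) l * e j k = ∑ k, e k l * B k j)]
  have h5 : Q = P * B * (P.transpose * A) := by
    rw [← h3, Matrix.mul_assoc, h2, Matrix.mul_one]
  have h6 : ∑ k, L (stdVec k) k = Q.trace := rfl
  rw [h6, h5, Matrix.mul_assoc, Matrix.trace_mul_comm, Matrix.mul_assoc, h1, Matrix.mul_one]

/-- Liouville's formula for a frame in dimension three. -/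
theorem fderiv_det_frame {e : Fin 3 → EuclideanSpace ℝ (Fin 3) → EuclideanSpace ℝ (Fin 3)}
    {u a : EuclideanSpace ℝ (Fin 3)} (he : ∀ j, DifferentiableAt ℝ (e j) u)
    {B : Matrix (Fin 3) (Fin 3) ℝ} (hB : ∀ j, fderiv ℝ (e j) u a = ∑ k, B k j • e k u) :
    HasDerivAt (fun t : ℝ ↦ (Matrix.of fun k j ↦ e j (u + t • a) k : Matrix (Fin 3) (Fin 3) ℝ).det)
      (B.trace * (Matrix.of fun k j ↦ e j u k : Matrix (Fin 3) (Fin 3) ℝ).det) 0 := by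
  have h : ∀ j k, HasDerivAt (fun t : ℝ ↦ e j (u + t • a) k) (∑ l, B l j * e l u k) 0 := by
    intro j k
    have h1 := (EuclideanSpace.proj k : EuclideanSpace ℝ (Fin 3) →L[ℝ] ℝ).hasFDerivAt.comp_hasDerivAt
      (0 : ℝ) (hasDerivAt_comp_line (he j) a)
    rw [hB] at h1
    simpa [Function.comp_def] using h1
  simp only [Matrix.det_fin_three, Matrix.of_apply]
  have h2 := (((((((h 0 0).mul (h 1 1)).mul (h 2 2)).sub (((h 0 0).mul (h 2 1)).mul (h 1 2))).sub
    (((h 1 0).mul (h 0 1)).mul (h 2 2))).add (((h 2 0).mul (h 0 1)).mul (h 1 2))).add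
    (((h 1 0).mul (h 2 1)).mul (h 0 2))).sub (((h 2 0).mul (h 1 1)).mul (h 0 2))
  refine (h2.congr_deriv ?_).congr_of_eventuallyEq (Filter.Eventually.of_forall fun t ↦ ?_)
  · simp only [Pi.mul_apply, zero_smul, add_zero, Fin.sum_univ_three, Matrix.trace_fin_three]
    ring
  · simp only [Pi.mul_apply, Pi.sub_apply, Pi.add_apply]
    ring

/-- The logarithmic derivative of the volume density along a frame field. -/
theorem fderiv_density {U : Set (EuclideanSpace ℝ (Fin 3))} (hU : IsOpen U)
    {A : EuclideanSpace ℝ (Fin 3) → Matrix (Fin 3) (Fin 3) ℝ} {ρ : EuclideanSpace ℝ (Fin 3) → ℝ}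
    (hρ : ContDiffOn ℝ ∞ ρ U) (hρA : ∀ u ∈ U, ρ u ^ 2 = (A u).det)
    {e : Fin 3 → EuclideanSpace ℝ (Fin 3) → EuclideanSpace ℝ (Fin 3)}
    (he : IsOrthonormalFrame U (fun u ↦ bil (A u)) e) {u : EuclideanSpace ℝ (Fin 3)} (hu : u ∈ U)
    (a : EuclideanSpace ℝ (Fin 3)) {B : Matrix (Fin 3) (Fin 3) ℝ}
    (hB : ∀ j, fderiv ℝ (e j) u a = ∑ k, B k j • e k u) :
    fderiv ℝ ρ u a = - B.trace * ρ u := by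
  set P : EuclideanSpace ℝ (Fin 3) → Matrix (Fin 3) (Fin 3) ℝ := fun w ↦
    Matrix.of fun k j ↦ e j w k with hP
  -- Orthonormality reads `Pᵀ A P = 1`. Working with squares avoids a choice of orientation for the
  -- frame; the derivative of `det P` is Liouville's formula.
  have h1 : ∀ w ∈ U, ρ w ^ 2 * (P w).det ^ 2 = 1 := by
    intro w hw
    have h2 : (P w).transpose * A w * P w = 1 :=
      (eq_transpose_mul_mul_of_gram (B := 1)
        (by simpa [Matrix.one_apply] using he.inner w hw)).symm
    have h3 := congrArg Matrix.det h2
    rw [Matrix.det_mul, Matrix.det_mul, Matrix.det_transpose, Matrix.det_one] at h3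
    rw [hρA w hw]
    linarith
  have d1 := hasDerivAt_comp_line (ContDiffOn.differentiableAt_of_isOpen hU hρ hu) a
  have d2 := fderiv_det_frame (fun j ↦ ContDiffOn.differentiableAt_of_isOpen hU
    (he.contDiffOn j) hu) hB
  have d3 := (d1.pow 2).mul (d2.pow 2)
  have hc : ContinuousAt (fun t : ℝ ↦ u + t • a) 0 := by fun_prop
  have hev : ∀ᶠ t : ℝ in nhds 0, u + t • a ∈ U :=
    hc.eventually_mem (by simpa using hU.mem_nhds hu)
  have d4 : HasDerivAt (fun t : ℝ ↦ ρ (u + t • a) ^ 2 * (P (u + t • a)).det ^ 2) 0 0 :=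
    (hasDerivAt_const (0 : ℝ) (1 : ℝ)).congr_of_eventuallyEq (hev.mono fun t ht ↦ h1 _ ht)
  have d5 := d3.unique d4
  have h0 := h1 u hu
  simp only [zero_smul, add_zero, Pi.pow_apply, Nat.cast_ofNat, Nat.add_one_sub_one, pow_one] at d5
  have hρ0 : ρ u ≠ 0 := fun h ↦ by simp [h] at h0
  have hP0 : (P u).det ≠ 0 := fun h ↦ by simp [h] at h0
  have h6 : 2 * (ρ u * (P u).det ^ 2) * (fderiv ℝ ρ u a + B.trace * ρ u) = 0 := by
    linear_combination d5
  have h7 := (mul_eq_zero.1 h6).resolve_left (by positivity)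
  linarith

/-- The divergence theorem for a compactly supported multiple of a frame field. -/
theorem integral_frame_divergence {U : Set (EuclideanSpace ℝ (Fin 3))}
    {A : EuclideanSpace ℝ (Fin 3) → Matrix (Fin 3) (Fin 3) ℝ} {ρ : EuclideanSpace ℝ (Fin 3) → ℝ}
    {Γ : EuclideanSpace ℝ (Fin 3) → EuclideanSpace ℝ (Fin 3) →L[ℝ]
      EuclideanSpace ℝ (Fin 3) →L[ℝ] EuclideanSpace ℝ (Fin 3)}
    (h : IsLocalMetric U (fun u ↦ bil (A u)) Γ)
    (hρ : ContDiffOn ℝ ∞ ρ U) (hρA : ∀ u ∈ U, ρ u ^ 2 = (A u).det)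
    {e : Fin 3 → EuclideanSpace ℝ (Fin 3) → EuclideanSpace ℝ (Fin 3)}
    (he : IsOrthonormalFrame U (fun u ↦ bil (A u)) e) {f : EuclideanSpace ℝ (Fin 3) → ℝ}
    (hf : ContDiffOn ℝ ∞ f U) {K : Set (EuclideanSpace ℝ (Fin 3))} (hK : IsCompact K)
    (hKU : K ⊆ U) (hfK : ∀ u ∉ K, f u = 0) (i : Fin 3) :
    IntegrableOn (fun u ↦ ρ u * (fderiv ℝ f u (e i u)
        + (∑ j, connCoeff (fun u ↦ bil (A u)) Γ e j i j u) * f u)) K ∧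
    ∫ u in K, ρ u * (fderiv ℝ f u (e i u)
      + (∑ j, connCoeff (fun u ↦ bil (A u)) Γ e j i j u) * f u) = 0 := by
  have hU := h.isOpen
  have hdiv : ContDiffOn ℝ ∞ (fun u ↦ ρ u * (fderiv ℝ f u (e i u)
      + (∑ j, connCoeff (fun u ↦ bil (A u)) Γ e j i j u) * f u)) U :=
    hρ.mul (((contDiffOn_fderiv hU hf).clm_apply (he.contDiffOn i)).add
      ((ContDiffOn.sum fun j _ ↦ he.contDiffOn_connCoeff h j i j).mul hf))
  refine ⟨(hdiv.continuousOn.mono hKU).integrableOn_compact hK, ?_⟩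
  have hik : ∀ k, ContDiffOn ℝ ∞ (fun u ↦ e i u k) U := fun k ↦
    (contDiffOn_euclidean.1 (he.contDiffOn i)) k
  -- These are the coordinates of `ρ f e i`, smooth on the whole space because they vanish off `K`.
  -- The integrand is their Euclidean divergence.
  set W : Fin 3 → EuclideanSpace ℝ (Fin 3) → ℝ := fun k u ↦ f u * (ρ u * e i u k) with hW
  have hWU : ∀ k, ContDiffOn ℝ ∞ (W k) U := fun k ↦ hf.mul (hρ.mul (hik k))
  have hW0 : ∀ k, ∀ u ∉ K, W k u = 0 := fun k u hu ↦ by simp [hW, hfK u hu]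
  have hWev : ∀ k, ∀ u ∉ K, W k =ᶠ[nhds u] fun _ ↦ 0 := fun k u hu ↦
    Filter.eventuallyEq_of_mem (hK.isClosed.isOpen_compl.mem_nhds hu) fun w hw ↦ hW0 k w hw
  have hWc : ∀ k, ContDiff ℝ ∞ (W k) := fun k ↦ contDiff_iff_contDiffAt.2 fun u ↦ by
    by_cases hu : u ∈ K
    · exact (hWU k).contDiffAt (hU.mem_nhds (hKU hu))
    · exact contDiffAt_const.congr_of_eventuallyEq (hWev k u hu)
  have hWs : ∀ k, HasCompactSupport (W k) := fun k ↦ HasCompactSupport.intro hK (hW0 k)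
  have hd0 : ∀ k a, ∀ u ∉ K, fderiv ℝ (W k) u a = 0 := fun k a u hu ↦ by
    rw [(hWev k u hu).fderiv_eq]; simp
  have hcd : ∀ k a, Continuous fun u ↦ fderiv ℝ (W k) u a := fun k a ↦
    ((hWc k).continuous_fderiv (by simp)).clm_apply continuous_const
  have hint : ∀ k, ∫ u, fderiv ℝ (W k) u (stdVec k) = 0 := fun k ↦ by
    have i1 : Integrable (fun u ↦ fderiv ℝ (W k) u (stdVec k)) volume :=
      (hcd k _).integrable_of_hasCompactSupport (HasCompactSupport.intro hK (hd0 k _))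
    have i2 : Integrable (W k) volume :=
      (hWc k).continuous.integrable_of_hasCompactSupport (hWs k)
    -- Integration by parts against the constant function `1`.
    have h1 := integral_mul_fderiv_eq_neg_fderiv_mul_of_integrable (μ := volume)
      (f := fun _ : EuclideanSpace ℝ (Fin 3) ↦ (1 : ℝ)) (g := W k) (v := stdVec k)
      (by simp) (by simpa using i1) (by simpa using i2)
      (fun _ _ ↦ differentiableAt_const _)
      (fun u _ ↦ (hWc k).differentiable (by simp) u)
    simpa using h1
  have hsum : ∫ u in K, ∑ k, fderiv ℝ (W k) u (stdVec k) = 0 := by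
    rw [integral_finsetSum _ fun k _ ↦ (hcd k _).continuousOn.integrableOn_compact hK]
    refine Finset.sum_eq_zero fun k _ ↦ ?_
    rw [setIntegral_eq_integral_of_forall_compl_eq_zero fun u hu ↦ hd0 k _ u hu, hint k]
  rw [← hsum]
  refine setIntegral_congr_fun hK.measurableSet fun u huK ↦ ?_
  have hu := hKU huK
  have dd : ∀ {F : EuclideanSpace ℝ (Fin 3) → ℝ}, ContDiffOn ℝ ∞ F U → DifferentiableAt ℝ F u :=
    fun hF ↦ ContDiffOn.differentiableAt_of_isOpen hU hF hu
  have de := fun j ↦ ContDiffOn.differentiableAt_of_isOpen hU (he.contDiffOn j) hu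
  have hB : ∀ a j, fderiv ℝ (e j) u a =
      ∑ k, (Matrix.of fun k j ↦ bil (A u) (fderiv ℝ (e j) u a) (e k u)) k j • e k u :=
    fun a j ↦ (he.sum_eq u hu _).symm
  have hρ' := fderiv_density hU hρ hρA he hu (e i u) (hB (e i u))
  have htr := trace_eq_of_frame (he.inner u hu) (fderiv ℝ (e i) u)
    (B := Matrix.of fun k j ↦ bil (A u) (fderiv ℝ (e i) u (e j u)) (e k u))
    fun j ↦ (he.sum_eq u hu _).symm
  have hcomp : ∀ k a, fderiv ℝ (fun w ↦ e i w k) u a = fderiv ℝ (e i) u a k := fun k a ↦ by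
    have : HasFDerivAt (fun w ↦ e i w k) _ u :=
      (EuclideanSpace.proj k : EuclideanSpace ℝ (Fin 3) →L[ℝ] ℝ).hasFDerivAt.comp u
        (de i).hasFDerivAt
    rw [this.fderiv]; rfl
  -- The divergence of `e i` equals `∑ ⟨[e j, e i], e j⟩`. One half of the bracket is the trace of
  -- the Jacobian of `e i`, the other half is the logarithmic derivative of `ρ` along `e i`.
  have hconn : ∑ j, connCoeff (fun u ↦ bil (A u)) Γ e j i j u =
      ∑ j, bil (A u) (fderiv ℝ (e i) u (e j u)) (e j u)
        - ∑ j, bil (A u) (fderiv ℝ (e j) u (e i u)) (e j u) := by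
    rw [← Finset.sum_sub_distrib]
    refine Finset.sum_congr rfl fun j _ ↦ ?_
    have h1 := he.connCoeff_sub h hu j i j
    rw [he.connCoeff_self h hu, sub_zero] at h1
    rw [h1, map_sub, sub_apply]
  have hWk : ∀ k, fderiv ℝ (W k) u (stdVec k) =
      fderiv ℝ f u (e i u k • stdVec k) * ρ u + f u * fderiv ℝ ρ u (e i u k • stdVec k)
        + f u * ρ u * fderiv ℝ (e i) u (stdVec k) k := fun k ↦ by
    rw [hW, fderiv_fun_mul (dd hf) ((dd hρ).fun_mul (dd (hik k))), fderiv_fun_mul (dd hρ) (dd (hik k))]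
    simp only [add_apply, smul_apply, smul_eq_mul, hcomp, map_smul]
    ring
  simp only [hWk, Finset.sum_add_distrib, ← Finset.sum_mul, ← Finset.mul_sum, ← map_sum,
    sum_smul_stdVec, htr, hρ', hconn, Matrix.trace, Matrix.diag_apply, Matrix.of_apply]
  ring

end Divergence

/-! ### The Jacobi operator as the first variation of the tension field. -/

section Jacobi

theorem jacobi_neg {R : Type*} [CommRing R] [Algebra ℝ R] (d₁ d₂ d₃ : Derivation ℝ R R)
    (b₁ b₂ K θ₁ θ₂ a₁ a₂ : R) : jacobi d₁ d₂ d₃ b₁ b₂ K (-θ₁) (-θ₂) a₁ a₂ =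
      d₁ (d₁ a₁ + θ₁ * a₂) + b₁ * (d₁ a₁ + θ₁ * a₂) + θ₁ * (d₁ a₂ - θ₁ * a₁)
        + (d₂ (d₂ a₁ + θ₂ * a₂) + b₂ * (d₂ a₁ + θ₂ * a₂) + θ₂ * (d₂ a₂ - θ₂ * a₁))
        + d₃ (d₃ a₁) + K * a₁ := by
  simp only [jacobi, neg_mul, sub_neg_eq_add, ← sub_eq_add_neg]

variable {E F : Type*} [NormedAddCommGroup E] [NormedSpace ℝ E]
  [NormedAddCommGroup F] [NormedSpace ℝ F]

namespace IsAdaptedFrame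

/-- The first component of the covariant derivative of `v₀ ε₀ + v₁ ε₁` along the frame. -/
def covFst (g' : F → F →L[ℝ] F →L[ℝ] ℝ) (Γ' : F → F →L[ℝ] F →L[ℝ] F) (ψ : E → F)
    (ε : Fin 2 → F → F) (e : Fin 3 → E → E) (i : Fin 3) (v₀ v₁ : E → ℝ) (w : E) : ℝ :=
  fderiv ℝ v₀ w (e i w) - thetaFun g' Γ' ψ ε i w * v₁ w

/-- The second component of the covariant derivative of `v₀ ε₀ + v₁ ε₁` along the frame. -/
def covSnd (g' : F → F →L[ℝ] F →L[ℝ] ℝ) (Γ' : F → F →L[ℝ] F →L[ℝ] F) (ψ : E → F)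
    (ε : Fin 2 → F → F) (e : Fin 3 → E → E) (i : Fin 3) (v₀ v₁ : E → ℝ) (w : E) : ℝ :=
  fderiv ℝ v₁ w (e i w) + thetaFun g' Γ' ψ ε i w * v₀ w

variable {U : TopologicalSpace.Opens E} {g : E → E →L[ℝ] E →L[ℝ] ℝ} {Γ : E → E →L[ℝ] E →L[ℝ] E}
  {U' : Set F} {g' : F → F →L[ℝ] F →L[ℝ] ℝ} {Γ' : F → F →L[ℝ] F →L[ℝ] F} {ψ : E → F}
  {e : Fin 3 → E → E} {ε : Fin 2 → F → F} (H : IsAdaptedFrame U g Γ U' g' Γ' ψ e ε)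

include H in
theorem contDiffOn_covFst {v₀ v₁ : E → ℝ} (h₀ : ContDiffOn ℝ ∞ v₀ U) (h₁ : ContDiffOn ℝ ∞ v₁ U)
    (i : Fin 3) : ContDiffOn ℝ ∞ (covFst g' Γ' ψ ε e i v₀ v₁) U :=
  ((contDiffOn_fderiv U.isOpen h₀).clm_apply (H.frame.contDiffOn i)).sub
    ((H.contDiffOn_thetaFun i).mul h₁)

include H in
theorem contDiffOn_covSnd {v₀ v₁ : E → ℝ} (h₀ : ContDiffOn ℝ ∞ v₀ U) (h₁ : ContDiffOn ℝ ∞ v₁ U)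
    (i : Fin 3) : ContDiffOn ℝ ∞ (covSnd g' Γ' ψ ε e i v₀ v₁) U :=
  ((contDiffOn_fderiv U.isOpen h₁).clm_apply (H.frame.contDiffOn i)).add
    ((H.contDiffOn_thetaFun i).mul h₀)

/-- The first component of the Jacobi operator of the submersion. -/
def jacFst (a₀ a₁ : SmoothFun U) : SmoothFun U :=
  jacobi (H.frame.der 0) (H.frame.der 1) (H.frame.der 2) (H.theta 1 - H.kappa 0)
    (-(H.kappa 1 + H.theta 0)) (H.frame.der 1 (H.theta 0) - H.frame.der 0 (H.theta 1)
      - H.theta 0 ^ 2 - H.theta 1 ^ 2) (H.theta 0) (H.theta 1) a₀ a₁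

/-- The second component of the Jacobi operator of the submersion. -/
def jacSnd (a₀ a₁ : SmoothFun U) : SmoothFun U :=
  jacobi (H.frame.der 0) (H.frame.der 1) (H.frame.der 2) (H.theta 1 - H.kappa 0)
    (-(H.kappa 1 + H.theta 0)) (H.frame.der 1 (H.theta 0) - H.frame.der 0 (H.theta 1)
      - H.theta 0 ^ 2 - H.theta 1 ^ 2) (-H.theta 0) (-H.theta 1) a₁ a₀

theorem der_mk {v : E → ℝ} (hv : ContDiffOn ℝ ∞ v U) (i : Fin 3) :
    H.frame.der i (SmoothFun.mk v hv) = SmoothFun.mk (fun w ↦ fderiv ℝ v w (e i w))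
      (SmoothFun.contDiffOn_fderiv_apply hv (H.frame.contDiffOn i)) :=
  SmoothFun.deriv_mk _ hv

theorem jacFst_apply {v₀ v₁ : E → ℝ} (h₀ : ContDiffOn ℝ ∞ v₀ U) (h₁ : ContDiffOn ℝ ∞ v₁ U)
    (u : U) : (H.jacFst (SmoothFun.mk v₀ h₀) (SmoothFun.mk v₁ h₁) : U → ℝ) u =
      fderiv ℝ (covFst g' Γ' ψ ε e 0 v₀ v₁) u (e 0 u)
        + (thetaFun g' Γ' ψ ε 1 u - connCoeff g Γ e 2 2 0 u) * covFst g' Γ' ψ ε e 0 v₀ v₁ u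
        - thetaFun g' Γ' ψ ε 0 u * covSnd g' Γ' ψ ε e 0 v₀ v₁ u
      + (fderiv ℝ (covFst g' Γ' ψ ε e 1 v₀ v₁) u (e 1 u)
        + -(connCoeff g Γ e 2 2 1 u + thetaFun g' Γ' ψ ε 0 u) * covFst g' Γ' ψ ε e 1 v₀ v₁ u
        - thetaFun g' Γ' ψ ε 1 u * covSnd g' Γ' ψ ε e 1 v₀ v₁ u)
      + fderiv ℝ (fun w ↦ fderiv ℝ v₀ w (e 2 w)) u (e 2 u)
      + (fderiv ℝ (thetaFun g' Γ' ψ ε 0) u (e 1 u) - fderiv ℝ (thetaFun g' Γ' ψ ε 1) u (e 0 u)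
        - thetaFun g' Γ' ψ ε 0 u ^ 2 - thetaFun g' Γ' ψ ε 1 u ^ 2) * v₀ u := by
  have e0 : H.frame.der 0 (SmoothFun.mk v₀ h₀) - H.theta 0 * SmoothFun.mk v₁ h₁ =
      SmoothFun.mk _ (H.contDiffOn_covFst h₀ h₁ 0) := by rw [H.der_mk]; rfl
  have e1 : H.frame.der 1 (SmoothFun.mk v₀ h₀) - H.theta 1 * SmoothFun.mk v₁ h₁ =
      SmoothFun.mk _ (H.contDiffOn_covFst h₀ h₁ 1) := by rw [H.der_mk]; rfl
  have f0 : H.frame.der 0 (SmoothFun.mk v₁ h₁) + H.theta 0 * SmoothFun.mk v₀ h₀ =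
      SmoothFun.mk _ (H.contDiffOn_covSnd h₀ h₁ 0) := by rw [H.der_mk]; rfl
  have f1 : H.frame.der 1 (SmoothFun.mk v₁ h₁) + H.theta 1 * SmoothFun.mk v₀ h₀ =
      SmoothFun.mk _ (H.contDiffOn_covSnd h₀ h₁ 1) := by rw [H.der_mk]; rfl
  rw [jacFst, jacobi, e0, e1, f0, f1, H.der_mk, H.der_mk, H.der_mk, H.der_mk]
  have t0 : H.frame.der 1 (H.theta 0) = _ := H.der_mk (H.contDiffOn_theta 0) 1
  have t1 : H.frame.der 0 (H.theta 1) = _ := H.der_mk (H.contDiffOn_theta 1) 0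
  rw [t0, t1]
  rfl

theorem jacSnd_apply {v₀ v₁ : E → ℝ} (h₀ : ContDiffOn ℝ ∞ v₀ U) (h₁ : ContDiffOn ℝ ∞ v₁ U)
    (u : U) : (H.jacSnd (SmoothFun.mk v₀ h₀) (SmoothFun.mk v₁ h₁) : U → ℝ) u =
      fderiv ℝ (covSnd g' Γ' ψ ε e 0 v₀ v₁) u (e 0 u)
        + (thetaFun g' Γ' ψ ε 1 u - connCoeff g Γ e 2 2 0 u) * covSnd g' Γ' ψ ε e 0 v₀ v₁ u
        + thetaFun g' Γ' ψ ε 0 u * covFst g' Γ' ψ ε e 0 v₀ v₁ u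
      + (fderiv ℝ (covSnd g' Γ' ψ ε e 1 v₀ v₁) u (e 1 u)
        + -(connCoeff g Γ e 2 2 1 u + thetaFun g' Γ' ψ ε 0 u) * covSnd g' Γ' ψ ε e 1 v₀ v₁ u
        + thetaFun g' Γ' ψ ε 1 u * covFst g' Γ' ψ ε e 1 v₀ v₁ u)
      + fderiv ℝ (fun w ↦ fderiv ℝ v₁ w (e 2 w)) u (e 2 u)
      + (fderiv ℝ (thetaFun g' Γ' ψ ε 0) u (e 1 u) - fderiv ℝ (thetaFun g' Γ' ψ ε 1) u (e 0 u)
        - thetaFun g' Γ' ψ ε 0 u ^ 2 - thetaFun g' Γ' ψ ε 1 u ^ 2) * v₁ u := by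
  have e0 : H.frame.der 0 (SmoothFun.mk v₀ h₀) - H.theta 0 * SmoothFun.mk v₁ h₁ =
      SmoothFun.mk _ (H.contDiffOn_covFst h₀ h₁ 0) := by rw [H.der_mk]; rfl
  have e1 : H.frame.der 1 (SmoothFun.mk v₀ h₀) - H.theta 1 * SmoothFun.mk v₁ h₁ =
      SmoothFun.mk _ (H.contDiffOn_covFst h₀ h₁ 1) := by rw [H.der_mk]; rfl
  have f0 : H.frame.der 0 (SmoothFun.mk v₁ h₁) + H.theta 0 * SmoothFun.mk v₀ h₀ =
      SmoothFun.mk _ (H.contDiffOn_covSnd h₀ h₁ 0) := by rw [H.der_mk]; rfl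
  have f1 : H.frame.der 1 (SmoothFun.mk v₁ h₁) + H.theta 1 * SmoothFun.mk v₀ h₀ =
      SmoothFun.mk _ (H.contDiffOn_covSnd h₀ h₁ 1) := by rw [H.der_mk]; rfl
  rw [jacSnd, jacobi_neg, e0, e1, f0, f1, H.der_mk, H.der_mk, H.der_mk, H.der_mk]
  have t0 : H.frame.der 1 (H.theta 0) = _ := H.der_mk (H.contDiffOn_theta 0) 1
  have t1 : H.frame.der 0 (H.theta 1) = _ := H.der_mk (H.contDiffOn_theta 1) 0
  rw [t0, t1]
  rfl

include H in
-- The sum of the `∇_{e i} e i` produces the first-order coefficients `θ₁ - κ₀` and `-(κ₁ + θ₀)`,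
-- the divergences of the two horizontal fields. The curvature term sees only the horizontal
-- directions and is multiplication by the curvature of the base.
theorem sum_covAlong_eq {v₀ v₁ : E → ℝ} (h₀ : ContDiffOn ℝ ∞ v₀ U) (h₁ : ContDiffOn ℝ ∞ v₁ U)
    {V : E → F} (hV : ∀ w ∈ U, V w = secAlong ε ψ v₀ v₁ w) (u : U) :
    ∑ i, (covAlong Γ' ψ (e i) (covAlong Γ' ψ (e i) V) u - covAlong Γ' ψ (cov Γ (e i) (e i)) V u
      + curv Γ' (ψ u) (V u) (fderiv ℝ ψ u (e i u)) (fderiv ℝ ψ u (e i u))) =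
    (H.jacFst (SmoothFun.mk v₀ h₀) (SmoothFun.mk v₁ h₁) : U → ℝ) u • ε 0 (ψ u)
      + (H.jacSnd (SmoothFun.mk v₀ h₀) (SmoothFun.mk v₁ h₁) : U → ℝ) u • ε 1 (ψ u) := by
  have hc : ∀ i, ∀ w ∈ U, covAlong Γ' ψ (e i) V w =
      secAlong ε ψ (covFst g' Γ' ψ ε e i v₀ v₁) (covSnd g' Γ' ψ ε e i v₀ v₁) w := fun i w hw ↦ by
    rw [covAlong_congr U.isOpen Γ' ψ (e i) hV hw, H.covAlong_secAlong hw h₀ h₁ i]; rfl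
  have hcc : ∀ i, covAlong Γ' ψ (e i) (covAlong Γ' ψ (e i) V) u = _ := fun i ↦
    (covAlong_congr U.isOpen Γ' ψ (e i) (hc i) u.2).trans
      (H.covAlong_secAlong u.2 (H.contDiffOn_covFst h₀ h₁ i) (H.contDiffOn_covSnd h₀ h₁ i) i)
  have hcv : ∀ i, covAlong Γ' ψ (cov Γ (e i) (e i)) V u =
      ∑ k, connCoeff g Γ e i i k u • covAlong Γ' ψ (e k) V u := fun i ↦
    covAlong_eq_sum Γ' ψ V (H.frame.cov_eq_sum H.metric u.2 i i)
  have g0 := H.connCoeff_eq u.2 0 0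
  have g1 := H.connCoeff_eq u.2 1 1
  have g00 := g0 0
  have g01 := g0 1
  have g02 := g0 2
  have g10 := g1 0
  have g11 := g1 1
  have g12 := g1 2
  have g22 := H.frame.connCoeff_self H.metric u.2 2 2
  simp only [connTable, Fin.isValue, Matrix.cons_val] at g00 g01 g02 g10 g11 g12
  have k0 : fderiv ℝ ψ u (e 0 u) = ε 0 (ψ u) := H.fderiv_castSucc u.2 0
  have k1 : fderiv ℝ ψ u (e 1 u) = ε 1 (ψ u) := H.fderiv_castSucc u.2 1
  have k2 : fderiv ℝ ψ u (e 2 u) = 0 := H.fderiv_last u.2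
  have hR := H.sum_curv_eq u.2 (v₀ u) (v₁ u)
  have hR0 : curv Γ' (ψ u) (V u) 0 0 = 0 := by simp [curv]
  have hVu : V u = v₀ u • ε 0 (ψ u) + v₁ u • ε 1 (ψ u) := hV u u.2
  have z2 : thetaFun g' Γ' ψ ε 2 = fun _ ↦ 0 := rfl
  have c2 : covFst g' Γ' ψ ε e 2 v₀ v₁ = fun w ↦ fderiv ℝ v₀ w (e 2 w) := by
    funext w; simp [covFst, z2]
  have s2 : covSnd g' Γ' ψ ε e 2 v₀ v₁ = fun w ↦ fderiv ℝ v₁ w (e 2 w) := by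
    funext w; simp [covSnd, z2]
  rw [H.jacFst_apply, H.jacSnd_apply]
  simp only [Fin.sum_univ_three, hcc, hcv, g00, g01, g02, g10, g11, g12, g22, zero_smul, zero_add,
    add_zero, k0, k1, k2, hR0, hc _ _ u.2]
  rw [hVu, ← c2, ← s2]
  rw [← sub_eq_zero] at hR ⊢
  refine Eq.trans ?_ hR
  simp only [secAlong, z2, thetaFun, Matrix.cons_val, Fin.isValue]
  module

/-- The first variation of the squared norm of the tension field. -/
theorem hasDerivAt_norm_sq_tension {v₀ v₁ : E → ℝ} (h₀ : ContDiffOn ℝ ∞ v₀ U)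
    (h₁ : ContDiffOn ℝ ∞ v₁ U) {V : E → F} (hV : ∀ w ∈ U, V w = secAlong ε ψ v₀ v₁ w) (u : U) :
    HasDerivAt (fun s : ℝ ↦ g' (ψ u + s • V u)
        (∑ i, sff Γ Γ' (fun w ↦ ψ w + s • V w) u (e i u) (e i u))
        (∑ i, sff Γ Γ' (fun w ↦ ψ w + s • V w) u (e i u) (e i u)))
      (-2 * ((H.jacFst (SmoothFun.mk v₀ h₀) (SmoothFun.mk v₁ h₁) * H.kappa 0
        + H.jacSnd (SmoothFun.mk v₀ h₀) (SmoothFun.mk v₁ h₁) * H.kappa 1 : SmoothFun U) :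
          U → ℝ) u) 0 := by
  have hy := H.mapsTo u.2
  have hVs : ContDiffOn ℝ ∞ V U := (H.contDiffOn_secAlong h₀ h₁).congr hV
  have d1 := HasDerivAt.fun_sum fun i (_ : i ∈ Finset.univ) ↦ hasDerivAt_sff_add_smul U.isOpen Γ
    H.smooth hVs u.2 (H.metric'.differentiableAt_chr hy) (e i u) (e i u)
  have d2 := hasDerivAt_comp_line (W := F →L[ℝ] F →L[ℝ] ℝ) (H.metric'.differentiableAt hy) (V u)
  have d3 := (d2.clm_apply d1).clm_apply d1
  have hs := Finset.sum_congr rfl fun i (_ : i ∈ Finset.univ) ↦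
    variation_sff_eq U.isOpen Γ H.metric' H.smooth H.mapsTo hVs (H.frame.contDiffOn i) u.2
  rw [H.sum_covAlong_eq h₀ h₁ hV u, Finset.sum_add_distrib, ← map_sum, H.sum_sff_eq u.2] at hs
  have h0 : (fun w ↦ ψ w + (0 : ℝ) • V w) = ψ := by funext w; simp
  simp only [h0, zero_smul, add_zero, H.sum_sff_eq u.2] at d3
  refine d3.congr_deriv ?_
  set T' := ∑ i, (fderiv ℝ (fderiv ℝ V) u (e i u) (e i u) - fderiv ℝ V u (Γ u (e i u) (e i u))
    + (fderiv ℝ Γ' (ψ u) (V u) (fderiv ℝ ψ u (e i u)) (fderiv ℝ ψ u (e i u))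
      + Γ' (ψ u) (fderiv ℝ V u (e i u)) (fderiv ℝ ψ u (e i u))
      + Γ' (ψ u) (fderiv ℝ ψ u (e i u)) (fderiv ℝ V u (e i u)))) with hT'
  set T := secAlong ε ψ (fun w ↦ - connCoeff g Γ e 2 2 0 w) (fun w ↦ - connCoeff g Γ e 2 2 1 w) u
    with hT
  have hT2 : T' = (H.jacFst (SmoothFun.mk v₀ h₀) (SmoothFun.mk v₁ h₁) : U → ℝ) u • ε 0 (ψ u)
      + (H.jacSnd (SmoothFun.mk v₀ h₀) (SmoothFun.mk v₁ h₁) : U → ℝ) u • ε 1 (ψ u)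
      - Γ' (ψ u) (V u) T := by rw [← hs]; abel
  -- Metric compatibility absorbs the derivative of `g'` into the covariant derivative `T' + Γ'(V,
  -- T)` of the tension.
  have hfin : fderiv ℝ g' (ψ u) (V u) T T + g' (ψ u) T' T + g' (ψ u) T T' =
      2 * g' (ψ u) (T' + Γ' (ψ u) (V u) T) T := by
    rw [H.metric'.compat hy, H.metric'.symm _ hy T, H.metric'.symm _ hy T T']
    simp only [map_add, add_apply]
    ring
  have hinn := H.frame'.inner _ hy
  have hg : g' (ψ u) (T' + Γ' (ψ u) (V u) T) T =
      -((H.jacFst (SmoothFun.mk v₀ h₀) (SmoothFun.mk v₁ h₁) : U → ℝ) u * connCoeff g Γ e 2 2 0 u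
      + (H.jacSnd (SmoothFun.mk v₀ h₀) (SmoothFun.mk v₁ h₁) : U → ℝ) u *
        connCoeff g Γ e 2 2 1 u) := by
    rw [hT2, sub_add_cancel, hT, secAlong]
    simp only [map_add, add_apply, (g' (ψ u)).map_smul, smul_apply, map_smul, hinn, smul_eq_mul]
    simp
    ring
  have hk : ((H.jacFst (SmoothFun.mk v₀ h₀) (SmoothFun.mk v₁ h₁) * H.kappa 0
        + H.jacSnd (SmoothFun.mk v₀ h₀) (SmoothFun.mk v₁ h₁) * H.kappa 1 : SmoothFun U) :
          U → ℝ) u = (H.jacFst (SmoothFun.mk v₀ h₀) (SmoothFun.mk v₁ h₁) : U → ℝ) u *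
            connCoeff g Γ e 2 2 0 u
      + (H.jacSnd (SmoothFun.mk v₀ h₀) (SmoothFun.mk v₁ h₁) : U → ℝ) u *
        connCoeff g Γ e 2 2 1 u := rfl
  rw [hk]
  simp only [add_apply]
  rw [hfin, hg]
  ring

end IsAdaptedFrame

end Jacobi

/-! ### Self-adjointness of the Jacobi operator and the Euler-Lagrange equation. -/

section Green

namespace IsAdaptedFrame

/-- The components of the vector field `⟨∇v, a⟩ - ⟨v, ∇a⟩` for `v = v₀ ε₀ + v₁ ε₁` and
`a = a₀ ε₀ + a₁ ε₁`. -/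
def greenFun {E F : Type*} [NormedAddCommGroup E] [NormedSpace ℝ E]
    [NormedAddCommGroup F] [NormedSpace ℝ F]
    (g' : F → F →L[ℝ] F →L[ℝ] ℝ) (Γ' : F → F →L[ℝ] F →L[ℝ] F) (ψ : E → F)
    (ε : Fin 2 → F → F) (e : Fin 3 → E → E) (i : Fin 3) (v₀ v₁ a₀ a₁ : E → ℝ) (w : E) : ℝ :=
  covFst g' Γ' ψ ε e i v₀ v₁ w * a₀ w + covSnd g' Γ' ψ ε e i v₀ v₁ w * a₁ w
    - (v₀ w * covFst g' Γ' ψ ε e i a₀ a₁ w + v₁ w * covSnd g' Γ' ψ ε e i a₀ a₁ w)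

section

variable {E F : Type*} [NormedAddCommGroup E] [NormedSpace ℝ E]
  [NormedAddCommGroup F] [NormedSpace ℝ F]
  {U : TopologicalSpace.Opens E} {g : E → E →L[ℝ] E →L[ℝ] ℝ} {Γ : E → E →L[ℝ] E →L[ℝ] E}
  {U' : Set F} {g' : F → F →L[ℝ] F →L[ℝ] ℝ} {Γ' : F → F →L[ℝ] F →L[ℝ] F} {ψ : E → F}
  {e : Fin 3 → E → E} {ε : Fin 2 → F → F} (H : IsAdaptedFrame U g Γ U' g' Γ' ψ e ε)
  {v₀ v₁ a₀ a₁ : E → ℝ} (hv₀ : ContDiffOn ℝ ∞ v₀ U) (hv₁ : ContDiffOn ℝ ∞ v₁ U)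
  (ha₀ : ContDiffOn ℝ ∞ a₀ U) (ha₁ : ContDiffOn ℝ ∞ a₁ U)

include H hv₀ hv₁ ha₀ ha₁

theorem contDiffOn_greenFun (i : Fin 3) :
    ContDiffOn ℝ ∞ (greenFun g' Γ' ψ ε e i v₀ v₁ a₀ a₁) U :=
  (((H.contDiffOn_covFst hv₀ hv₁ i).mul ha₀).add ((H.contDiffOn_covSnd hv₀ hv₁ i).mul ha₁)).sub
    ((hv₀.mul (H.contDiffOn_covFst ha₀ ha₁ i)).add (hv₁.mul (H.contDiffOn_covSnd ha₀ ha₁ i)))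

/-- Ordinary derivatives of `v` and `a` are rewritten through covariant ones; the products of two
covariant derivatives then cancel, as in Green's identity. -/
theorem fderiv_greenFun (i : Fin 3) (u : U) :
    fderiv ℝ (greenFun g' Γ' ψ ε e i v₀ v₁ a₀ a₁) u (e i u) =
      fderiv ℝ (covFst g' Γ' ψ ε e i v₀ v₁) u (e i u) * a₀ u
      + fderiv ℝ (covSnd g' Γ' ψ ε e i v₀ v₁) u (e i u) * a₁ u
      - v₀ u * fderiv ℝ (covFst g' Γ' ψ ε e i a₀ a₁) u (e i u)
      - v₁ u * fderiv ℝ (covSnd g' Γ' ψ ε e i a₀ a₁) u (e i u)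
      + thetaFun g' Γ' ψ ε i u * (covFst g' Γ' ψ ε e i v₀ v₁ u * a₁ u
        - covSnd g' Γ' ψ ε e i v₀ v₁ u * a₀ u - v₁ u * covFst g' Γ' ψ ε e i a₀ a₁ u
        + v₀ u * covSnd g' Γ' ψ ε e i a₀ a₁ u) := by
  have dd : ∀ {f : E → ℝ}, ContDiffOn ℝ ∞ f U → HasFDerivAt f (fderiv ℝ f u) u := fun hf ↦
    (ContDiffOn.differentiableAt_of_isOpen U.isOpen hf u.2).hasFDerivAt
  have h := (((dd (H.contDiffOn_covFst hv₀ hv₁ i)).mul (dd ha₀)).add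
    ((dd (H.contDiffOn_covSnd hv₀ hv₁ i)).mul (dd ha₁))).sub
    (((dd hv₀).mul (dd (H.contDiffOn_covFst ha₀ ha₁ i))).add
      ((dd hv₁).mul (dd (H.contDiffOn_covSnd ha₀ ha₁ i))))
  have h1 : fderiv ℝ (greenFun g' Γ' ψ ε e i v₀ v₁ a₀ a₁) u = _ := h.fderiv
  rw [h1]
  simp only [add_apply, sub_apply, smul_apply, smul_eq_mul]
  have e0 : ∀ v₀ v₁ : E → ℝ, fderiv ℝ v₀ u (e i u) =
      covFst g' Γ' ψ ε e i v₀ v₁ u + thetaFun g' Γ' ψ ε i u * v₁ u := fun _ _ ↦ by simp [covFst]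
  have e1 : ∀ v₀ v₁ : E → ℝ, fderiv ℝ v₁ u (e i u) =
      covSnd g' Γ' ψ ε e i v₀ v₁ u - thetaFun g' Γ' ψ ε i u * v₀ u := fun _ _ ↦ by simp [covSnd]
  rw [e0 v₀ v₁, e0 a₀ a₁, e1 v₀ v₁, e1 a₀ a₁]
  ring

/-- Green's identity for the Jacobi operator. -/
theorem jac_mul_sub_mul_jac (u : U) :
    (H.jacFst (SmoothFun.mk v₀ hv₀) (SmoothFun.mk v₁ hv₁) : U → ℝ) u * a₀ u
      + (H.jacSnd (SmoothFun.mk v₀ hv₀) (SmoothFun.mk v₁ hv₁) : U → ℝ) u * a₁ u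
      - (v₀ u * (H.jacFst (SmoothFun.mk a₀ ha₀) (SmoothFun.mk a₁ ha₁) : U → ℝ) u
        + v₁ u * (H.jacSnd (SmoothFun.mk a₀ ha₀) (SmoothFun.mk a₁ ha₁) : U → ℝ) u) =
    ∑ i, (fderiv ℝ (greenFun g' Γ' ψ ε e i v₀ v₁ a₀ a₁) u (e i u)
      + (∑ j, connCoeff g Γ e j i j u) * greenFun g' Γ' ψ ε e i v₀ v₁ a₀ a₁ u) := by
  have g00 := H.connCoeff_eq u.2 0 0 0
  have g10 := H.connCoeff_eq u.2 1 0 1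
  have g20 := H.connCoeff_eq u.2 2 0 2
  have g01 := H.connCoeff_eq u.2 0 1 0
  have g11 := H.connCoeff_eq u.2 1 1 1
  have g21 := H.connCoeff_eq u.2 2 1 2
  have g02 := H.connCoeff_eq u.2 0 2 0
  have g12 := H.connCoeff_eq u.2 1 2 1
  have g22 := H.frame.connCoeff_self H.metric u.2 2 2
  simp only [connTable, Fin.isValue, Matrix.cons_val, Fin.castSucc_zero, Fin.castSucc_one]
    at g00 g01 g02 g10 g11 g12 g20 g21
  have z2 : thetaFun g' Γ' ψ ε 2 = fun _ ↦ 0 := rfl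
  have c2 : ∀ v₀ v₁, (fun w ↦ fderiv ℝ v₀ w (e 2 w)) = covFst g' Γ' ψ ε e 2 v₀ v₁ :=
    fun _ _ ↦ by funext w; simp [covFst, z2]
  have s2 : ∀ v₀ v₁, (fun w ↦ fderiv ℝ v₁ w (e 2 w)) = covSnd g' Γ' ψ ε e 2 v₀ v₁ :=
    fun _ _ ↦ by funext w; simp [covSnd, z2]
  simp only [Fin.sum_univ_three, H.fderiv_greenFun hv₀ hv₁ ha₀ ha₁, H.jacFst_apply, H.jacSnd_apply,
    g00, g01, g02, g10, g11, g12, g20, g21, g22, c2 v₀ v₁, c2 a₀ a₁, s2 v₀ v₁, s2 a₀ a₁]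
  simp only [greenFun, z2]
  simp only [thetaFun, Matrix.cons_val, Fin.isValue]
  ring

end

variable {F : Type*} [NormedAddCommGroup F] [NormedSpace ℝ F]
  {U : TopologicalSpace.Opens (EuclideanSpace ℝ (Fin 3))}
  {A : EuclideanSpace ℝ (Fin 3) → Matrix (Fin 3) (Fin 3) ℝ} {ρ : EuclideanSpace ℝ (Fin 3) → ℝ}
  {Γ : EuclideanSpace ℝ (Fin 3) → EuclideanSpace ℝ (Fin 3) →L[ℝ]
    EuclideanSpace ℝ (Fin 3) →L[ℝ] EuclideanSpace ℝ (Fin 3)}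
  {U' : Set F} {g' : F → F →L[ℝ] F →L[ℝ] ℝ} {Γ' : F → F →L[ℝ] F →L[ℝ] F}
  {ψ : EuclideanSpace ℝ (Fin 3) → F}
  {e : Fin 3 → EuclideanSpace ℝ (Fin 3) → EuclideanSpace ℝ (Fin 3)} {ε : Fin 2 → F → F}
  (H : IsAdaptedFrame U (fun u ↦ bil (A u)) Γ U' g' Γ' ψ e ε)
  (hρ : ContDiffOn ℝ ∞ ρ U) (hρA : ∀ u ∈ U, ρ u ^ 2 = (A u).det)

include H hρ hρA

/-- The Jacobi operator is formally self-adjoint. -/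
theorem integral_jac_eq {v₀ v₁ a₀ a₁ : EuclideanSpace ℝ (Fin 3) → ℝ}
    (hv₀ : ContDiffOn ℝ ∞ v₀ U) (hv₁ : ContDiffOn ℝ ∞ v₁ U)
    (ha₀ : ContDiffOn ℝ ∞ a₀ U) (ha₁ : ContDiffOn ℝ ∞ a₁ U)
    {K : Set (EuclideanSpace ℝ (Fin 3))} (hK : IsCompact K) (hKU : K ⊆ U)
    (h₀ : ∀ u ∉ K, v₀ u = 0) (h₁ : ∀ u ∉ K, v₁ u = 0)
    {P Q : EuclideanSpace ℝ (Fin 3) → ℝ} (hP : ContDiffOn ℝ ∞ P U) (hQ : ContDiffOn ℝ ∞ Q U)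
    (hPv : ∀ u : U, P u =
      (H.jacFst (SmoothFun.mk v₀ hv₀) (SmoothFun.mk v₁ hv₁) : U → ℝ) u * a₀ u
      + (H.jacSnd (SmoothFun.mk v₀ hv₀) (SmoothFun.mk v₁ hv₁) : U → ℝ) u * a₁ u)
    (hQv : ∀ u : U, Q u =
      v₀ u * (H.jacFst (SmoothFun.mk a₀ ha₀) (SmoothFun.mk a₁ ha₁) : U → ℝ) u
      + v₁ u * (H.jacSnd (SmoothFun.mk a₀ ha₀) (SmoothFun.mk a₁ ha₁) : U → ℝ) u) :
    ∫ u in K, ρ u * P u = ∫ u in K, ρ u * Q u := by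
  have hd : ∀ {v : EuclideanSpace ℝ (Fin 3) → ℝ}, (∀ u ∉ K, v u = 0) → ∀ u ∉ K,
      fderiv ℝ v u = 0 := fun hv u hu ↦ by
    have : _ =ᶠ[nhds u] fun _ ↦ (0 : ℝ) :=
      Filter.eventuallyEq_of_mem (hK.isClosed.isOpen_compl.mem_nhds hu) fun w hw ↦ hv w hw
    rw [this.fderiv_eq]; simp
  have hf0 : ∀ i, ∀ u ∉ K, greenFun g' Γ' ψ ε e i v₀ v₁ a₀ a₁ u = 0 := fun i u hu ↦ by
    simp [greenFun, covFst, covSnd, h₀ u hu, h₁ u hu, hd h₀ u hu, hd h₁ u hu]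
  have hI := fun i ↦ integral_frame_divergence H.metric hρ hρA H.frame
    (H.contDiffOn_greenFun hv₀ hv₁ ha₀ ha₁ i) hK hKU (hf0 i) i
  have i1 : ∀ {f : EuclideanSpace ℝ (Fin 3) → ℝ}, ContDiffOn ℝ ∞ f U →
      IntegrableOn (fun u ↦ ρ u * f u) K := fun hf ↦
    ((hρ.mul hf).continuousOn.mono hKU).integrableOn_compact hK
  rw [← sub_eq_zero, ← integral_sub (i1 hP) (i1 hQ)]
  have hS := integral_finsetSum (μ := volume.restrict K) Finset.univ fun i _ ↦ (hI i).1
  simp only [(hI _).2, Finset.sum_const_zero] at hS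
  rw [← hS]
  refine setIntegral_congr_fun hK.measurableSet fun u hu ↦ ?_
  have := H.jac_mul_sub_mul_jac hv₀ hv₁ ha₀ ha₁ ⟨u, hKU hu⟩
  rw [← hPv ⟨u, hKU hu⟩, ← hQv ⟨u, hKU hu⟩] at this
  change ρ u * P u - ρ u * Q u = _
  rw [← mul_sub, this, Finset.mul_sum]

omit hρA in
/-- The fundamental lemma of the calculus of variations with a positive weight. -/
theorem eq_zero_of_integral {f : SmoothFun U} (hρpos : ∀ u ∈ U, 0 < ρ u)
    (h : ∀ v : EuclideanSpace ℝ (Fin 3) → ℝ, ContDiff ℝ ∞ v → HasCompactSupport v →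
      tsupport v ⊆ U → ∀ P : EuclideanSpace ℝ (Fin 3) → ℝ, (∀ u : U, P u = (f : U → ℝ) u) →
        ContDiffOn ℝ ∞ P U → ∫ u, v u * (ρ u * P u) = 0) : f = 0 := by
  obtain ⟨P, hP, rfl⟩ := SmoothFun.exists_eq_mk f
  have hc : ContinuousOn (fun u ↦ ρ u * P u) U := (hρ.mul hP).continuousOn
  have h1 := U.isOpen.ae_eq_zero_of_integral_contDiff_smul_eq_zero (μ := volume)
    (hc.locallyIntegrableOn U.isOpen.measurableSet)
    fun v hv hvc hvs ↦ by simpa using h v hv hvc hvs P (fun _ ↦ rfl) hP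
  have h2 : (fun u ↦ ρ u * P u) =ᵐ[volume.restrict U] fun _ ↦ 0 :=
    (ae_restrict_iff' U.isOpen.measurableSet).2 h1
  have h3 := Measure.eqOn_open_of_ae_eq h2 U.isOpen hc continuousOn_const
  exact SmoothFun.ext_apply fun u ↦ (mul_eq_zero.1 (h3 u.2)).resolve_left (hρpos u u.2).ne'

omit hρ hρA in
/-- The Euler-Lagrange equation of the bienergy: the mean curvature is a Jacobi field. -/
theorem jac_kappa_eq_zero (hρ : ContDiffOn ℝ ∞ ρ U) (hρA : ∀ u ∈ U, ρ u ^ 2 = (A u).det)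
    (hρpos : ∀ u ∈ U, 0 < ρ u)
    (hvar : ∀ v₀ v₁ : EuclideanSpace ℝ (Fin 3) → ℝ, ∀ (h₀ : ContDiff ℝ ∞ v₀)
      (h₁ : ContDiff ℝ ∞ v₁), HasCompactSupport v₀ → tsupport v₀ ⊆ U → HasCompactSupport v₁ →
      tsupport v₁ ⊆ U → ∃ K, IsCompact K ∧ K ⊆ U ∧ (∀ u ∉ K, v₀ u = 0) ∧ (∀ u ∉ K, v₁ u = 0) ∧
        ∀ P : EuclideanSpace ℝ (Fin 3) → ℝ, ContDiffOn ℝ ∞ P U → (∀ u : U, P u =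
          ((H.jacFst (SmoothFun.mk v₀ h₀.contDiffOn) (SmoothFun.mk v₁ h₁.contDiffOn) * H.kappa 0
            + H.jacSnd (SmoothFun.mk v₀ h₀.contDiffOn) (SmoothFun.mk v₁ h₁.contDiffOn) * H.kappa 1 :
            SmoothFun U) : U → ℝ) u) →
          ∫ u in K, ρ u * P u = 0) :
    H.jacFst (H.kappa 0) (H.kappa 1) = 0 ∧ H.jacSnd (H.kappa 0) (H.kappa 1) = 0 := by
  obtain ⟨a₀, ha₀, e₀⟩ := SmoothFun.exists_eq_mk (H.kappa 0)
  obtain ⟨a₁, ha₁, e₁⟩ := SmoothFun.exists_eq_mk (H.kappa 1)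
  have key : ∀ v₀ v₁ : EuclideanSpace ℝ (Fin 3) → ℝ, ContDiff ℝ ∞ v₀ → ContDiff ℝ ∞ v₁ →
      HasCompactSupport v₀ → tsupport v₀ ⊆ U → HasCompactSupport v₁ → tsupport v₁ ⊆ U →
      ∀ Q₀ Q₁ : EuclideanSpace ℝ (Fin 3) → ℝ, ContDiffOn ℝ ∞ Q₀ U → ContDiffOn ℝ ∞ Q₁ U →
      (∀ u : U, Q₀ u = (H.jacFst (H.kappa 0) (H.kappa 1) : U → ℝ) u) →
      (∀ u : U, Q₁ u = (H.jacSnd (H.kappa 0) (H.kappa 1) : U → ℝ) u) →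
      ∫ u, ρ u * (v₀ u * Q₀ u + v₁ u * Q₁ u) = 0 := by
    intro v₀ v₁ h₀ h₁ c₀ s₀ c₁ s₁ Q₀ Q₁ hQ₀ hQ₁ q₀ q₁
    obtain ⟨K, hK, hKU, z₀, z₁, hint⟩ := hvar v₀ v₁ h₀ h₁ c₀ s₀ c₁ s₁
    obtain ⟨P, hP, eP⟩ := SmoothFun.exists_eq_mk
      (H.jacFst (SmoothFun.mk v₀ h₀.contDiffOn) (SmoothFun.mk v₁ h₁.contDiffOn) * H.kappa 0
        + H.jacSnd (SmoothFun.mk v₀ h₀.contDiffOn) (SmoothFun.mk v₁ h₁.contDiffOn) * H.kappa 1)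
    have h := hint P hP fun u ↦ by rw [eP]; rfl
    rw [H.integral_jac_eq hρ hρA h₀.contDiffOn h₁.contDiffOn ha₀ ha₁ hK hKU z₀ z₁ hP
      (Q := fun u ↦ v₀ u * Q₀ u + v₁ u * Q₁ u)
      ((h₀.contDiffOn.mul hQ₀).add (h₁.contDiffOn.mul hQ₁)) ?_ ?_] at h
    · rwa [setIntegral_eq_integral_of_forall_compl_eq_zero] at h
      intro u hu
      simp [z₀ u hu, z₁ u hu]
    · intro u
      have := congrArg (fun f : SmoothFun U ↦ (f : U → ℝ) u) eP
      rw [e₀, e₁] at this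
      exact this.symm
    · intro u
      simp only [q₀, q₁, e₀, e₁]
  obtain ⟨Q₀, hQ₀, q₀⟩ := SmoothFun.exists_eq_mk (H.jacFst (H.kappa 0) (H.kappa 1))
  obtain ⟨Q₁, hQ₁, q₁⟩ := SmoothFun.exists_eq_mk (H.jacSnd (H.kappa 0) (H.kappa 1))
  have z : ContDiff ℝ ∞ fun _ : EuclideanSpace ℝ (Fin 3) ↦ (0 : ℝ) := contDiff_const
  have zs : tsupport (fun _ : EuclideanSpace ℝ (Fin 3) ↦ (0 : ℝ)) ⊆ U := by
    simp [tsupport, Function.support]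
  have zc : HasCompactSupport fun _ : EuclideanSpace ℝ (Fin 3) ↦ (0 : ℝ) := by
    simp [HasCompactSupport, tsupport, Function.support]
  constructor
  -- Test fields with a single nonzero component separate the two components of the equation.
  · refine H.eq_zero_of_integral hρ hρpos fun v hv hvc hvs P hPu hP ↦ ?_
    refine Eq.trans (integral_congr_ae (Filter.Eventually.of_forall fun u ↦ ?_))
      (key v (fun _ ↦ 0) hv z hvc hvs zc zs P Q₁ hP hQ₁ hPu fun u ↦ by rw [q₁]; rfl)
    ring
  · refine H.eq_zero_of_integral hρ hρpos fun v hv hvc hvs P hPu hP ↦ ?_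
    refine Eq.trans (integral_congr_ae (Filter.Eventually.of_forall fun u ↦ ?_))
      (key (fun _ ↦ 0) v z hv zc zs hvc hvs Q₀ P hQ₀ hP (fun u ↦ by rw [q₀]; rfl) hPu)
    ring

end IsAdaptedFrame

end Green

/-! ### Biharmonic submersions: the mean curvature of the fibres is a Jacobi field. -/

section EulerLagrange

variable {M : Type*} [TopologicalSpace M] [ChartedSpace (EuclideanSpace ℝ (Fin 3)) M]
  [IsManifold (𝓡 3) ∞ M] [RiemannianBundle (fun x : M ↦ TangentSpace (𝓡 3) x)]
  [IsContMDiffRiemannianBundle (𝓡 3) ∞ (EuclideanSpace ℝ (Fin 3))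
    (fun x : M ↦ TangentSpace (𝓡 3) x)]
  {N : Type*} [TopologicalSpace N] [ChartedSpace (EuclideanSpace ℝ (Fin 2)) N]
  [IsManifold (𝓡 2) ∞ N] [RiemannianBundle (fun y : N ↦ TangentSpace (𝓡 2) y)]
  [IsContMDiffRiemannianBundle (𝓡 2) ∞ (EuclideanSpace ℝ (Fin 2))
    (fun y : N ↦ TangentSpace (𝓡 2) y)]
  {φ : M → N} {x₀ : M} {y₀ : N} {e : Fin 3 → EuclideanSpace ℝ (Fin 3) → EuclideanSpace ℝ (Fin 3)}
  {ε : Fin 2 → EuclideanSpace ℝ (Fin 2) → EuclideanSpace ℝ (Fin 2)}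

theorem IsOrthonormalFrame.locTension_eq {U : Set (EuclideanSpace ℝ (Fin 3))}
    (he : IsOrthonormalFrame U (metricBil x₀) e)
    (f : EuclideanSpace ℝ (Fin 3) → EuclideanSpace ℝ (Fin 2)) {u : EuclideanSpace ℝ (Fin 3)}
    (hu : u ∈ U) :
    locTension x₀ y₀ f u = ∑ i, sff (chrMap x₀) (chrMap y₀) f u (e i u) (e i u) :=
  metricTrace_eq_sum_of_orthonormal (he.inner u hu) (sff_isBilinear _ _ _ _)

variable [T2Space M] [MeasurableSpace M] [BorelSpace M]

theorem IsBiharmonicMap.jac_kappa_eq_zero (hbi : IsBiharmonicMap 3 2 φ)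
    (hφ : ContMDiff (𝓡 3) (𝓡 2) ∞ φ) {U : TopologicalSpace.Opens (EuclideanSpace ℝ (Fin 3))}
    (hU : (U : Set (EuclideanSpace ℝ (Fin 3))) ⊆ locDom 3 2 φ x₀ y₀)
    {U' : Set (EuclideanSpace ℝ (Fin 2))}
    (H : IsAdaptedFrame U (metricBil x₀) (chrMap x₀) U' (metricBil y₀) (chrMap y₀)
      (locMap 3 2 φ x₀ y₀) e ε) :
    H.jacFst (H.kappa 0) (H.kappa 1) = 0 ∧ H.jacSnd (H.kappa 0) (H.kappa 1) = 0 := by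
  set ψ := locMap 3 2 φ x₀ y₀ with hψ
  have hUt : (U : Set (EuclideanSpace ℝ (Fin 3))) ⊆ (extChartAt (𝓡 3) x₀).target :=
    hU.trans (locDom_subset φ x₀ y₀)
  refine H.jac_kappa_eq_zero (A := metricMatrix x₀) ((contDiffOn_volDensity x₀).mono hUt)
    (fun u hu ↦ Real.sq_sqrt (metricMatrix_det_pos (hUt hu)).le)
    (fun u hu ↦ volDensity_pos (hUt hu)) ?_
  intro v₀ v₁ h₀ h₁ c₀ s₀ c₁ s₁
  set V := secAlong ε ψ v₀ v₁ with hV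
  set C := tsupport v₀ ∪ tsupport v₁ with hC
  have hCc : IsCompact C := c₀.isCompact.union c₁
  have hCU : C ⊆ U := Set.union_subset s₀ s₁
  have hV0 : ∀ u ∉ C, V u = 0 := fun u hu ↦ by
    rw [hC, Set.mem_union, not_or] at hu
    simp [hV, secAlong, image_eq_zero_of_notMem_tsupport hu.1,
      image_eq_zero_of_notMem_tsupport hu.2]
  have hVC : tsupport V ⊆ C :=
    closure_minimal (fun u hu ↦ by_contra fun h ↦ hu (hV0 u h)) hCc.isClosed
  have hVc : HasCompactSupport V := HasCompactSupport.intro hCc hV0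
  have hVs : ContDiff ℝ ∞ V := contDiff_iff_contDiffAt.2 fun u ↦ by
    by_cases hu : u ∈ C
    · exact (H.contDiffOn_secAlong h₀.contDiffOn h₁.contDiffOn).contDiffAt
        (U.isOpen.mem_nhds (hCU hu))
    · exact contDiffAt_const.congr_of_eventuallyEq (Filter.eventuallyEq_of_mem
        (hCc.isClosed.isOpen_compl.mem_nhds hu) fun w hw ↦ hV0 w hw)
  have hinn : ∀ u ∈ U, v₀ u = metricBil y₀ (ψ u) (V u) (ε 0 (ψ u)) ∧
      v₁ u = metricBil y₀ (ψ u) (V u) (ε 1 (ψ u)) := fun u hu ↦ by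
    simp [hV, secAlong, (metricBil y₀ (ψ u)).map_smul, H.frame'.inner _ (H.mapsTo hu)]
  -- The first variation is an integral over the support of `V`, while Green's identity needs the
  -- components to vanish off that set. On `U` they are the inner products of `V` with the frame;
  -- off `U` they vanish by assumption on their supports.
  have hz : ∀ u ∉ tsupport V, v₀ u = 0 ∧ v₁ u = 0 := fun u hu ↦ by
    by_cases h : u ∈ U
    · rw [(hinn u h).1, (hinn u h).2, image_eq_zero_of_notMem_tsupport hu]
      simp
    · exact ⟨image_eq_zero_of_notMem_tsupport fun h' ↦ h (s₀ h'),
        image_eq_zero_of_notMem_tsupport fun h' ↦ h (s₁ h')⟩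
  refine ⟨tsupport V, hVc, hVC.trans hCU, fun u hu ↦ (hz u hu).1, fun u hu ↦ (hz u hu).2,
    fun P hP hPu ↦ ?_⟩
  have h := hbi.integral_deriv_eq_zero hφ x₀ y₀ hVs hVc ((hVC.trans hCU).trans hU)
  have h2 : ∫ u in tsupport V, deriv (fun s : ℝ ↦ volDensity x₀ u *
      locBienergyDensity x₀ y₀ (fun w ↦ locMap 3 2 φ x₀ y₀ w + s • V w) u) 0 =
      ∫ u in tsupport V, -2 * (volDensity x₀ u * P u) := by
    refine setIntegral_congr_fun hVc.isCompact.measurableSet fun u huV ↦ ?_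
    have hu := hCU (hVC huV)
    have d := (H.hasDerivAt_norm_sq_tension h₀.contDiffOn h₁.contDiffOn (V := V)
      (fun _ _ ↦ rfl) ⟨u, hu⟩).const_mul (volDensity x₀ u)
    simp only [locBienergyDensity, H.frame.locTension_eq _ hu]
    rw [d.deriv, hPu ⟨u, hu⟩]
    exact mul_left_comm _ _ _
  rw [h2, integral_const_mul] at h
  linarith

end EulerLagrange

/-! ### Existence of adapted frames. -/

section Existence

variable {E F : Type*} [NormedAddCommGroup E] [NormedSpace ℝ E] [FiniteDimensional ℝ E]
  [NormedAddCommGroup F] [NormedSpace ℝ F] [FiniteDimensional ℝ F]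
  {U : Set E} {g : E → E →L[ℝ] E →L[ℝ] ℝ} {Γ : E → E →L[ℝ] E →L[ℝ] E}

/-- The vector field that is dual, with respect to the metric, to a smooth one-form. -/
theorem IsLocalMetric.exists_dual (h : IsLocalMetric U g Γ) {l : E → E →L[ℝ] ℝ}
    (hl : ContDiffOn ℝ ∞ l U) :
    ∃ X : E → E, ContDiffOn ℝ ∞ X U ∧ ∀ u ∈ U, ∀ a, g u (X u) a = l u a := by
  have hc : CompleteSpace E := FiniteDimensional.complete ℝ E
  have hfd : FiniteDimensional ℝ (E →L[ℝ] ℝ) := inferInstance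
  have hdim : Module.finrank ℝ E = Module.finrank ℝ (E →L[ℝ] ℝ) := by
    rw [(LinearMap.toContinuousLinearMap (𝕜 := ℝ) (E := E) (F' := ℝ)).symm.finrank_eq]
    exact (Subspace.dual_finrank_eq (K := ℝ) (V := E)).symm
  have hequiv : ∀ u ∈ U, ∃ e : E ≃L[ℝ] (E →L[ℝ] ℝ), (e : E →L[ℝ] E →L[ℝ] ℝ) = g u := by
    intro u hu
    have hinj : Function.Injective (g u) := by
      refine (injective_iff_map_eq_zero (g u)).2 fun a ha ↦ by_contra fun h0 ↦ ?_
      have := h.pos u hu a h0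
      rw [ha] at this
      simp at this
    refine ⟨(LinearEquiv.ofInjectiveOfFinrankEq (g u : E →ₗ[ℝ] E →L[ℝ] ℝ)
      hinj hdim).toContinuousLinearEquiv, ?_⟩
    ext a b
    rfl
  refine ⟨fun u ↦ ContinuousLinearMap.inverse (g u) (l u), fun u hu ↦ ?_, fun u hu a ↦ ?_⟩
  · obtain ⟨e, he⟩ := hequiv u hu
    have h1 : ContDiffAt ℝ ∞ (ContinuousLinearMap.inverse : (E →L[ℝ] (E →L[ℝ] ℝ)) → _) (g u) := by
      rw [← he]
      exact contDiffAt_map_inverse e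
    exact (h1.comp_contDiffWithinAt u (h.contDiffOn u hu)).clm_apply (hl u hu)
  · obtain ⟨e, he⟩ := hequiv u hu
    simp only [← he, ContinuousLinearMap.inverse_equiv, ContinuousLinearEquiv.coe_coe,
      ContinuousLinearEquiv.apply_symm_apply]

/-- Normalization of a vector field without zeros. -/
theorem IsLocalMetric.exists_normalize (h : IsLocalMetric U g Γ) {X : E → E}
    (hX : ContDiffOn ℝ ∞ X U) (hX0 : ∀ u ∈ U, X u ≠ 0) :
    ∃ f : E → ℝ, ContDiffOn ℝ ∞ (fun u ↦ f u • X u) U ∧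
      ∀ u ∈ U, g u (f u • X u) (f u • X u) = 1 := by
  have hp : ∀ u ∈ U, 0 < g u (X u) (X u) := fun u hu ↦ h.pos u hu _ (hX0 u hu)
  have hs : ContDiffOn ℝ ∞ (fun u ↦ √(g u (X u) (X u))) U :=
    ((h.contDiffOn.clm_apply hX).clm_apply hX).sqrt fun u hu ↦ (hp u hu).ne'
  have hs0 : ∀ u ∈ U, √(g u (X u) (X u)) ≠ 0 := fun u hu ↦ (Real.sqrt_pos.2 (hp u hu)).ne'
  refine ⟨fun u ↦ (√(g u (X u) (X u)))⁻¹, (hs.inv hs0).smul hX, fun u hu ↦ ?_⟩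
  rw [(g u).map_smul, smul_apply, map_smul, smul_eq_mul, smul_eq_mul]
  have h1 := Real.mul_self_sqrt (hp u hu).le
  have h2 := hs0 u hu
  field_simp
  rw [sq, h1]

theorem IsOrthonormalFrame.of_inner {ι : Type*} [Fintype ι] [DecidableEq ι]
    (hι : Fintype.card ι = Module.finrank ℝ E) {e : ι → E → E}
    (he : ∀ i, ContDiffOn ℝ ∞ (e i) U)
    (h : ∀ u ∈ U, ∀ i j, g u (e i u) (e j u) = if i = j then 1 else 0) :
    IsOrthonormalFrame U g e where
  contDiffOn := he
  inner := h
  sum_eq u hu a := by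
    have key : ∀ (c : ι → ℝ) j, g u (∑ i, c i • e i u) (e j u) = c j := fun c j ↦ by
      simp only [map_sum, sum_apply, (g u).map_smul, smul_apply, h u hu, smul_eq_mul, mul_ite,
        mul_one, mul_zero, Finset.sum_ite_eq', Finset.mem_univ, if_true]
    have hli : LinearIndependent ℝ fun i ↦ e i u :=
      Fintype.linearIndependent_iff.2 fun c hc j ↦ by rw [← key c j, hc]; simp
    have hsp := hli.span_eq_top_of_card_eq_finrank' hι
    obtain ⟨c, rfl⟩ := (Submodule.mem_span_range_iff_exists_fun ℝ).1
      (hsp ▸ Submodule.mem_top : a ∈ Submodule.span ℝ (Set.range fun i ↦ e i u))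
    simp only [key]

/-- Gram-Schmidt applied to the two constant fields of a basis, which stay independent on all of
`U`. -/
theorem IsLocalMetric.exists_frame_two (h : IsLocalMetric U g Γ)
    (hE : Module.finrank ℝ E = 2) : ∃ e : Fin 2 → E → E, IsOrthonormalFrame U g e := by
  set b := Module.finBasisOfFinrankEq ℝ E hE
  obtain ⟨f, hf, hf1⟩ := h.exists_normalize (X := fun _ ↦ b 0) contDiffOn_const
    fun _ _ ↦ b.ne_zero 0
  set e₀ : E → E := fun u ↦ f u • b 0 with he₀
  have hw : ContDiffOn ℝ ∞ (fun u ↦ b 1 - g u (b 1) (e₀ u) • e₀ u) U :=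
    contDiffOn_const.sub (((h.contDiffOn.clm_apply contDiffOn_const).clm_apply hf).smul hf)
  obtain ⟨f', hf', hf1'⟩ := h.exists_normalize hw fun u hu h0 ↦ by
    have hli := b.linearIndependent
    have hb : LinearIndependent ℝ ![b 0, b 1] := by
      convert hli using 1
      ext i
      fin_cases i <;> rfl
    have := LinearIndependent.pair_iff.1 hb (-(g u (b 1) (e₀ u) * f u)) 1 (by
      rw [← h0, he₀]
      module)
    exact one_ne_zero this.2
  have h01 : ∀ u ∈ U, g u (e₀ u) (f' u • (b 1 - g u (b 1) (e₀ u) • e₀ u)) = 0 := fun u hu ↦ by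
    have h1 : g u (e₀ u) (e₀ u) = 1 := hf1 u hu
    rw [(g u (e₀ u)).map_smul, (g u (e₀ u)).map_sub, (g u (e₀ u)).map_smul, h1,
      h.symm u hu (e₀ u)]
    simp
  refine ⟨![e₀, fun u ↦ f' u • (b 1 - g u (b 1) (e₀ u) • e₀ u)],
    IsOrthonormalFrame.of_inner (by simp [hE]) (fun i ↦ ?_) fun u hu i j ↦ ?_⟩
  · fin_cases i
    exacts [hf, hf']
  · fin_cases i <;> fin_cases j
    · exact hf1 u hu
    · exact h01 u hu
    · exact (h.symm u hu _ _).trans (h01 u hu)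
    · exact hf1' u hu

variable {U' : Set F} {g' : F → F →L[ℝ] F →L[ℝ] ℝ} {Γ' : F → F →L[ℝ] F →L[ℝ] F} {ψ : E → F}

/-- A Riemannian submersion from a space of dimension three to a surface admits adapted frames. -/
theorem exists_isAdaptedFrame (hE : Module.finrank ℝ E = 3) (hF : Module.finrank ℝ F = 2)
    (h : IsLocalMetric U g Γ) (h' : IsLocalMetric U' g' Γ') (hψ : ContDiffOn ℝ ∞ ψ U)
    (hψU : Set.MapsTo ψ U U') (hlift : ∀ u ∈ U, ∀ w, ∃ x, fderiv ℝ ψ u x = w ∧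
      ∀ a, g u x a = g' (ψ u) w (fderiv ℝ ψ u a)) {u₀ : E} (hu₀ : u₀ ∈ U) :
    ∃ (V : TopologicalSpace.Opens E) (e : Fin 3 → E → E) (ε : Fin 2 → F → F),
      u₀ ∈ V ∧ (V : Set E) ⊆ U ∧ IsAdaptedFrame V g Γ U' g' Γ' ψ e ε := by
  obtain ⟨ε, hε⟩ := h'.exists_frame_two hF
  have hεψ : ∀ k, ContDiffOn ℝ ∞ (fun u ↦ g' (ψ u) (ε k (ψ u))) U := fun k ↦
    (h'.contDiffOn.clm_apply (hε.contDiffOn k)).comp hψ hψU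
  -- The horizontal lift of `ε k` is dual to the one-form `a ↦ g'(ε k, dψ a)`. Duality gives
  -- smoothness; the pointwise lifts from `hlift` show that the dual field does project to `ε k`.
  have hX := fun k ↦ h.exists_dual (l := fun u ↦ (g' (ψ u) (ε k (ψ u))).comp (fderiv ℝ ψ u))
    ((hεψ k).clm_comp (contDiffOn_fderiv h.isOpen hψ))
  choose X hXs hXd using hX
  simp only [ContinuousLinearMap.comp_apply] at hXd
  have hdX : ∀ k, ∀ u ∈ U, fderiv ℝ ψ u (X k u) = ε k (ψ u) := fun k u hu ↦ by
    obtain ⟨x, hx, hxa⟩ := hlift u hu (ε k (ψ u))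
    have : X k u - x = 0 := by_contra fun h0 ↦ by
      have h1 := h.pos u hu _ h0
      rw [(g u).map_sub, sub_apply, hXd k u hu, hxa, sub_self] at h1
      exact lt_irrefl _ h1
    rw [sub_eq_zero.1 this, hx]
  have hXX : ∀ u ∈ U, ∀ k l, g u (X k u) (X l u) = if k = l then 1 else 0 := fun u hu k l ↦ by
    rw [hXd k u hu, hdX l u hu, hε.inner _ (hψU hu)]
  obtain ⟨v, hv, hv0⟩ := (Submodule.ne_bot_iff _).1
    (LinearMap.ker_ne_bot_of_finrank_lt (f := (fderiv ℝ ψ u₀ : E →ₗ[ℝ] F)) (by rw [hE, hF]; norm_num))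
  have hv : fderiv ℝ ψ u₀ v = 0 := hv
  -- The vertical field is the constant field `v` minus its horizontal part. At `u₀` it equals `v`,
  -- which lies in the kernel there, so it has no zero nearby; this is why the frame exists only on
  -- a smaller open set.
  set w : E → E := fun u ↦ v - (g u (X 0 u) v • X 0 u + g u (X 1 u) v • X 1 u) with hw
  have hws : ContDiffOn ℝ ∞ w U := contDiffOn_const.sub
    ((((h.contDiffOn.clm_apply (hXs 0)).clm_apply contDiffOn_const).smul (hXs 0)).add
      (((h.contDiffOn.clm_apply (hXs 1)).clm_apply contDiffOn_const).smul (hXs 1)))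
  have hw0 : w u₀ ≠ 0 := by
    simp only [hw, hXd _ u₀ hu₀, hv, map_zero, zero_smul, add_zero, sub_zero]
    exact hv0
  have hVo : IsOpen (U ∩ w ⁻¹' {0}ᶜ) :=
    hws.continuousOn.isOpen_inter_preimage h.isOpen isOpen_compl_singleton
  have hVU : U ∩ w ⁻¹' {0}ᶜ ⊆ U := Set.inter_subset_left
  obtain ⟨f, hf, hf1⟩ := (h.mono hVo hVU).exists_normalize (hws.mono hVU) fun u hu ↦ hu.2
  have hXw : ∀ u ∈ U, ∀ k, g u (X k u) (f u • w u) = 0 := fun u hu k ↦ by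
    fin_cases k <;> simp [hw, hXX u hu]
  have hall : ∀ u ∈ U ∩ w ⁻¹' {0}ᶜ, ∀ i j, g u (![X 0, X 1, fun u ↦ f u • w u] i u)
      (![X 0, X 1, fun u ↦ f u • w u] j u) = if i = j then 1 else 0 := by
    intro u hu i j
    have hs := fun k ↦ (h.symm u hu.1 _ _).trans (hXw u hu.1 k)
    fin_cases i <;> fin_cases j
    · exact hXX u hu.1 0 0
    · exact hXX u hu.1 0 1
    · exact hXw u hu.1 0
    · exact hXX u hu.1 1 0
    · exact hXX u hu.1 1 1
    · exact hXw u hu.1 1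
    · exact hs 0
    · exact hs 1
    · exact hf1 u hu
  refine ⟨⟨U ∩ w ⁻¹' {0}ᶜ, hVo⟩, ![X 0, X 1, fun u ↦ f u • w u], ε, ⟨hu₀, hw0⟩, hVU, ?_⟩
  refine ⟨h.mono hVo hVU, h', hψ.mono hVU, fun u hu ↦ hψU hu.1,
    IsOrthonormalFrame.of_inner (by simp [hE]) (fun i ↦ ?_) hall, hε, fun u hu a k ↦ ?_⟩
  · fin_cases i
    exacts [(hXs 0).mono hVU, (hXs 1).mono hVU, hf]
  · have h1 := hXd k u hu.1 a
    rw [h.symm u hu.1, h'.symm _ (hψU hu.1), ← h1]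
    fin_cases k <;> rfl

end Existence

/-! ### Biharmonic submersions from a space form are harmonic. -/

section Converse

/-- The ring of smooth functions is not a domain, but a function without zeros is not a zero
divisor; this is what the algebraic contradiction asks of σ and `|κ|²`. -/
theorem SmoothFun.eq_zero_of_mul_eq_zero {E : Type*} [NormedAddCommGroup E] [NormedSpace ℝ E]
    {U : TopologicalSpace.Opens E} {f : SmoothFun U} (hf : ∀ u : U, (f : U → ℝ) u ≠ 0)
    {x : SmoothFun U} (h : f * x = 0) : x = 0 :=
  SmoothFun.ext_apply fun u ↦
    (mul_eq_zero.1 (congrArg (fun y : SmoothFun U ↦ (y : U → ℝ) u) h)).resolve_left (hf u)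

variable {M : Type*} [TopologicalSpace M] [ChartedSpace (EuclideanSpace ℝ (Fin 3)) M]
  [IsManifold (𝓡 3) ∞ M] [RiemannianBundle (fun x : M ↦ TangentSpace (𝓡 3) x)]
  [IsContMDiffRiemannianBundle (𝓡 3) ∞ (EuclideanSpace ℝ (Fin 3))
    (fun x : M ↦ TangentSpace (𝓡 3) x)]
  {N : Type*} [TopologicalSpace N] [ChartedSpace (EuclideanSpace ℝ (Fin 2)) N]
  [IsManifold (𝓡 2) ∞ N] [RiemannianBundle (fun y : N ↦ TangentSpace (𝓡 2) y)]
  [IsContMDiffRiemannianBundle (𝓡 2) ∞ (EuclideanSpace ℝ (Fin 2))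
    (fun y : N ↦ TangentSpace (𝓡 2) y)]
  {φ : M → N} {x₀ : M} {y₀ : N} {e : Fin 3 → EuclideanSpace ℝ (Fin 3) → EuclideanSpace ℝ (Fin 3)}
  {ε : Fin 2 → EuclideanSpace ℝ (Fin 2) → EuclideanSpace ℝ (Fin 2)}
  [T2Space M] [MeasurableSpace M] [BorelSpace M]

/-- The fibres of a biharmonic Riemannian submersion from a space form are minimal. -/
theorem IsBiharmonicMap.connCoeff_eq_zero (hbi : IsBiharmonicMap 3 2 φ)
    (hφ : ContMDiff (𝓡 3) (𝓡 2) ∞ φ) {c : ℝ} (hM : HasConstantSectionalCurvature 3 M c)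
    {U : TopologicalSpace.Opens (EuclideanSpace ℝ (Fin 3))}
    (hU : (U : Set (EuclideanSpace ℝ (Fin 3))) ⊆ locDom 3 2 φ x₀ y₀)
    {U' : Set (EuclideanSpace ℝ (Fin 2))}
    (H : IsAdaptedFrame U (metricBil x₀) (chrMap x₀) U' (metricBil y₀) (chrMap y₀)
      (locMap 3 2 φ x₀ y₀) e ε) {u : EuclideanSpace ℝ (Fin 3)} (hu : u ∈ U) :
    connCoeff (metricBil x₀) (chrMap x₀) e 2 2 0 u = 0 ∧
      connCoeff (metricBil x₀) (chrMap x₀) e 2 2 1 u = 0 := by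
  set k := fun i ↦ connCoeff (metricBil x₀) (chrMap x₀) e 2 2 i with hk
  set s := connCoeff (metricBil x₀) (chrMap x₀) e 0 2 1 with hs
  have hkU : ∀ i, ContDiffOn ℝ ∞ (k i) U := fun i ↦ H.frame.contDiffOn_connCoeff H.metric 2 2 i
  have hsU : ContDiffOn ℝ ∞ s U := H.frame.contDiffOn_connCoeff H.metric 0 2 1
  by_contra hne
  have hopen : ∀ {f : EuclideanSpace ℝ (Fin 3) → ℝ} {W : Set (EuclideanSpace ℝ (Fin 3))},
      IsOpen W → W ⊆ U → ContDiffOn ℝ ∞ f U → IsOpen (W ∩ f ⁻¹' {0}ᶜ) := fun hW hWU hf ↦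
    (hf.continuousOn.mono hWU).isOpen_inter_preimage hW isOpen_compl_singleton
  set V := (U : Set (EuclideanSpace ℝ (Fin 3))) ∩ (fun w ↦ k 0 w ^ 2 + k 1 w ^ 2) ⁻¹' {0}ᶜ with hV
  have hVo : IsOpen V := hopen U.isOpen le_rfl (((hkU 0).pow 2).add ((hkU 1).pow 2))
  have hVU : V ⊆ U := Set.inter_subset_left
  have huV : u ∈ V := ⟨hu, fun h ↦ hne (by
    have h : k 0 u ^ 2 + k 1 u ^ 2 = 0 := h
    exact ⟨by change k 0 u = 0; nlinarith, by change k 1 u = 0; nlinarith⟩)⟩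
  -- Either σ vanishes on all of `V`, or it is nonzero at some point and hence on an open part of
  -- `V`. A contradiction on any nonempty open subset suffices, so `W` need not contain `u`.
  obtain ⟨W, hWo, hWV, hWne, hW⟩ : ∃ W : Set (EuclideanSpace ℝ (Fin 3)), IsOpen W ∧ W ⊆ V ∧
      W.Nonempty ∧ ((∀ w ∈ W, s w ≠ 0) ∨ ∀ w ∈ W, s w = 0) := by
    by_cases h : ∀ w ∈ V, s w = 0
    · exact ⟨V, hVo, le_rfl, ⟨u, huV⟩, Or.inr h⟩
    · push Not at h
      obtain ⟨w, hw, hsw⟩ := h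
      exact ⟨V ∩ s ⁻¹' {0}ᶜ, hopen hVo hVU hsU, Set.inter_subset_left, ⟨w, hw, hsw⟩,
        Or.inl fun w hw ↦ hw.2⟩
  have hWU := hWV.trans hVU
  let W' : TopologicalSpace.Opens (EuclideanSpace ℝ (Fin 3)) := ⟨W, hWo⟩
  have HW : IsAdaptedFrame W' (metricBil x₀) (chrMap x₀) U' (metricBil y₀) (chrMap y₀)
    (locMap 3 2 φ x₀ y₀) e ε := H.mono hWo hWU
  have hJ := hbi.jac_kappa_eq_zero hφ (U := W') (hWU.trans hU) HW
  have S := HW.structureEquations (c := c) fun w hw x y z ↦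
    curv_of_hasConstantSectionalCurvature hM (locDom_subset φ x₀ y₀ (hU (hWU hw))) x y z
  -- Makes the ring of smooth functions on `W` nontrivial.
  have : Nonempty W' := ⟨⟨hWne.some, hWne.some_mem⟩⟩
  have hp : ∀ x, x * (HW.kappa 0 ^ 2 + HW.kappa 1 ^ 2) = 0 → x = 0 := fun x hx ↦
    SmoothFun.eq_zero_of_mul_eq_zero (fun w ↦ (hWV w.2).2) ((mul_comm _ _).trans hx)
  rcases hW with hW | hW
  · exact S.false_of_sigma_ne_zero (fun x ↦ SmoothFun.eq_zero_of_mul_eq_zero fun w ↦ hW w w.2)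
      hp hJ.1 hJ.2
  · exact S.false_of_sigma_eq_zero (SmoothFun.ext_apply fun w ↦ hW w w.2) hp hJ.1 hJ.2

theorem IsBiharmonicMap.isHarmonicMap (hbi : IsBiharmonicMap 3 2 φ)
    (hφ : IsRiemannianSubmersion 3 2 φ) {c : ℝ} (hM : HasConstantSectionalCurvature 3 M c) :
    IsHarmonicMap 3 2 φ := by
  intro x
  have hD := isOpen_locDom (m := 3) (n := 2) hφ.contMDiff.continuous x (φ x)
  obtain ⟨V, e, ε, huV, hVD, H⟩ := exists_isAdaptedFrame (by simp) (by simp)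
    ((isLocalMetric (m := 3) x).mono hD (locDom_subset φ x (φ x))) (isLocalMetric (m := 2) (φ x))
    (contDiffOn_locMap hφ.contMDiff x (φ x)) (mapsTo_locMap φ x (φ x))
    (fun u hu w ↦ hφ.exists_lift x (φ x) hu w) (mem_locDom_self φ x)
  have h := hbi.connCoeff_eq_zero hφ.contMDiff hM hVD H huV
  rw [tensionField_eq hφ.contMDiff, H.frame.locTension_eq _ huV, H.sum_sff_eq huV, secAlong,
    h.1, h.2]
  simp

end Converse

end RiemGeom

end

theorem theorem3p3
    {M : Type*} [TopologicalSpace M] [T2Space M] [SecondCountableTopology M]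
    [ChartedSpace (EuclideanSpace ℝ (Fin 3)) M] [IsManifold (𝓡 3) ∞ M]
    [RiemannianBundle (fun x : M ↦ TangentSpace (𝓡 3) x)]
    [IsContMDiffRiemannianBundle (𝓡 3) ∞ (EuclideanSpace ℝ (Fin 3))
      (fun x : M ↦ TangentSpace (𝓡 3) x)]
    [MeasurableSpace M] [BorelSpace M]
    {N : Type*} [TopologicalSpace N] [T2Space N] [SecondCountableTopology N]
    [ChartedSpace (EuclideanSpace ℝ (Fin 2)) N] [IsManifold (𝓡 2) ∞ N]
    [RiemannianBundle (fun y : N ↦ TangentSpace (𝓡 2) y)]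
    [IsContMDiffRiemannianBundle (𝓡 2) ∞ (EuclideanSpace ℝ (Fin 2))
      (fun y : N ↦ TangentSpace (𝓡 2) y)]
    (c : ℝ) (hM : RiemGeom.HasConstantSectionalCurvature 3 M c)
    (φ : M → N) (hφ : RiemGeom.IsRiemannianSubmersion 3 2 φ) :
    RiemGeom.IsBiharmonicMap 3 2 φ ↔ RiemGeom.IsHarmonicMap 3 2 φ :=
  ⟨fun h ↦ h.isHarmonicMap hφ hM, RiemGeom.IsHarmonicMap.isBiharmonicMap⟩
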